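/- Let $X$ be a smooth variety of dimension $n$ over $\mathbb C$ (a separated quasi-compact scheme, smooth of relative dimension $n$ over $\mathbb C$), with cotangent bundle $\Omega^1_X$ and tangent bundle $T_X$. For a vector bundle $E$ on $X$, let $\pi_d\colon \mathrm{Gr}_d(E)\to X$ be the Grassmann bundle of rank $d$ subbundles of $E$, with its universal sequence $0\to S_d\to\pi_d^*E\to Q_d\to 0$; it is the $X$-scheme such that for every $f\colon T\to X$ each rank $d$ subbundle of $f^*E$ (locally free of rank $d$, with locally free quotient) is $g^*S_d$ for a unique $X$-morphism $g\colon T\to \mathrm{Gr}_d(E)$. For a Higgs bundle $\mathfrak E=(E,\phi)$, $\phi\colon E\to E\otimes\Omega^1_X$, the Higgs Grassmannian $\mathrm{Hgrass}_d(\mathfrak E)$ is the closed subscheme of $\mathrm{Gr}_d(E)$ defined as the zero locus of the composition $$S_d\to\pi_d^*E\xrightarrow{\pi_d^*\phi}\pi_d^*E\otimes\Omega^1_{\mathrm{Gr}_d(E)}\to Q_d\otimes\Omega^1_{\mathrm{Gr}_d(E)},$$ and $\mathrm{Hgrass}_d(\mathfrak E)_{\mathrm{red}}$ is its reduction. Let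 $\mathfrak S=(S,\phi)$ be the Simpson system of $X$: $S=\mathcal O_X\oplus\Omega^1_X$ and $\phi(f,\omega)=(\omega,0)$, i.e. $\phi(f,\omega)=(1,0)\otimes\omega\in S\otimes\Omega^1_X$. Then the Grassmann bundles below exist, and: 1. $\mathrm{Hgrass}_1(\mathfrak S)_{\mathrm{red}}\cong X$, where the isomorphism is given by the section $X\to \mathrm{Gr}_1(S)=\mathbb P S$ corresponding to the subbundle $\mathcal O_X\subset S$: this section induces an isomorphism of $X$ onto $\mathrm{Hgrass}_1(\mathfrak S)_{\mathrm{red}}$. 2. For $2\le d\le n$ there are isomorphisms of $X$-schemes $$\mathrm{Hgrass}_d(\mathfrak S)_{\mathrm{red}}\cong \mathrm{Gr}_{d-1}(\Omega^1_X)\cong \mathrm{Gr}_{n+1-d}(T_X).$$ -/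

import Mathlib

open CategoryTheory Limits AlgebraicGeometry MonoidalCategory

noncomputable section

namespace HiggsGrass

section Sheafification

/-- Presheaves of `𝒪_X`-modules. -/
abbrev PreMod (X : Scheme.{0}) :=
  PresheafOfModules.{0} (X.presheaf ⋙ forget₂ CommRingCat RingCat)

def sheafification (X : Scheme.{0}) : PreMod X ⥤ X.Modules :=
  (PresheafOfModules.sheafification (𝟙 X.ringCatSheaf.obj) : X.PresheafOfModules ⥤ X.Modules)

def toPreMod (X : Scheme.{0}) : X.Modules ⥤ PreMod X := Scheme.Modules.toPresheafOfModules X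

def sheafificationAdj (X : Scheme.{0}) : sheafification X ⊣ toPreMod X :=
  PresheafOfModules.sheafificationAdjunction (𝟙 X.ringCatSheaf.obj)

abbrev sheafify {X : Scheme.{0}} (P : PreMod X) : X.Modules := (sheafification X).obj P

abbrev pre {X : Scheme.{0}} (M : X.Modules) : PreMod X := (toPreMod X).obj M

abbrev preMap {X : Scheme.{0}} {M N : X.Modules} (f : M ⟶ N) : pre M ⟶ pre N :=
  (toPreMod X).map f

abbrev toSheafify {X : Scheme.{0}} (P : PreMod X) : P ⟶ pre (sheafify P) :=
  (sheafificationAdj X).unit.app P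

abbrev sheafifyDesc {X : Scheme.{0}} {P : PreMod X} {M : X.Modules} (f : P ⟶ pre M) :
    sheafify P ⟶ M :=
  ((sheafificationAdj X).homEquiv P M).symm f

end Sheafification

section Tensor

variable {X : Scheme.{0}}

/-- The tensor product `M ⊗ N` of `𝒪_X`-modules: the sheaf associated with
`U ↦ M(U) ⊗ N(U)`. -/
def tensor (M N : X.Modules) : X.Modules :=
  sheafify (pre M ⊗ pre N)

/-- The morphism `f ⊗ g`. -/
def tensorMap {M M' N N' : X.Modules} (f : M ⟶ M') (g : N ⟶ N') :
    tensor M N ⟶ tensor M' N' :=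
  (sheafification X).map (preMap f ⊗ₘ preMap g)

/-- `𝒪_X` as a module over itself. -/
def structureSheaf (X : Scheme.{0}) : X.Modules := SheafOfModules.unit X.ringCatSheaf

/-- The canonical morphism `N ⟶ 𝒪_X ⊗ N`, `n ↦ 1 ⊗ n`. -/
def leftUnitorInv (N : X.Modules) : N ⟶ tensor (structureSheaf X) N :=
  Scheme.Modules.fullyFaithfulToPresheafOfModules.preimage
    ((λ_ (pre N)).inv ≫ toSheafify (pre (structureSheaf X) ⊗ pre N))

lemma tensorMap_comp {M M' M'' N N' N'' : X.Modules} (f : M ⟶ M') (g : N ⟶ N')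
    (f' : M' ⟶ M'') (g' : N' ⟶ N'') :
    tensorMap f g ≫ tensorMap f' g' = tensorMap (f ≫ f') (g ≫ g') := by
  have h : (preMap f ⊗ₘ preMap g) ≫ (preMap f' ⊗ₘ preMap g') =
      preMap (f ≫ f') ⊗ₘ preMap (g ≫ g') := by
    rw [MonoidalCategory.tensorHom_comp_tensorHom, ← Functor.map_comp, ← Functor.map_comp]
  exact ((sheafification X).map_comp _ _).symm.trans (congrArg (sheafification X).map h)

lemma zero_tensorMap {M M' N N' : X.Modules} (g : N ⟶ N') :
    tensorMap (0 : M ⟶ M') g = 0 := by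
  have h : preMap (0 : M ⟶ M') ⊗ₘ preMap g = 0 := by
    ext1 U
    exact ModuleCat.MonoidalCategory.tensor_ext (fun m n => TensorProduct.zero_tmul _ _)
  have : (sheafification X).IsLeftAdjoint := (sheafificationAdj X).isLeftAdjoint
  have : (sheafification X).PreservesZeroMorphisms := inferInstance
  exact (congrArg (sheafification X).map h).trans (Functor.map_zero (sheafification X) _ _)

end Tensor

section Differentials

variable {X : Scheme.{0}}

/-- The structure morphism of a `ℂ`-scheme, as a morphism from the constant presheaf `ℂ` to
`𝒪_X`. -/
def scalars (p : X ⟶ Spec (.of ℂ)) :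
    (Functor.const X.Opensᵒᵖ).obj (CommRingCat.of ℂ) ⟶ X.presheaf where
  app U := (Scheme.ΓSpecIso (.of ℂ)).inv ≫ p.appTop ≫ X.presheaf.map (homOfLE le_top).op
  naturality U V i := by
    simp [← Functor.map_comp]
    rfl

/-- The cotangent sheaf `Ω¹_X` of a `ℂ`-scheme: the sheaf associated with the presheaf
`U ↦ Ω_{𝒪(U)/ℂ}` of Kähler differentials. -/
def cotangent (p : X ⟶ Spec (.of ℂ)) : X.Modules :=
  sheafify (PresheafOfModules.DifferentialsConstruction.relativeDifferentials' (scalars p))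

end Differentials

section Hom
variable {X : Scheme.{0}} (M N : X.Modules)

/-- Sections over `U` of the sheaf `ℋom(M, N)`: families of `𝒪(V)`-linear maps `M(V) → N(V)`,
for `V ⊆ U` open, compatible with restriction. -/
def homSections (U : X.Opens) :
    AddSubgroup (∀ V : {V : X.Opens // V ≤ U}, Γ(M, V.1) →ₗ[Γ(X, V.1)] Γ(N, V.1)) where
  carrier := { f | ∀ (V W : {V : X.Opens // V ≤ U}) (h : W.1 ≤ V.1) (s : Γ(M, V.1)),
    f W (M.presheaf.map (homOfLE h).op s) = N.presheaf.map (homOfLE h).op (f V s) }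
  zero_mem' := by intro V W h s; simp
  add_mem' := by intro f g hf hg V W h s; simp [hf V W h s, hg V W h s]
  neg_mem' := by intro f hf V W h s; simp [hf V W h s]

instance (U : X.Opens) : Module Γ(X, U) (homSections M N U) where
  smul r f := ⟨fun V => X.presheaf.map (homOfLE V.2).op r • f.1 V, by
    intro V W h s
    have e : X.presheaf.map (homOfLE W.2).op r =
        X.presheaf.map (homOfLE h).op (X.presheaf.map (homOfLE V.2).op r) := by
      rw [← CategoryTheory.comp_apply, ← Functor.map_comp]; rfl
    simp only [LinearMap.smul_apply, Scheme.Modules.map_smul]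
    rw [f.2 V W h s, e]⟩
  one_smul f := by
    ext V : 2; change X.presheaf.map (homOfLE V.2).op 1 • f.1 V = f.1 V; simp
  mul_smul a b f := by
    ext V : 2
    change X.presheaf.map (homOfLE V.2).op (a * b) • f.1 V =
      X.presheaf.map (homOfLE V.2).op a • X.presheaf.map (homOfLE V.2).op b • f.1 V
    simp [mul_smul]
  smul_zero a := by
    ext V : 2; change X.presheaf.map (homOfLE V.2).op a • (0 : Γ(M, V.1) →ₗ[Γ(X, V.1)] Γ(N, V.1)) = 0
    simp
  smul_add a f g := by
    ext V : 2
    change X.presheaf.map (homOfLE V.2).op a • (f.1 V + g.1 V) =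
      X.presheaf.map (homOfLE V.2).op a • f.1 V + X.presheaf.map (homOfLE V.2).op a • g.1 V
    simp
  add_smul a b f := by
    ext V : 2
    change X.presheaf.map (homOfLE V.2).op (a + b) • f.1 V =
      X.presheaf.map (homOfLE V.2).op a • f.1 V + X.presheaf.map (homOfLE V.2).op b • f.1 V
    simp [add_smul]
  zero_smul f := by
    ext V : 2; change X.presheaf.map (homOfLE V.2).op 0 • f.1 V = 0; simp

def homSectionsRes {U V : X.Opens} (h : V ≤ U) : homSections M N U →+ homSections M N V where
  toFun f := ⟨fun W => f.1 ⟨W.1, W.2.trans h⟩, fun W W' hW s =>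
    f.2 ⟨W.1, W.2.trans h⟩ ⟨W'.1, W'.2.trans h⟩ hW s⟩
  map_zero' := rfl
  map_add' _ _ := rfl

def homAbPresheaf : X.Opensᵒᵖ ⥤ Ab.{0} where
  obj U := .of (homSections M N U.unop)
  map i := AddCommGrpCat.ofHom (homSectionsRes M N (leOfHom i.unop))
  map_id _ := rfl
  map_comp _ _ := rfl

instance (U : X.Opensᵒᵖ) :
    Module ((X.presheaf ⋙ forget₂ CommRingCat RingCat).obj U) ((homAbPresheaf M N).obj U) :=
  inferInstanceAs (Module Γ(X, U.unop) (homSections M N U.unop))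

def homPresheaf : PreMod X :=
  PresheafOfModules.ofPresheaf (homAbPresheaf M N) (by
    intro U V i r f
    apply Subtype.ext
    funext W
    change X.presheaf.map (homOfLE (W.2.trans (leOfHom i.unop))).op r •
        f.1 ⟨W.1, W.2.trans (leOfHom i.unop)⟩ =
      X.presheaf.map (homOfLE W.2).op (X.presheaf.map i r) • f.1 ⟨W.1, W.2.trans (leOfHom i.unop)⟩
    congr 1
    rw [← CategoryTheory.comp_apply, ← Functor.map_comp]; rfl)

/-- The sheaf `ℋom(M, N)`. (The presheaf is already a sheaf, so that sheafifying it changes nothing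
up to isomorphism.) -/
def sheafHom : X.Modules := sheafify (homPresheaf M N)
end Hom

/-- The tangent sheaf `T_X`, the dual of `Ω¹_X`. -/
def tangent {X : Scheme.{0}} (p : X ⟶ Spec (.of ℂ)) : X.Modules :=
  sheafHom (cotangent p) (structureSheaf X)

section Pushforward
variable {X Y : Scheme.{0}} (f : Y ⟶ X)
open Scheme.Modules

/-- The section `m ⊗ n` of `M ⊗ N` given by sections `m` of `M` and `n` of `N`. -/
def tmulSection {M N : Y.Modules} (V : Y.Opens) :
    Γ(M, V) →ₗ[Γ(Y, V)] Γ(N, V) →ₗ[Γ(Y, V)] Γ(tensor M N, V) :=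
  (TensorProduct.mk Γ(Y, V) Γ(M, V) Γ(N, V)).compr₂ ((toSheafify (pre M ⊗ pre N)).app (.op V)).hom

lemma tmulSection_res {M N : Y.Modules} {V W : Y.Opens} (i : W ⟶ V) (m : Γ(M, V)) (n : Γ(N, V)) :
    (tensor M N).presheaf.map i.op (tmulSection V m n) =
      tmulSection W (M.presheaf.map i.op m) (N.presheaf.map i.op n) :=
  (PresheafOfModules.naturality_apply (toSheafify (pre M ⊗ pre N)) i.op
    (TensorProduct.tmul Γ(Y, V) m n)).symm

lemma app_smul' {M : X.Modules} {M' : Y.Modules} (α : M ⟶ (pushforward f).obj M') (U : X.Opens)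
    (r : Γ(X, U)) (m : Γ(M, U)) :
    @Eq Γ(M', f ⁻¹ᵁ U) (α.app U (r • m)) (@HSMul.hSMul Γ(Y, f ⁻¹ᵁ U) Γ(M', f ⁻¹ᵁ U) _ _ (f.app U r) (α.app U m)) :=
  α.app_smul r m

lemma app_res {M : X.Modules} {M' : Y.Modules} (α : M ⟶ (pushforward f).obj M') {U V : X.Opens}
    (i : V ⟶ U) (m : Γ(M, U)) :
    (α.app V (M.presheaf.map i.op m) : Γ(M', f ⁻¹ᵁ V)) =
      M'.presheaf.map ((TopologicalSpace.Opens.map f.base).map i).op (α.app U m) :=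
  PresheafOfModules.naturality_apply α.val i.op m

/-- The morphism `M ⊗ N ⟶ f_*(M' ⊗ N')`, `m ⊗ n ↦ α(m) ⊗ β(n)`. -/
def tensorToPushforward {M N : X.Modules} {M' N' : Y.Modules}
    (α : M ⟶ (pushforward f).obj M') (β : N ⟶ (pushforward f).obj N') :
    tensor M N ⟶ (pushforward f).obj (tensor M' N') :=
  sheafifyDesc
    { app U := ModuleCat.MonoidalCategory.tensorLift
        (M₃ := (pre ((pushforward f).obj (tensor M' N'))).obj U)
        (fun m n => tmulSection (f ⁻¹ᵁ U.unop)
          (α.app U.unop m : Γ(M', f ⁻¹ᵁ U.unop)) (β.app U.unop n : Γ(N', f ⁻¹ᵁ U.unop)))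
        (fun m m' n => by
          have := map_add (α.app U.unop).hom m m'
          erw [this, map_add]; rfl)
        (fun r m n => by
          have := app_smul' f α U.unop r m
          erw [this, _root_.map_smul]; rfl)
        (fun m n n' => by
          have := map_add (β.app U.unop).hom n n'
          erw [this, map_add]; rfl)
        (fun r m n => by
          have := app_smul' f β U.unop r n
          erw [this, _root_.map_smul]; rfl)
      naturality {U V} i := ModuleCat.MonoidalCategory.tensor_ext (fun m n => by
        have h := tmulSection_res (M := M') (N := N') ((TopologicalSpace.Opens.map f.base).map i.unop)
          (α.app U.unop m) (β.app U.unop n)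
        have h1 := app_res f α i.unop m
        have h2 := app_res f β i.unop n
        refine Eq.trans ?_ h.symm
        refine Eq.trans ?_ (congrArg₂ (fun a b => tmulSection (f ⁻¹ᵁ V.unop) a b) h1 h2)
        rfl) }

open PresheafOfModules.DifferentialsConstruction in
/-- The exterior derivative `d : 𝒪_Y(V) → Ω¹_Y(V)`. -/
def dSection (q : Y ⟶ Spec (.of ℂ)) (V : Y.Opens) : Γ(Y, V) →+ Γ(cotangent q, V) :=
  ((toSheafify (relativeDifferentials' (scalars q))).app (.op V)).hom.toAddMonoidHom.comp
    (derivation' (scalars q)).d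

open PresheafOfModules.DifferentialsConstruction in
lemma dSection_mul (q : Y ⟶ Spec (.of ℂ)) (V : Y.Opens) (a b : Γ(Y, V)) :
    dSection q V (a * b) = a • dSection q V b + b • dSection q V a := by
  have h := (derivation' (scalars q)).d_mul (X := .op V) a b
  have := congrArg ((toSheafify (relativeDifferentials' (scalars q))).app (.op V)).hom h
  rw [map_add, _root_.map_smul, _root_.map_smul] at this
  exact this

open PresheafOfModules.DifferentialsConstruction in
lemma dSection_res (q : Y ⟶ Spec (.of ℂ)) {V W : Y.Opens} (i : W ⟶ V) (a : Γ(Y, V)) :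
    dSection q W (Y.presheaf.map i.op a) = (cotangent q).presheaf.map i.op (dSection q V a) := by
  have h := (derivation' (scalars q)).d_map i.op a
  have := congrArg ((toSheafify (relativeDifferentials' (scalars q))).app (.op W)).hom h
  exact this.trans (PresheafOfModules.naturality_apply
    (toSheafify (relativeDifferentials' (scalars q))) i.op ((derivation' (scalars q)).d a))

open PresheafOfModules.DifferentialsConstruction in
lemma dSection_scalars (q : Y ⟶ Spec (.of ℂ)) (V : Y.Opens) (z : ℂ) :
    dSection q V ((scalars q).app (.op V) z) = 0 := by
  have h := PresheafOfModules.Derivation'.d_app (derivation' (scalars q)) (X := .op V) z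
  have := congrArg ((toSheafify (relativeDifferentials' (scalars q))).app (.op V)).hom h
  rw [map_zero] at this
  exact this

lemma scalars_comp (p : X ⟶ Spec (.of ℂ)) (U : X.Opens) (z : ℂ) :
    f.app U ((scalars p).app (.op U) z) = (scalars (f ≫ p)).app (.op (f ⁻¹ᵁ U)) z := by
  have : (scalars p).app (.op U) ≫ f.app U = (scalars (f ≫ p)).app (.op (f ⁻¹ᵁ U)) := by
    simp [scalars]; rfl
  exact congr($this z)

/-- The canonical morphism `Ω¹_X ⟶ f_* Ω¹_Y`, `a db ↦ f^♯(a) d(f^♯ b)`, which is adjoint to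
`f^* Ω¹_X ⟶ Ω¹_Y`. -/
def pullbackForms (p : X ⟶ Spec (.of ℂ)) :
    cotangent p ⟶ (pushforward f).obj (cotangent (f ≫ p)) :=
  sheafifyDesc ((PresheafOfModules.DifferentialsConstruction.isUniversal' (scalars p)).desc
    (M' := pre ((pushforward f).obj (cotangent (f ≫ p))))
    { d {U} := (dSection (f ≫ p) (f ⁻¹ᵁ U.unop)).comp (f.app U.unop).hom.toAddMonoidHom
      d_mul {U} a b := by
        have := dSection_mul (f ≫ p) (f ⁻¹ᵁ U.unop) (f.app U.unop a) (f.app U.unop b)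
        rw [← map_mul] at this
        exact this
      d_map {U V} i a := by
        have := dSection_res (f ≫ p) ((TopologicalSpace.Opens.map f.base).map i.unop) (f.app U.unop a)
        refine Eq.trans ?_ this
        have h : f.app V.unop (X.presheaf.map i a) = _ := congr($(f.naturality i) a)
        exact congrArg (dSection (f ≫ p) (f ⁻¹ᵁ V.unop)) h
      d_app {U} z := by
        have := dSection_scalars (f ≫ p) (f ⁻¹ᵁ U.unop) z
        rw [← scalars_comp] at this
        exact this })

end Pushforward

section Higgs

variable {X : Scheme.{0}} {p : X ⟶ Spec (.of ℂ)}

/-- Pairs `(E, φ)` with `φ : E ⟶ E ⊗ Ω¹_X` are considered without the integrability condition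
`φ ∧ φ = 0`, on which the definition of the Higgs Grassmannian does not depend. -/
abbrev HiggsField (p : X ⟶ Spec (.of ℂ)) (E : X.Modules) := E ⟶ tensor E (cotangent p)

/-- The pulled back Higgs field `f^* φ : f^* E ⟶ f^* E ⊗ Ω¹_Y`, i.e. the composition
`f^* E ⟶ f^* (E ⊗ Ω¹_X) ≅ f^* E ⊗ f^* Ω¹_X ⟶ f^* E ⊗ Ω¹_Y`. It is defined here as the adjoint of
`E ⟶ E ⊗ Ω¹_X ⟶ f_* (f^* E ⊗ Ω¹_Y)`, the second arrow being `e ⊗ ω ↦ f^* e ⊗ f^* ω`. -/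
def HiggsField.pullback {Y : Scheme.{0}} (f : Y ⟶ X) {E : X.Modules} (φ : HiggsField p E) :
    HiggsField (f ≫ p) ((Scheme.Modules.pullback f).obj E) :=
  ((Scheme.Modules.pullbackPushforwardAdjunction f).homEquiv _ _).symm
    (φ ≫ tensorToPushforward f
      ((Scheme.Modules.pullbackPushforwardAdjunction f).unit.app E) (pullbackForms f p))

/-- The underlying module `𝒪_X ⊕ Ω¹_X` of the Simpson system. -/
abbrev simpson (p : X ⟶ Spec (.of ℂ)) : X.Modules := structureSheaf X ⊞ cotangent p

/-- The Higgs field `φ(f, ω) = (ω, 0)` of the Simpson system. As a section of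
`(𝒪_X ⊕ Ω¹_X) ⊗ Ω¹_X`, the right hand side is `(1, 0) ⊗ ω`. -/
def simpsonField (p : X ⟶ Spec (.of ℂ)) : HiggsField p (simpson p) :=
  biprod.snd ≫ leftUnitorInv (cotangent p) ≫ tensorMap biprod.inl (𝟙 (cotangent p))

/-- The Higgs field of the Simpson system satisfies `(φ ⊗ id) ∘ φ = 0`; in particular it is
integrable, `φ ∧ φ = 0`. -/
lemma simpson_integrable (p : X ⟶ Spec (.of ℂ)) :
    simpsonField p ≫ tensorMap (simpsonField p) (𝟙 (cotangent p)) = 0 := by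
  have h : (biprod.inl : structureSheaf X ⟶ structureSheaf X ⊞ cotangent p) ≫
      simpsonField p = 0 := by
    unfold simpsonField
    exact (biprod.inl_snd_assoc _).trans zero_comp
  have h2 := tensorMap_comp (biprod.inl : structureSheaf X ⟶ structureSheaf X ⊞ cotangent p)
    (𝟙 (cotangent p)) (simpsonField p) (𝟙 (cotangent p))
  rw [h, zero_tensorMap] at h2
  calc _ = biprod.snd ≫ leftUnitorInv (cotangent p) ≫ tensorMap
        (biprod.inl : structureSheaf X ⟶ structureSheaf X ⊞ cotangent p) (𝟙 (cotangent p)) ≫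
          tensorMap (simpsonField p) (𝟙 (cotangent p)) := by
        conv_lhs => arg 1; unfold simpsonField
        exact (Category.assoc _ _ _).trans (congrArg _ (Category.assoc _ _ _))
    _ = 0 := by
      rw [h2]
      exact (congrArg _ comp_zero).trans comp_zero

end Higgs

section Grassmann

/-- `M` is locally free of rank `r`. -/
def IsLocallyFreeOfRank {X : Scheme.{0}} (M : X.Modules) (r : ℕ) : Prop :=
  ∀ x : X, ∃ U : X.Opens, x ∈ U ∧ Nonempty (M.restrict U.ι ≅
    (SheafOfModules.free (R := (U : Scheme.{0}).ringCatSheaf) (Fin r) : (U : Scheme.{0}).Modules))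

/-- `M` is locally free of finite rank. -/
def IsVectorBundle {X : Scheme.{0}} (M : X.Modules) : Prop :=
  ∀ x : X, ∃ (U : X.Opens) (r : ℕ), x ∈ U ∧ Nonempty (M.restrict U.ι ≅
    (SheafOfModules.free (R := (U : Scheme.{0}).ringCatSheaf) (Fin r) : (U : Scheme.{0}).Modules))

/-- `i : F ⟶ E` is (the inclusion of) a rank `d` subbundle: `F` is locally free of rank `d` and
`E / F` is locally free of finite rank. -/
structure IsSubbundle {X : Scheme.{0}} {F E : X.Modules} (i : F ⟶ E) (d : ℕ) : Prop where
  mono : Mono i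
  rank : IsLocallyFreeOfRank F d
  quotient : IsVectorBundle (cokernel i)

/-- Given `a : S ⟶ π^* E` on `π : G ⟶ X`, the morphism `g : T ⟶ G` is a morphism over `X` from
`f : T ⟶ X` to `π`, and `g^* S = F` as subobjects of `g^* π^* E = f^* E`. -/
def Classifies {X G T : Scheme.{0}} {E : X.Modules} {π : G ⟶ X} {S : G.Modules}
    (a : S ⟶ (Scheme.Modules.pullback π).obj E) (g : T ⟶ G) (f : T ⟶ X) {F : T.Modules}
    (i : F ⟶ (Scheme.Modules.pullback f).obj E) : Prop :=
  ∃ (h : g ≫ π = f) (e : F ≅ (Scheme.Modules.pullback g).obj S),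
    i = e.hom ≫ (Scheme.Modules.pullback g).map a ≫
      (Scheme.Modules.pullbackComp g π).hom.app E ≫ (Scheme.Modules.pullbackCongr h).hom.app E

/-- The Grassmann bundle `Gr_d(E)` of rank `d` subbundles of `E`, with its tautological subbundle
`S_d ⊂ π^* E`: the `X`-scheme which represents the functor that sends `f : T ⟶ X` to the set of
rank `d` subbundles of `f^* E`. -/
structure GrassmannBundle {X : Scheme.{0}} (E : X.Modules) (d : ℕ) where
  total : Scheme.{0}
  proj : total ⟶ X
  taut : total.Modules
  incl : taut ⟶ (Scheme.Modules.pullback proj).obj E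
  isSubbundle : IsSubbundle incl d
  existsUnique : ∀ {T : Scheme.{0}} (f : T ⟶ X) {F : T.Modules}
    (i : F ⟶ (Scheme.Modules.pullback f).obj E), IsSubbundle i d →
      ∃! g : T ⟶ total, Classifies incl g f i

/-- The ideal sheaf of the zero locus of a morphism `ψ` of vector bundles, i.e. of the largest
closed subscheme to which `ψ` restricts as zero. -/
def zeroLocus {X : Scheme.{0}} {A B : X.Modules} (ψ : A ⟶ B) : X.IdealSheafData :=
  sInf {I | (Scheme.Modules.pullback I.subschemeι).map ψ = 0}

variable {X : Scheme.{0}} {p : X ⟶ Spec (.of ℂ)} {E : X.Modules} {d : ℕ}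

/-- The composition `S_d ⟶ π^* E ⟶ π^* E ⊗ Ω¹ ⟶ Q_d ⊗ Ω¹` on `Gr_d(E)`, where `Ω¹` is the
cotangent sheaf of `Gr_d(E)` and `Q_d = π^* E / S_d`. -/
def higgsObstruction (G : GrassmannBundle E d) (φ : HiggsField p E) :
    G.taut ⟶ tensor (cokernel G.incl) (cotangent (G.proj ≫ p)) :=
  G.incl ≫ φ.pullback G.proj ≫ tensorMap (cokernel.π G.incl) (𝟙 (cotangent (G.proj ≫ p)))

/-- The ideal sheaf of the Higgs Grassmannian as a closed subscheme of `Gr_d(E)`. -/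
def higgsIdeal (G : GrassmannBundle E d) (φ : HiggsField p E) : G.total.IdealSheafData :=
  zeroLocus (higgsObstruction G φ)

/-- The Higgs Grassmannian, a closed subscheme of `Gr_d(E)`. -/
def higgsGrassmannian (G : GrassmannBundle E d) (φ : HiggsField p E) : Scheme.{0} :=
  (higgsIdeal G φ).subscheme

/-- The reduction of the Higgs Grassmannian, the closed subscheme of `Gr_d(E)` defined by the
radical of its ideal sheaf. -/
def higgsGrassmannianRed (G : GrassmannBundle E d) (φ : HiggsField p E) : Scheme.{0} :=
  (higgsIdeal G φ).radical.subscheme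

/-- The inclusion of the reduced Higgs Grassmannian into `Gr_d(E)`. -/
def higgsGrassmannianRedι (G : GrassmannBundle E d) (φ : HiggsField p E) :
    higgsGrassmannianRed G φ ⟶ G.total :=
  (higgsIdeal G φ).radical.subschemeι

/-- The subbundle `𝒪_X` of the Simpson system, as a family over `𝟙 X`. -/
def simpsonLine (p : X ⟶ Spec (.of ℂ)) :
    structureSheaf X ⟶ (Scheme.Modules.pullback (𝟙 X)).obj (simpson p) :=
  biprod.inl ≫ (Scheme.Modules.pullbackId X).inv.app (simpson p)

end Grassmann

end HiggsGrass

end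

open CategoryTheory AlgebraicGeometry HiggsGrass

/-!
The argument works with sections over open sets. A *frame* of a module over an open set is a family
of sections that is a basis over all smaller open sets (`IsFrame`), and a *subbundle* of rank `d` is
a subsheaf that is spanned, locally, by the first `d` members of a frame (`SubMod.IsSub`,
`isSubbundle_iff`); pullbacks map frames to frames (`isBC_pullUnit`). In these terms a Grassmann
bundle is a scheme over `X` with a universal subsheaf (`IsUniversalSub`). Subbundles form a Zariski
sheaf (`isSheaf_famFunctor`), and locally a subbundle is the graph of a unique matrix with respect to
some arrangement of a given frame (`exists_mem_chartOpen`), so the sheaf is covered by affine spaces.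
This shows that Grassmann bundles of vector bundles exist and are smooth over `X`
(`exists_isUniversalSub`, `IsUniversalSub.smooth`).

Let `G` be a Grassmann bundle of subbundles of rank `d` of the Simpson system `𝒪 ⊕ Ω¹`, and `K` one
of subbundles of rank `d - 1` of `Ω¹`. Sending `F ⊂ Ω¹` to `𝒪 ⊕ F` defines a monomorphism
`j : K ⟶ G` (`IsConeMap`), which represents the condition that the section `1` of `𝒪` lies in the
subbundle (`IsConeMap.exists_fac_iff`). Choose locally on `G` a frame adapted to the universal
subbundle, let `y k` be the coordinates of `1` along its complementary part, and let `b i l` be the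
coordinates in `Ω¹` of the members of its first part. Then the image of `j` has the ideal `J`
generated by the `y k` (`IsConeMap.ker_ideal`). The obstruction that defines the Higgs Grassmannian
has the coordinates `b i l * y k` with respect to part of a frame, because a frame of `Ω¹_X` pulls
back to part of a frame of `Ω¹_G`, `G` being smooth over `X` (`exists_isFrame_pullbackForms`,
`ObstructionChart.cm_higgsObstruction_eq_zero_iff`). Hence the ideal `I` of the Higgs Grassmannian is
locally generated by the products `b i l * y k`, and `I ≤ J` (`IsConeMap.zeroLocus_le_ker`).

Conversely, if all `b i l * y k` vanish, each member of the frame of the universal subbundle that is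
multiplied by `y k` becomes a multiple of `1`; comparing coordinates, `y k * y k'` vanishes
(`mul_mem_of_mul_mem`), so that `J² ≤ I` (`IsConeMap.ker_sq_le`). Finally `K` is smooth over `ℂ` and
therefore reduced (`isReduced_of_smooth`), so `J` is its own radical and equals the radical of `I`.
So `j` is an isomorphism onto the reduced Higgs Grassmannian
(`IsConeMap.exists_iso_higgsGrassmannianRed`). For `d = 1` one takes `K = X`, which parametrizes the
zero subbundle (`isUniversalSub_id_zeroSub`), and `j` is the section given by `𝒪`.

The isomorphism `Gr_{d-1}(Ω¹) ≅ Gr_{n+1-d}(T)` takes a subbundle to its orthogonal with respect to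
the pairing of the cotangent and the tangent sheaf (`IsDuality.perp`, `IsDuality.nonempty_iso`,
`isDuality_tangent`).
-/

noncomputable section

namespace HiggsGrass

/-! ### Sections of modules and their restriction -/

section Restriction

variable {X : Scheme.{0}} {M N : X.Modules} {U V W : X.Opens}

/-- Restriction of functions. -/
def rres (h : V ≤ U) : Γ(X, U) →+* Γ(X, V) := (X.presheaf.map (homOfLE h).op).hom

/-- Restriction of sections of a module. -/
def mres (h : V ≤ U) : Γ(M, U) →+ Γ(M, V) := (M.presheaf.map (homOfLE h).op).hom

lemma rres_rres (h : V ≤ U) (h' : W ≤ V) (a : Γ(X, U)) :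
    rres h' (rres h a) = rres (h'.trans h) a := by
  simp only [rres]
  rw [← CommRingCat.comp_apply, ← Functor.map_comp]; rfl

lemma rres_self (a : Γ(X, U)) : rres le_rfl a = a := by
  have : (homOfLE (le_refl U)).op = 𝟙 (Opposite.op U) := rfl
  simp only [rres, this, X.presheaf.map_id]; rfl

lemma mres_mres (h : V ≤ U) (h' : W ≤ V) (s : Γ(M, U)) :
    mres h' (mres h s) = mres (h'.trans h) s := by
  simp only [mres]
  rw [← AddCommGrpCat.comp_apply, ← Functor.map_comp]; rfl

lemma mres_self (s : Γ(M, U)) : mres le_rfl s = s := by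
  have : (homOfLE (le_refl U)).op = 𝟙 (Opposite.op U) := rfl
  simp only [mres, this, M.presheaf.map_id]; rfl

lemma mres_smul (h : V ≤ U) (a : Γ(X, U)) (s : Γ(M, U)) :
    mres h (a • s) = rres h a • mres h s :=
  Scheme.Modules.map_smul M (homOfLE h) a s

lemma app_mres (φ : M ⟶ N) (h : V ≤ U) (s : Γ(M, U)) :
    φ.app V (mres h s) = mres h (φ.app U s) :=
  congr($(φ.mapPresheaf.naturality (homOfLE h).op) s)

lemma app_smul (φ : M ⟶ N) (a : Γ(X, U)) (s : Γ(M, U)) :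
    φ.app U (a • s) = a • φ.app U s := φ.app_smul a s

lemma eq_of_locally {s t : Γ(M, U)}
    (h : ∀ x ∈ U, ∃ (V : X.Opens) (hV : V ≤ U), x ∈ V ∧ mres hV s = mres hV t) : s = t := by
  choose V hV hx e using h
  refine TopCat.Sheaf.eq_of_locally_eq' ⟨M.presheaf, M.isSheaf⟩ (fun x : U => V x.1 x.2) U
    (fun x => homOfLE (hV x.1 x.2)) ?_ s t (fun x => e x.1 x.2)
  intro x hxU
  exact TopologicalSpace.Opens.mem_iSup.mpr ⟨⟨x, hxU⟩, hx x hxU⟩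

lemma eq_of_locally_ring {s t : Γ(X, U)}
    (h : ∀ x ∈ U, ∃ (V : X.Opens) (hV : V ≤ U), x ∈ V ∧ rres hV s = rres hV t) : s = t := by
  choose V hV hx e using h
  refine TopCat.Sheaf.eq_of_locally_eq' X.sheaf (fun x : U => V x.1 x.2) U
    (fun x => homOfLE (hV x.1 x.2)) ?_ s t (fun x => e x.1 x.2)
  intro x hxU
  exact TopologicalSpace.Opens.mem_iSup.mpr ⟨⟨x, hxU⟩, hx x hxU⟩

/-- Sections that exist locally and are locally unique glue. -/
lemma exists_glue (P : ∀ V : X.Opens, Γ(M, V) → Prop)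
    (hres : ∀ (V W : X.Opens) (h : W ≤ V) (s : Γ(M, V)), P V s → P W (mres h s))
    (huniq : ∀ V ≤ U, ∀ s t : Γ(M, V), P V s → P V t → s = t)
    (hex : ∀ x ∈ U, ∃ V ≤ U, x ∈ V ∧ ∃ s : Γ(M, V), P V s) :
    ∃ s : Γ(M, U), ∀ (V : X.Opens) (h : V ≤ U) (t : Γ(M, V)), P V t → mres h s = t := by
  choose V hV hx s hs using hex
  obtain ⟨g, hg, -⟩ := TopCat.Sheaf.existsUnique_gluing' ⟨M.presheaf, M.isSheaf⟩
    (fun x : U => V x.1 x.2) U (fun x => homOfLE (hV x.1 x.2))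
    (fun x hxU => TopologicalSpace.Opens.mem_iSup.mpr ⟨⟨x, hxU⟩, hx x hxU⟩)
    (fun x => s x.1 x.2)
    (fun x y => huniq _ (inf_le_left.trans (hV x.1 x.2)) _ _
      (hres _ _ inf_le_left _ (hs x.1 x.2)) (hres _ _ inf_le_right _ (hs y.1 y.2)))
  refine ⟨g, fun W h t ht => eq_of_locally fun x hxW => ?_⟩
  refine ⟨W ⊓ V x (h hxW), inf_le_left, ⟨hxW, hx x (h hxW)⟩, ?_⟩
  refine huniq _ (inf_le_left.trans h) _ _ ?_ (hres _ _ inf_le_left _ ht)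
  have e : mres (hV x (h hxW)) g = s x (h hxW) := hg ⟨x, h hxW⟩
  have := hres _ _ (inf_le_right : W ⊓ V x (h hxW) ≤ _) _ (hs x (h hxW))
  rw [← e, mres_mres] at this
  rw [mres_mres]
  exact this

lemma exists_glue_ring (P : ∀ V : X.Opens, Γ(X, V) → Prop)
    (hres : ∀ (V W : X.Opens) (h : W ≤ V) (s : Γ(X, V)), P V s → P W (rres h s))
    (huniq : ∀ V ≤ U, ∀ s t : Γ(X, V), P V s → P V t → s = t)
    (hex : ∀ x ∈ U, ∃ V ≤ U, x ∈ V ∧ ∃ s : Γ(X, V), P V s) :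
    ∃ s : Γ(X, U), ∀ (V : X.Opens) (h : V ≤ U) (t : Γ(X, V)), P V t → rres h s = t :=
  exists_glue (M := structureSheaf X) P hres huniq hex

end Restriction

/-! ### Frames -/

section Frames

variable {X : Scheme.{0}} {M N : X.Modules} {U V W : X.Opens} {ι κ : Type} [Fintype ι] [Fintype κ]

/-- The linear combination of the restrictions to `W` of sections `e i` with coefficients `a i`. -/
def lc (e : ι → Γ(M, V)) (h : W ≤ V) (a : ι → Γ(X, W)) : Γ(M, W) := ∑ i, a i • mres h (e i)

lemma lc_add (e : ι → Γ(M, V)) (h : W ≤ V) (a b : ι → Γ(X, W)) :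
    lc e h (a + b) = lc e h a + lc e h b := by
  simp [lc, add_smul, Finset.sum_add_distrib]

lemma lc_sub (e : ι → Γ(M, V)) (h : W ≤ V) (a b : ι → Γ(X, W)) :
    lc e h (a - b) = lc e h a - lc e h b := by
  simp [lc, sub_smul, Finset.sum_sub_distrib]

lemma lc_smul (e : ι → Γ(M, V)) (h : W ≤ V) (c : Γ(X, W)) (a : ι → Γ(X, W)) :
    lc e h (c • a) = c • lc e h a := by
  simp [lc, mul_smul, Finset.smul_sum]

lemma lc_zero (e : ι → Γ(M, V)) (h : W ≤ V) : lc e h 0 = 0 := by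
  simp [lc]

lemma lc_sum {σ : Type*} (t : Finset σ) (e : ι → Γ(M, V)) (h : W ≤ V) (a : σ → ι → Γ(X, W)) :
    lc e h (∑ k ∈ t, a k) = ∑ k ∈ t, lc e h (a k) := by
  simp only [lc, Finset.sum_apply, Finset.sum_smul]
  exact Finset.sum_comm

lemma lc_single [DecidableEq ι] (e : ι → Γ(M, V)) (h : W ≤ V) (i : ι) (c : Γ(X, W)) :
    lc e h (Pi.single i c) = c • mres h (e i) := by
  rw [lc, Finset.sum_eq_single i]
  · simp
  · intro j _ hj; simp [Pi.single_eq_of_ne hj]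
  · simp

lemma mres_lc (e : ι → Γ(M, V)) (h : W ≤ V) (h' : U ≤ W) (a : ι → Γ(X, W)) :
    mres h' (lc e h a) = lc e (h'.trans h) (fun i => rres h' (a i)) := by
  simp [lc, map_sum, mres_smul, mres_mres]

lemma lc_mres (e : ι → Γ(M, V)) (h : W ≤ V) (h' : U ≤ W) (a : ι → Γ(X, U)) :
    lc (fun i => mres h (e i)) h' a = lc e (h'.trans h) a := by
  simp [lc, mres_mres]

lemma app_lc (φ : M ⟶ N) (e : ι → Γ(M, V)) (h : W ≤ V) (a : ι → Γ(X, W)) :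
    φ.app W (lc e h a) = lc (fun i => φ.app V (e i)) h a := by
  simp only [lc, map_sum, app_smul, app_mres]

lemma lc_sumElim (e : ι ⊕ κ → Γ(M, V)) (h : W ≤ V) (a : ι ⊕ κ → Γ(X, W)) :
    lc e h a = lc (e ∘ Sum.inl) h (a ∘ Sum.inl) + lc (e ∘ Sum.inr) h (a ∘ Sum.inr) := by
  simp [lc]

/-- Sections `e i` of `M` over `V` are a frame if they are a basis of `M` over every open subset
of `V`, i.e. if they trivialize the restriction of `M` to `V`. -/
def IsFrame (e : ι → Γ(M, V)) : Prop :=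
  ∀ (W : X.Opens) (h : W ≤ V), Function.Bijective (lc e h)

/-- Being a frame can be checked locally. -/
lemma isFrame_of_locally {e : ι → Γ(M, V)}
    (inj' : ∀ (W : X.Opens) (h : W ≤ V) (a : ι → Γ(X, W)), lc e h a = 0 →
      ∀ x ∈ W, ∃ (W' : X.Opens) (hW' : W' ≤ W), x ∈ W' ∧ ∀ i, rres hW' (a i) = 0)
    (surj : ∀ (W : X.Opens) (h : W ≤ V) (s : Γ(M, W)), ∀ x ∈ W,
      ∃ (W' : X.Opens) (hW' : W' ≤ W) (a : ι → Γ(X, W')), x ∈ W' ∧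
        lc e (hW'.trans h) a = mres hW' s) :
    IsFrame e := by
  have inj : ∀ (W : X.Opens) (h : W ≤ V), Function.Injective (lc e h) := by
    intro W h a b hab
    funext i
    refine eq_of_locally_ring fun x hx => ?_
    obtain ⟨W', hW', hx', hb⟩ := inj' W h (a - b) (by rw [lc_sub, hab, sub_self]) x hx
    exact ⟨W', hW', hx', sub_eq_zero.1 (by rw [← map_sub]; exact hb i)⟩
  intro W h
  refine ⟨inj W h, fun s => ?_⟩
  let P : ι → ∀ V' : X.Opens, Γ(X, V') → Prop := fun i V' c =>
    ∃ (h' : V' ≤ W) (a : ι → Γ(X, V')), lc e (h'.trans h) a = mres h' s ∧ a i = c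
  have key : ∀ i, ∃ c : Γ(X, W), ∀ (V' : X.Opens) (h' : V' ≤ W) (t : Γ(X, V')),
      P i V' t → rres h' c = t := by
    intro i
    refine exists_glue_ring (P i) ?_ ?_ ?_
    · rintro V' W' hW' c ⟨h', a, ha, rfl⟩
      exact ⟨hW'.trans h', fun j => rres hW' (a j),
        by rw [← mres_lc e (h'.trans h) hW', ha, mres_mres], rfl⟩
    · rintro V' - c c' ⟨h', a, ha, rfl⟩ ⟨_, b, hb, rfl⟩
      exact congrFun (inj _ _ (ha.trans hb.symm)) i
    · intro x hx
      obtain ⟨W', hW', a, hx', ha⟩ := surj W h s x hx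
      exact ⟨W', hW', hx', a i, hW', a, ha, rfl⟩
  choose c hc using key
  refine ⟨c, eq_of_locally fun x hx => ?_⟩
  obtain ⟨W', hW', a, hx', ha⟩ := surj W h s x hx
  refine ⟨W', hW', hx', ?_⟩
  rw [mres_lc e h hW', ← ha]
  congr 1
  funext i
  exact hc i W' hW' (a i) ⟨hW', a, ha, rfl⟩

namespace IsFrame

lemma mres {e : ι → Γ(M, V)} (he : IsFrame e) (h : W ≤ V) :
    IsFrame (fun i => mres h (e i)) := by
  intro U hU
  have : lc (fun i => HiggsGrass.mres h (e i)) hU = lc e (hU.trans h) := by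
    funext a; exact lc_mres e h hU a
  rw [this]; exact he _ _

lemma map_iso {e : ι → Γ(M, V)} (he : IsFrame e) (φ : M ≅ N) :
    IsFrame (fun i => φ.hom.app V (e i)) := by
  intro W h
  have : lc (fun i => φ.hom.app V (e i)) h = φ.hom.app W ∘ lc e h := by
    funext a; exact (app_lc φ.hom e h a).symm
  rw [this]
  exact Function.Bijective.comp (ConcreteCategory.bijective_of_isIso (φ.hom.app W)) (he W h)

lemma reindex {e : ι → Γ(M, V)} (he : IsFrame e) (σ : κ ≃ ι) : IsFrame (e ∘ σ) := by
  intro W h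
  have : lc (e ∘ σ) h = lc e h ∘ (fun a => a ∘ σ.symm) := by
    funext a
    simp only [lc, Function.comp]
    exact (Fintype.sum_equiv σ _ _ (fun i => by simp))
  rw [this]
  refine (he W h).comp ?_
  exact (Equiv.arrowCongr σ (Equiv.refl _)).bijective

/-- The coordinates of a section with respect to a frame. -/
def coord {e : ι → Γ(M, V)} (he : IsFrame e) (h : W ≤ V) (s : Γ(M, W)) : ι → Γ(X, W) :=
  ((he W h).2 s).choose

lemma lc_coord {e : ι → Γ(M, V)} (he : IsFrame e) (h : W ≤ V) (s : Γ(M, W)) :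
    lc e h (he.coord h s) = s := ((he W h).2 s).choose_spec

lemma coord_lc {e : ι → Γ(M, V)} (he : IsFrame e) (h : W ≤ V) (a : ι → Γ(X, W)) :
    he.coord h (lc e h a) = a := (he W h).1 (he.lc_coord h _)

lemma coord_add {e : ι → Γ(M, V)} (he : IsFrame e) (h : W ≤ V) (s t : Γ(M, W)) :
    he.coord h (s + t) = he.coord h s + he.coord h t :=
  (he W h).1 (by rw [lc_add]; simp only [lc_coord])

lemma coord_smul {e : ι → Γ(M, V)} (he : IsFrame e) (h : W ≤ V) (c : Γ(X, W)) (s : Γ(M, W)) :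
    he.coord h (c • s) = c • he.coord h s :=
  (he W h).1 (by rw [lc_smul]; simp only [lc_coord])

lemma coord_mres {e : ι → Γ(M, V)} (he : IsFrame e) (h : W ≤ V) (h' : U ≤ W) (s : Γ(M, W)) :
    he.coord (h'.trans h) (HiggsGrass.mres h' s) = fun i => rres h' (he.coord h s i) :=
  (he U (h'.trans h)).1 (by rw [lc_coord, ← mres_lc e h h', lc_coord])

lemma coord_self [DecidableEq ι] {e : ι → Γ(M, V)} (he : IsFrame e) (h : W ≤ V) (i : ι) :
    he.coord h (HiggsGrass.mres h (e i)) = Pi.single i 1 :=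
  (he W h).1 (by rw [lc_coord, lc_single, one_smul])

end IsFrame

/-- Passing from a family to linear combinations of it multiplies coefficients by the matrix. -/
lemma lc_matrix (e : ι → Γ(M, V)) (A : κ → ι → Γ(X, V)) (h : W ≤ V) (b : κ → Γ(X, W)) :
    lc (fun k => lc e le_rfl (A k)) h b = lc e h (fun i => ∑ k, b k * rres h (A k i)) := by
  simp only [lc, map_sum, mres_smul, mres_mres, Finset.smul_sum, smul_smul, Finset.sum_smul]
  exact Finset.sum_comm

lemma IsFrame.of_matrix {e : ι → Γ(M, V)} (he : IsFrame e) [DecidableEq ι] [DecidableEq κ]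
    (A : Matrix κ ι Γ(X, V)) (B : Matrix ι κ Γ(X, V)) (hAB : A * B = 1) (hBA : B * A = 1) :
    IsFrame (fun k => lc e le_rfl (fun i => A k i)) := by
  intro W h
  have : lc (fun k => lc e le_rfl (fun i => A k i)) h =
      lc e h ∘ (fun b => Matrix.vecMul b (A.map (rres h))) := by
    funext b; exact lc_matrix e (fun k i => A k i) h b
  rw [this]
  refine (he W h).comp ?_
  have h1 : A.map (rres h) * B.map (rres h) = 1 := by
    rw [← Matrix.map_mul, hAB]; simp
  have h2 : B.map (rres h) * A.map (rres h) = 1 := by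
    rw [← Matrix.map_mul, hBA]; simp
  refine Function.bijective_iff_has_inverse.mpr ⟨fun c => Matrix.vecMul c (B.map (rres h)), ?_, ?_⟩
  · intro b; simp only [Matrix.vecMul_vecMul, h1, Matrix.vecMul_one]
  · intro b; simp only [Matrix.vecMul_vecMul, h2, Matrix.vecMul_one]

lemma IsFrame.of_det {e : ι → Γ(M, V)} (he : IsFrame e) [DecidableEq ι]
    (A : Matrix ι ι Γ(X, V)) (hA : IsUnit A.det) : IsFrame (fun k => lc e le_rfl (A k)) :=
  he.of_matrix A A⁻¹ (Matrix.mul_nonsing_inv A hA) (Matrix.nonsing_inv_mul A hA)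

/-- Two frames of the same module differ by mutually inverse matrices. -/
lemma IsFrame.coord_mul_coord {e : ι → Γ(M, V)} {e' : κ → Γ(M, V)} (he : IsFrame e)
    (he' : IsFrame e') [DecidableEq κ] :
    (Matrix.of fun k => he.coord le_rfl (e' k)) * (Matrix.of fun i => he'.coord le_rfl (e i)) =
      (1 : Matrix κ κ Γ(X, V)) := by
  funext k
  apply (he' V le_rfl).1
  have h1 : lc e' le_rfl ((1 : Matrix κ κ Γ(X, V)) k) = e' k := by
    have : (1 : Matrix κ κ Γ(X, V)) k = Pi.single k 1 := by
      ext j; simp [Matrix.one_apply, Pi.single_apply, eq_comm]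
    rw [this, lc_single, one_smul, mres_self]
  rw [h1]
  have h2 : e = fun i => lc e' le_rfl (he'.coord le_rfl (e i)) := by
    funext i; rw [he'.lc_coord]
  conv_rhs => rw [← he.lc_coord le_rfl (e' k)]
  conv_rhs => arg 1; rw [h2]
  rw [lc_matrix]
  congr 1
  funext j
  simp [Matrix.mul_apply, rres_self]

end Frames

/-! ### Subsheaves of modules -/

section SubMod

variable {X : Scheme.{0}} {M N : X.Modules}

/-- A subsheaf of submodules of `M`: a submodule of `Γ(M, U)` for each `U`, stable under
restriction, whose membership is a local condition. -/
@[ext]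
structure SubMod (M : X.Modules) where
  carrier : ∀ U : X.Opens, Submodule Γ(X, U) Γ(M, U)
  res_mem : ∀ {U V : X.Opens} (h : V ≤ U) {s : Γ(M, U)}, s ∈ carrier U → mres h s ∈ carrier V
  local_mem : ∀ {U : X.Opens} {s : Γ(M, U)},
    (∀ x ∈ U, ∃ (V : X.Opens) (h : V ≤ U), x ∈ V ∧ mres h s ∈ carrier V) → s ∈ carrier U

variable {ι κ : Type} [Fintype ι] [Fintype κ] {U V W : X.Opens}

/-- A frame `e` of `M` indexed by `ι ⊕ κ` is adapted to the subsheaf `S` if `S` is spanned by the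
part of `e` indexed by `ι`. -/
structure SubMod.IsAdapted (S : SubMod M) (e : ι ⊕ κ → Γ(M, V)) : Prop where
  isFrame : IsFrame e
  mem_iff : ∀ (W : X.Opens) (h : W ≤ V) (a : ι ⊕ κ → Γ(X, W)),
    lc e h a ∈ S.carrier W ↔ ∀ k, a (Sum.inr k) = 0

namespace SubMod

lemma IsAdapted.mres {S : SubMod M} {e : ι ⊕ κ → Γ(M, V)} (he : S.IsAdapted e) (h : W ≤ V) :
    S.IsAdapted (fun i => mres h (e i)) where
  isFrame := he.isFrame.mres h
  mem_iff U hU a := by rw [lc_mres]; exact he.mem_iff _ _ _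

lemma IsAdapted.inl_mem {S : SubMod M} {e : ι ⊕ κ → Γ(M, V)} (he : S.IsAdapted e) (i : ι) :
    e (Sum.inl i) ∈ S.carrier V := by
  classical
  have := (he.mem_iff V le_rfl (Pi.single (Sum.inl i) 1)).2 (by simp)
  rwa [lc_single, one_smul, mres_self] at this

/-- The condition that `S` is a subbundle of rank `d`. -/
def IsSub (S : SubMod M) (d : ℕ) : Prop :=
  ∀ x : X, ∃ (V : X.Opens) (r : ℕ) (e : Fin d ⊕ Fin r → Γ(M, V)), x ∈ V ∧ S.IsAdapted e

/-- Two subsheaves are equal if locally some frame is adapted to both. -/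
lemma eq_of_adapted {S T : SubMod M}
    (h : ∀ x : X, ∃ (V : X.Opens) (ι κ : Type) (_ : Fintype ι) (_ : Fintype κ)
      (e : ι ⊕ κ → Γ(M, V)), x ∈ V ∧ S.IsAdapted e ∧ T.IsAdapted e) : S = T := by
  have main : ∀ {S T : SubMod M} (_ : ∀ x : X, ∃ (V : X.Opens) (ι κ : Type) (_ : Fintype ι)
      (_ : Fintype κ) (e : ι ⊕ κ → Γ(M, V)), x ∈ V ∧ S.IsAdapted e ∧ T.IsAdapted e)
      (U : X.Opens) (s : Γ(M, U)), s ∈ S.carrier U → s ∈ T.carrier U := by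
    intro S T h U s hs
    refine T.local_mem fun x hx => ?_
    obtain ⟨V, ι, κ, _, _, e, hxV, h1, h2⟩ := h x
    refine ⟨U ⊓ V, inf_le_left, ⟨hx, hxV⟩, ?_⟩
    have := S.res_mem (inf_le_left : U ⊓ V ≤ U) hs
    rw [← h1.isFrame.lc_coord inf_le_right (HiggsGrass.mres inf_le_left s)] at this ⊢
    exact (h2.mem_iff _ _ _).2 ((h1.mem_iff _ _ _).1 this)
  ext U s
  exact ⟨main h U s, main (fun x => by
    obtain ⟨V, ι, κ, i1, i2, e, hxV, h1, h2⟩ := h x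
    exact ⟨V, ι, κ, i1, i2, e, hxV, h2, h1⟩) U s⟩

end SubMod

end SubMod

/-! ### Sections of the associated sheaf -/

section Sheafify

variable {X : Scheme.{0}} (P : PreMod X) {U V W : X.Opens}

/-- Sections of a presheaf of modules over `U`, as a module over `𝒪(U)`. -/
def PSec (U : X.Opens) : Type := P.obj (.op U)

instance (U : X.Opens) : AddCommGroup (PSec P U) :=
  inferInstanceAs (AddCommGroup (P.obj (.op U)))

instance (U : X.Opens) : Module Γ(X, U) (PSec P U) := (P.obj (.op U)).isModule

variable {P}

/-- Restriction of sections of a presheaf of modules. -/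
def pres (h : V ≤ U) : PSec P U →+ PSec P V := (P.presheaf.map (homOfLE h).op).hom

lemma pres_pres (h : V ≤ U) (h' : W ≤ V) (s : PSec P U) :
    pres h' (pres h s) = pres (h'.trans h) s := by
  have h := congr($(P.presheaf.map_comp (homOfLE h).op (homOfLE h').op) s)
  exact h.symm

lemma pres_smul (h : V ≤ U) (a : Γ(X, U)) (s : PSec P U) :
    pres h (a • s) = rres h a • pres h s :=
  P.map_smul (homOfLE h).op a s

variable (P) in
/-- The canonical map from sections of a presheaf to sections of its associated sheaf. -/
def toSh (U : X.Opens) : PSec P U →ₗ[Γ(X, U)] Γ(sheafify P, U) :=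
  ((toSheafify P).app (.op U)).hom

lemma toSh_pres (h : W ≤ V) (s : PSec P V) : toSh P W (pres h s) = mres h (toSh P V s) :=
  PresheafOfModules.naturality_apply (toSheafify P) (homOfLE h).op s

lemma toSh_locally_injective (s : PSec P U) (h : toSh P U s = 0) :
    ∀ x ∈ U, ∃ (V : X.Opens) (hV : V ≤ U), x ∈ V ∧ pres hV s = 0 := by
  intro x hx
  have inst : Presheaf.IsLocallyInjective (Opens.grothendieckTopology X)
    (CategoryTheory.toSheafify (Opens.grothendieckTopology X) P.presheaf) := inferInstance
  have := Presheaf.equalizerSieve_mem (Opens.grothendieckTopology X)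
    (CategoryTheory.toSheafify (Opens.grothendieckTopology X) P.presheaf)
    (X := .op U) s (0 : PSec P U) (h.trans (map_zero (toSh P U)).symm)
  obtain ⟨V, i, hi, hxV⟩ := this x hx
  have h2 : pres (leOfHom i) s = pres (leOfHom i) 0 := hi
  rw [map_zero] at h2
  exact ⟨V, leOfHom i, hxV, h2⟩

lemma toSh_locally_surjective (s : Γ(sheafify P, U)) :
    ∀ x ∈ U, ∃ (V : X.Opens) (hV : V ≤ U) (t : PSec P V), x ∈ V ∧ toSh P V t = mres hV s := by
  intro x hx
  have inst : Presheaf.IsLocallySurjective (Opens.grothendieckTopology X)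
    (CategoryTheory.toSheafify (Opens.grothendieckTopology X) P.presheaf) := inferInstance
  have := Presheaf.imageSieve_mem (Opens.grothendieckTopology X)
    (CategoryTheory.toSheafify (Opens.grothendieckTopology X) P.presheaf)
    (U := .op U) s
  obtain ⟨V, i, ⟨t, ht⟩, hxV⟩ := this x hx
  exact ⟨V, leOfHom i, t, hxV, ht⟩

variable {ι : Type} [Fintype ι]

/-- Sections of a presheaf of modules that are a basis over arbitrarily small open sets become
a frame of the associated sheaf. -/
lemma isFrame_sheafify (e : ι → PSec P V)
    (H : ∀ W ≤ V, ∀ x ∈ W, ∃ W' ≤ W, x ∈ W' ∧ ∀ h : W' ≤ V, Function.Bijective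
      (fun a : ι → Γ(X, W') => ∑ i, a i • pres h (e i))) :
    IsFrame (fun i => toSh P V (e i)) := by
  have hlc : ∀ (W : X.Opens) (h : W ≤ V) (a : ι → Γ(X, W)),
      lc (fun i => toSh P V (e i)) h a = toSh P W (∑ i, a i • pres h (e i)) := by
    intro W h a
    simp only [lc, map_sum, LinearMap.map_smul, toSh_pres]
  have hmap : ∀ (W W' : X.Opens) (h : W ≤ V) (h' : W' ≤ W) (a : ι → Γ(X, W)),
      pres h' (∑ i, a i • pres h (e i)) = ∑ i, rres h' (a i) • pres (h'.trans h) (e i) := by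
    intro W W' h h' a
    simp only [map_sum, pres_smul, pres_pres]
  refine isFrame_of_locally ?_ ?_
  · intro W h a ha x hx
    rw [hlc] at ha
    obtain ⟨W', hW', hx', h0⟩ := toSh_locally_injective _ ha x hx
    obtain ⟨W'', hW'', hx'', hb⟩ := H W' (hW'.trans h) x hx'
    refine ⟨W'', hW''.trans hW', hx'', fun i => ?_⟩
    refine congrFun ((hb (hW''.trans (hW'.trans h))).1
      (a₁ := fun i => rres (hW''.trans hW') (a i)) (a₂ := 0) ?_) i
    have := hmap W W'' h (hW''.trans hW') a
    refine this.symm.trans ?_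
    rw [← pres_pres hW' hW'', h0]
    simp
  · intro W h s x hx
    obtain ⟨W', hW', t, hx', ht⟩ := toSh_locally_surjective s x hx
    obtain ⟨W'', hW'', hx'', hb⟩ := H W' (hW'.trans h) x hx'
    obtain ⟨a, ha⟩ := (hb (hW''.trans (hW'.trans h))).2 (pres hW'' t)
    refine ⟨W'', hW''.trans hW', a, hx'', ?_⟩
    rw [hlc, ← mres_mres hW' hW'', ← ht]
    exact (congrArg (toSh P W'') ha).trans (toSh_pres hW'' t)

end Sheafify

/-! ### Sections and exactness -/

section Exactness

variable {X : Scheme.{0}} {M N : X.Modules} {U : X.Opens}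

/-- Sections over `U`, as a functor. -/
def sectionsFunctor (U : X.Opens) : X.Modules ⥤ Ab.{0} :=
  Scheme.Modules.toPresheaf X ⋙ (CategoryTheory.evaluation _ _).obj (.op U)

instance (U : X.Opens) : PreservesFiniteLimits (sectionsFunctor U) :=
  have : PreservesFiniteLimits
      ((CategoryTheory.evaluation (TopologicalSpace.Opens X)ᵒᵖ Ab.{0}).obj (.op U)) :=
    ⟨fun _ _ _ => CategoryTheory.Limits.evaluation_preservesLimitsOfShape _⟩
  comp_preservesFiniteLimits _ _

instance (U : X.Opens) : (sectionsFunctor U).Additive where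
  map_add := rfl

lemma injective_of_mono (i : M ⟶ N) [Mono i] (U : X.Opens) : Function.Injective (i.app U) := by
  have : Mono ((sectionsFunctor U).map i) := inferInstance
  exact (AddCommGrpCat.mono_iff_injective _).1 this

lemma mono_of_injective (i : M ⟶ N) (h : ∀ U, Function.Injective (i.app U)) : Mono i where
  right_cancellation f g hfg := by
    ext U s
    apply h U
    exact congr(($hfg).app U s)

lemma exists_of_cokernel_eq_zero (i : M ⟶ N) [Mono i] (s : Γ(N, U))
    (h : (cokernel.π i).app U s = 0) : ∃ t : Γ(M, U), i.app U t = s := by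
  have hS : (ShortComplex.mk i (cokernel.π i) (cokernel.condition i)).Exact :=
    ShortComplex.exact_cokernel i
  have hm : Mono (ShortComplex.mk i (cokernel.π i) (cokernel.condition i)).f := ‹Mono i›
  have htfae := ((sectionsFunctor (X := X) U).preservesFiniteLimits_tfae.out 3 1)
  have := (htfae.1 inferInstance (ShortComplex.mk i (cokernel.π i) (cokernel.condition i))
    ⟨hS, hm⟩).1
  rw [ShortComplex.ab_exact_iff] at this
  exact this s h

lemma locally_surjective_of_epi (q : M ⟶ N) [Epi q] (s : Γ(N, U)) :
    ∀ x ∈ U, ∃ (V : X.Opens) (hV : V ≤ U) (t : Γ(M, V)), x ∈ V ∧ q.app V t = mres hV s := by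
  intro x hx
  let k : pre N ⟶ cokernel (preMap q) := cokernel.π (preMap q)
  let κ : N ⟶ sheafify (cokernel (preMap q)) :=
    Scheme.Modules.fullyFaithfulToPresheafOfModules.preimage (k ≫ toSheafify (cokernel (preMap q)))
  have hκ' : preMap κ = k ≫ toSheafify (cokernel (preMap q)) :=
    Scheme.Modules.fullyFaithfulToPresheafOfModules.map_preimage _
  have hκ : κ = 0 := by
    rw [← cancel_epi q, comp_zero]
    apply Scheme.Modules.fullyFaithfulToPresheafOfModules.map_injective
    refine (Functor.map_comp _ _ _).trans ?_
    refine (congrArg (preMap q ≫ ·) hκ').trans ?_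
    exact (Category.assoc _ _ _).symm.trans
      ((congrArg (· ≫ _) (cokernel.condition (preMap q))).trans zero_comp)
  have h0 : (toSheafify (cokernel (preMap q))).app (.op U) (k.app (.op U) s) = 0 := by
    have h1 : (k ≫ toSheafify (cokernel (preMap q))).app (.op U) s = 0 := by
      rw [← hκ', hκ]; rfl
    exact h1
  obtain ⟨V, hV, hxV, h2⟩ := toSh_locally_injective (P := cokernel (preMap q)) _ h0 x hx
  have h3 : k.app (.op V) (mres hV s : Γ(N, V)) = 0 :=
    (PresheafOfModules.naturality_apply k (homOfLE hV).op s).trans h2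
  have hS : (ShortComplex.mk (preMap q) k (cokernel.condition _)).Exact :=
    ShortComplex.exact_cokernel _
  have := hS.map (PresheafOfModules.evaluation _ (.op V))
  rw [ShortComplex.moduleCat_exact_iff] at this
  obtain ⟨t, ht⟩ := this (mres hV s : Γ(N, V)) h3
  exact ⟨V, hV, t, hxV, ht⟩

end Exactness

/-! ### Morphisms given on sections -/

section MkHom

variable {X : Scheme.{0}} {M N : X.Modules} {U V W : X.Opens} {ι κ : Type} [Fintype ι] [Fintype κ]

/-- A morphism of modules given by its action on sections. -/
def mkHom (φ : ∀ U, Γ(M, U) →ₗ[Γ(X, U)] Γ(N, U))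
    (nat : ∀ (U V : X.Opens) (h : V ≤ U) (s : Γ(M, U)), φ V (mres h s) = mres h (φ U s)) :
    M ⟶ N :=
  Scheme.Modules.fullyFaithfulToPresheafOfModules.preimage
    { app := fun U => ModuleCat.ofHom (φ U.unop)
      naturality := fun {U V} i => by
        ext s
        exact nat U.unop V.unop (leOfHom i.unop) s }

/-- A morphism out of a free module is determined by the images of a basis. -/
def IsFrame.desc {e : ι → Γ(M, ⊤)} (he : IsFrame e) (t : ι → Γ(N, ⊤)) : M ⟶ N :=
  mkHom (fun U =>
    { toFun := fun s => lc t le_top (he.coord le_top s)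
      map_add' := fun s s' => by rw [he.coord_add, lc_add]
      map_smul' := fun c s => by rw [he.coord_smul, lc_smul]; rfl })
    (fun U V h s => by
      change lc t le_top (he.coord le_top (HiggsGrass.mres h s)) =
        HiggsGrass.mres h (lc t le_top (he.coord le_top s))
      rw [mres_lc, ← he.coord_mres le_top h])

lemma IsFrame.desc_app {e : ι → Γ(M, ⊤)} (he : IsFrame e) (t : ι → Γ(N, ⊤)) (i : ι) :
    (he.desc t).app ⊤ (e i) = t i := by
  classical
  change lc t le_top (he.coord le_top (e i)) = t i
  have := he.coord_self le_rfl i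
  rw [mres_self] at this
  rw [this, lc_single, one_smul, mres_self]

lemma IsFrame.hom_ext {e : ι → Γ(M, V)} (he : IsFrame e) (hV : V = ⊤) (φ ψ : M ⟶ N)
    (h : ∀ i, φ.app V (e i) = ψ.app V (e i)) : φ = ψ := by
  subst hV
  ext U s
  have := he.lc_coord le_top s
  rw [← this, app_lc, app_lc]
  simp only [h]

/-- The isomorphism between free modules given by bases indexed by the same set. -/
def IsFrame.iso {e : ι → Γ(M, ⊤)} (he : IsFrame e) {t : ι → Γ(N, ⊤)} (ht : IsFrame t) : M ≅ N where
  hom := he.desc t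
  inv := ht.desc e
  hom_inv_id := he.hom_ext rfl _ _ fun i => by
    change (ht.desc e).app ⊤ ((he.desc t).app ⊤ (e i)) = e i
    rw [he.desc_app, ht.desc_app]
  inv_hom_id := ht.hom_ext rfl _ _ fun i => by
    change (he.desc t).app ⊤ ((ht.desc e).app ⊤ (t i)) = t i
    rw [ht.desc_app, he.desc_app]

lemma app_of_eq {f g : M ⟶ N} (h : f = g) (U : X.Opens) (s : Γ(M, U)) :
    f.app U s = g.app U s := by rw [h]

instance : HasFiniteBiproducts X.Modules := Abelian.hasFiniteBiproducts

/-- Functions on `U`, as sections of the structure sheaf considered as a module. -/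
def secO (U : X.Opens) : Γ(X, U) ≃ₗ[Γ(X, U)] Γ(structureSheaf X, U) where
  toFun a := a
  invFun a := a
  left_inv _ := rfl
  right_inv _ := rfl
  map_add' _ _ := rfl
  map_smul' _ _ := rfl

lemma mres_secO (h : V ≤ U) (a : Γ(X, U)) : mres h (secO U a) = secO V (rres h a) := rfl

lemma isFrame_one (V : X.Opens) : IsFrame (fun _ : Unit => secO V 1) := by
  intro W h
  have : lc (fun _ : Unit => secO V 1) h = fun a => secO W (a ()) := by
    funext a
    simp only [lc, mres_secO, ← map_smul]
    simp
  rw [this]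
  exact (secO W).bijective.comp (Equiv.funUnique Unit Γ(X, W)).bijective

lemma IsFrame.biprod {e : ι → Γ(M, V)} (he : IsFrame e) {f : κ → Γ(N, V)} (hf : IsFrame f) :
    IsFrame (M := M ⊞ N) (Sum.elim (fun i => (biprod.inl : M ⟶ M ⊞ N).app V (e i))
      (fun k => (biprod.inr : N ⟶ M ⊞ N).app V (f k))) := by
  intro W h
  have hlc : ∀ a, lc (M := M ⊞ N) (Sum.elim (fun i => (biprod.inl : M ⟶ M ⊞ N).app V (e i))
      (fun k => (biprod.inr : N ⟶ M ⊞ N).app V (f k))) h a =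
      (biprod.inl : M ⟶ M ⊞ N).app W (lc e h (a ∘ Sum.inl)) +
      (biprod.inr : N ⟶ M ⊞ N).app W (lc f h (a ∘ Sum.inr)) := by
    intro a
    rw [lc_sumElim, app_lc, app_lc]; rfl
  have h1 : ∀ x : Γ(M, W), (biprod.fst : M ⊞ N ⟶ M).app W ((biprod.inl : M ⟶ M ⊞ N).app W x) = x :=
    app_of_eq biprod.inl_fst W
  have h2 : ∀ x : Γ(N, W), (biprod.fst : M ⊞ N ⟶ M).app W ((biprod.inr : N ⟶ M ⊞ N).app W x) = 0 :=
    app_of_eq biprod.inr_fst W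
  have h3 : ∀ x : Γ(M, W), (biprod.snd : M ⊞ N ⟶ N).app W ((biprod.inl : M ⟶ M ⊞ N).app W x) = 0 :=
    app_of_eq biprod.inl_snd W
  have h4 : ∀ x : Γ(N, W), (biprod.snd : M ⊞ N ⟶ N).app W ((biprod.inr : N ⟶ M ⊞ N).app W x) = x :=
    app_of_eq biprod.inr_snd W
  have h5 : ∀ x : Γ(M ⊞ N, W), (biprod.inl : M ⟶ M ⊞ N).app W ((biprod.fst : M ⊞ N ⟶ M).app W x) +
      (biprod.inr : N ⟶ M ⊞ N).app W ((biprod.snd : M ⊞ N ⟶ N).app W x) = x :=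
    app_of_eq biprod.total W
  constructor
  · intro a b hab
    rw [hlc, hlc] at hab
    have e1 := congrArg ((biprod.fst : M ⊞ N ⟶ M).app W) hab
    have e2 := congrArg ((biprod.snd : M ⊞ N ⟶ N).app W) hab
    simp only [map_add, h1, h2, h3, h4, add_zero, zero_add] at e1 e2
    have e3 := (he W h).1 e1
    have e4 := (hf W h).1 e2
    funext i
    rcases i with i | i
    · exact congrFun e3 i
    · exact congrFun e4 i
  · intro s
    obtain ⟨a, ha⟩ := (he W h).2 ((biprod.fst : M ⊞ N ⟶ M).app W s)
    obtain ⟨b, hb⟩ := (hf W h).2 ((biprod.snd : M ⊞ N ⟶ N).app W s)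
    refine ⟨Sum.elim a b, ?_⟩
    rw [hlc]
    simp only [Sum.elim_comp_inl, Sum.elim_comp_inr, ha, hb, h5]

/-- Finite sums of copies of the structure sheaf have a basis. -/
lemma exists_isFrame_biproduct (ι : Type) [Fintype ι] [DecidableEq ι] :
    ∃ e : ι → Γ((⨁ fun _ : ι => structureSheaf X), ⊤), IsFrame e := by
  refine ⟨fun i => (biproduct.ι (fun _ : ι => structureSheaf X) i).app ⊤ (secO ⊤ 1), ?_⟩
  intro W h
  set e : ι → Γ((⨁ fun _ : ι => structureSheaf X), ⊤) :=
    fun i => (biproduct.ι (fun _ : ι => structureSheaf X) i).app ⊤ (secO ⊤ 1) with he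
  have hlc : ∀ a : ι → Γ(X, W), lc e h a =
      ∑ i, (biproduct.ι (fun _ : ι => structureSheaf X) i).app W (secO W (a i)) := by
    intro a
    refine Finset.sum_congr rfl fun i _ => ?_
    simp only [he]
    rw [← app_mres, ← app_smul, mres_secO, ← map_smul]
    simp
  have hπ : ∀ i j (x : Γ(structureSheaf X, W)), (biproduct.π (fun _ : ι => structureSheaf X) j).app
    W
      ((biproduct.ι (fun _ : ι => structureSheaf X) i).app W x) = if i = j then x else 0 := by
    intro i j x
    have := app_of_eq (biproduct.ι_π (fun _ : ι => structureSheaf X) i j) W x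
    refine this.trans ?_
    split_ifs with hij
    · subst hij; rfl
    · rfl
  constructor
  · intro a b hab
    funext j
    have := congrArg ((biproduct.π (fun _ : ι => structureSheaf X) j).app W) hab
    rw [hlc, hlc, map_sum, map_sum] at this
    simp only [hπ] at this
    rw [Finset.sum_ite_eq', Finset.sum_ite_eq', if_pos (Finset.mem_univ j)] at this
    exact (secO W).injective (by simpa using this)
  · intro s
    refine ⟨fun i => (secO W).symm
      ((biproduct.π (fun _ : ι => structureSheaf X) i).app W s), ?_⟩
    rw [hlc]
    have := app_of_eq (biproduct.total (f := fun _ : ι => structureSheaf X)) W s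
    refine Eq.trans ?_ this
    have hs : ∀ (t : Finset ι) (φ : ι → ((⨁ fun _ : ι => structureSheaf X) ⟶
        (⨁ fun _ : ι => structureSheaf X))), (∑ i ∈ t, φ i).app W s = ∑ i ∈ t, (φ i).app W s := by
      intro t φ
      induction t using Finset.induction_on with
      | empty => simp
      | insert i t hi ih => rw [Finset.sum_insert hi, Finset.sum_insert hi, ← ih]; rfl
    rw [hs]
    rfl

/-- The standard free module has a basis. -/
lemma exists_isFrame_free (ι : Type) [Fintype ι] [DecidableEq ι] :
    ∃ e : ι → Γ((SheafOfModules.free (R := X.ringCatSheaf) ι : X.Modules), ⊤), IsFrame e := by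
  obtain ⟨e, he⟩ := exists_isFrame_biproduct (X := X) ι
  let i : (⨁ fun _ : ι => structureSheaf X) ≅
      (SheafOfModules.free (R := X.ringCatSheaf) ι : X.Modules) :=
    biproduct.isoCoproduct (fun _ : ι => structureSheaf X)
  exact ⟨_, he.map_iso i⟩

end MkHom

/-! ### Subsheaves as modules -/

section SubModule

variable {X : Scheme.{0}} {M N : X.Modules} {U V W : X.Opens} {ι κ : Type} [Fintype ι] [Fintype κ]

/-- The presheaf of modules underlying a subsheaf of modules. -/
def SubMod.toSubmodule (S : SubMod M) : PresheafOfModules.Submodule (pre M) where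
  obj U := S.carrier U.unop
  map f _ hs := S.res_mem (leOfHom f.unop) hs

/-- A subsheaf of `M`, as a module. -/
def SubMod.toModules (S : SubMod M) : X.Modules where
  val := S.toSubmodule.toPresheafOfModules
  isSheaf := by
    refine (TopCat.Presheaf.isSheaf_iff_isSheafUniqueGluing (C := Ab.{0}) _).2 ?_
    intro I U sf hsf
    obtain ⟨g, hg, hu⟩ := TopCat.Sheaf.existsUnique_gluing ⟨M.presheaf, M.isSheaf⟩ U
      (fun i => (sf i).1) (fun i j => congrArg Subtype.val (hsf i j))
    have hmem : g ∈ S.carrier (iSup U) := by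
      refine S.local_mem fun x hx => ?_
      obtain ⟨i, hi⟩ := TopologicalSpace.Opens.mem_iSup.mp hx
      refine ⟨U i, le_iSup U i, hi, ?_⟩
      have : mres (le_iSup U i) g = (sf i).1 := hg i
      rw [this]
      exact (sf i).2
    refine ⟨⟨g, hmem⟩, fun i => Subtype.ext (hg i), fun g' hg' => Subtype.ext ?_⟩
    exact hu g'.1 (fun i => congrArg Subtype.val (hg' i))

/-- The inclusion of a subsheaf. -/
def SubMod.incl (S : SubMod M) : S.toModules ⟶ M :=
  Scheme.Modules.fullyFaithfulToPresheafOfModules.preimage S.toSubmodule.ι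

lemma SubMod.incl_injective (S : SubMod M) (U : X.Opens) : Function.Injective (S.incl.app U) :=
  Subtype.val_injective

lemma SubMod.mem_iff_exists (S : SubMod M) (s : Γ(M, U)) :
    s ∈ S.carrier U ↔ ∃ t : Γ(S.toModules, U), S.incl.app U t = s :=
  ⟨fun h => ⟨⟨s, h⟩, rfl⟩, by rintro ⟨t, rfl⟩; exact t.2⟩

instance (S : SubMod M) : Mono S.incl := mono_of_injective _ S.incl_injective

/-- The image of a monomorphism, as a subsheaf. -/
def imageSub (i : M ⟶ N) [Mono i] : SubMod N where
  carrier U :=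
    { carrier := { s | ∃ t : Γ(M, U), i.app U t = s }
      zero_mem' := ⟨0, map_zero _⟩
      add_mem' := by rintro _ _ ⟨a, rfl⟩ ⟨b, rfl⟩; exact ⟨a + b, map_add _ _ _⟩
      smul_mem' := by rintro c _ ⟨a, rfl⟩; exact ⟨c • a, app_smul _ _ _⟩ }
  res_mem := by rintro U V h _ ⟨t, rfl⟩; exact ⟨mres h t, app_mres _ _ _⟩
  local_mem := by
    intro U s h
    obtain ⟨t, ht⟩ := exists_glue (M := M) (U := U) (fun V t => ∃ hV : V ≤ U, i.app V t = mres hV s)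
      (by
        rintro V W hW t ⟨hV, ht⟩
        exact ⟨hW.trans hV, by rw [app_mres, ht, mres_mres]⟩)
      (by
        rintro V hV t t' ⟨_, ht⟩ ⟨_, ht'⟩
        exact injective_of_mono i V (ht.trans ht'.symm))
      (by
        intro x hx
        obtain ⟨V, hV, hxV, t, ht⟩ := h x hx
        exact ⟨V, hV, hxV, t, hV, ht⟩)
    refine ⟨t, eq_of_locally fun x hx => ?_⟩
    obtain ⟨V, hV, hxV, t', ht'⟩ := h x hx
    refine ⟨V, hV, hxV, ?_⟩
    rw [← app_mres, ht V hV t' ⟨hV, ht'⟩, ht']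

lemma mem_imageSub (i : M ⟶ N) [Mono i] (s : Γ(N, U)) :
    s ∈ (imageSub i).carrier U ↔ ∃ t : Γ(M, U), i.app U t = s := Iff.rfl

lemma imageSub_incl (S : SubMod M) : imageSub S.incl = S := by
  ext U s
  rw [mem_imageSub, S.mem_iff_exists]

/-- Two monomorphisms with the same image differ by an isomorphism of their sources. -/
lemma exists_iso_of_imageSub_eq {M' : X.Modules} (i : M ⟶ N) (j : M' ⟶ N) [Mono i] [Mono j]
    (h : imageSub i = imageSub j) : ∃ e : M ≅ M', i = e.hom ≫ j := by
  have aux : ∀ {A B : X.Modules} (i : A ⟶ N) (j : B ⟶ N) [Mono i] [Mono j],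
      imageSub i = imageSub j → ∃ φ : A ⟶ B, i = φ ≫ j := by
    intro A B i j _ _ h
    have hex : ∀ (U : X.Opens) (s : Γ(A, U)), ∃ t : Γ(B, U), j.app U t = i.app U s := by
      intro U s
      rw [← mem_imageSub, ← h]
      exact ⟨s, rfl⟩
    choose φ hφ using hex
    let f : A ⟶ B := mkHom (fun U =>
      { toFun := φ U
        map_add' := fun s t => injective_of_mono j U (by rw [map_add, hφ, hφ, hφ, map_add])
        map_smul' := fun c s => injective_of_mono j U (by
          rw [app_smul, hφ, hφ, app_smul]; rfl) })
      (fun U V h s => injective_of_mono j V (by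
        change j.app V (φ V (mres h s)) = j.app V (mres h (φ U s))
        rw [app_mres, hφ, hφ, app_mres]))
    refine ⟨f, ?_⟩
    ext U s
    exact (hφ U s).symm
  obtain ⟨φ, hφ⟩ := aux i j h
  obtain ⟨ψ, hψ⟩ := aux j i h.symm
  refine ⟨⟨φ, ψ, ?_, ?_⟩, hφ⟩
  · rw [← cancel_mono i, Category.assoc, ← hψ, ← hφ, Category.id_comp]
  · rw [← cancel_mono j, Category.assoc, ← hφ, ← hψ, Category.id_comp]

end SubModule

/-! ### Morphisms to direct images -/

section Comorphism

variable {X Y : Scheme.{0}} {f : Y ⟶ X} {M : X.Modules} {M' N' : Y.Modules}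
  {U V W : X.Opens} {ι κ : Type} [Fintype ι] [Fintype κ]

/-- Pullback of functions. -/
def fres (f : Y ⟶ X) (U : X.Opens) : Γ(X, U) →+* Γ(Y, f ⁻¹ᵁ U) := (f.app U).hom

/-- The map on sections given by a morphism `M ⟶ f_* M'`. -/
def cm (α : M ⟶ (Scheme.Modules.pushforward f).obj M') (U : X.Opens) :
    Γ(M, U) →+ Γ(M', f ⁻¹ᵁ U) := (α.app U).hom

lemma cm_smul (α : M ⟶ (Scheme.Modules.pushforward f).obj M') (a : Γ(X, U)) (s : Γ(M, U)) :
    cm α U (a • s) = fres f U a • cm α U s := app_smul' f α U a s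

lemma cm_mres (α : M ⟶ (Scheme.Modules.pushforward f).obj M') (h : V ≤ U) (s : Γ(M, U)) :
    cm α V (mres h s) = mres (Scheme.Hom.preimage_mono f h) (cm α U s) :=
  app_res f α (homOfLE h) s

lemma cm_lc (α : M ⟶ (Scheme.Modules.pushforward f).obj M') (e : ι → Γ(M, V)) (h : W ≤ V)
    (a : ι → Γ(X, W)) : cm α W (lc e h a) =
      lc (fun i => cm α V (e i)) (Scheme.Hom.preimage_mono f h) (fun i => fres f W (a i)) := by
  simp only [lc, map_sum, cm_smul, cm_mres]

/-- A morphism `M ⟶ f_* M'` presents `M'` as a pullback of `M`, in the sense that it maps frames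
to frames. -/
def IsBC (α : M ⟶ (Scheme.Modules.pushforward f).obj M') : Prop :=
  ∀ (V : X.Opens) (ι : Type) [Fintype ι] (e : ι → Γ(M, V)), IsFrame e →
    IsFrame (fun i => cm α V (e i))

lemma IsBC.comp_iso {α : M ⟶ (Scheme.Modules.pushforward f).obj M'} (hα : IsBC α) (φ : M' ≅ N') :
    IsBC (α ≫ (Scheme.Modules.pushforward f).map φ.hom) :=
  fun V _ _ e he => (hα V _ e he).map_iso φ

/-! ### Open immersions -/

section OpenImmersion

variable [IsOpenImmersion f]

lemma fres_bijective (hU : U ≤ f.opensRange) : Function.Bijective (fres f U) := by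
  have := f.isIso_app U hU
  exact ConcreteCategory.bijective_of_isIso (f.app U)

lemma isFrame_cm_iff {α : M ⟶ (Scheme.Modules.pushforward f).obj M'}
    (hα : ∀ U ≤ f.opensRange, Function.Bijective (cm α U)) (hV : V ≤ f.opensRange)
    (e : ι → Γ(M, V)) : IsFrame (fun i => cm α V (e i)) ↔ IsFrame e := by
  have key : ∀ (W : X.Opens) (h : W ≤ V), Function.Bijective (lc e h) ↔
      Function.Bijective (lc (fun i => cm α V (e i)) (Scheme.Hom.preimage_mono f h)) := by
    intro W h
    have h1 : cm α W ∘ lc e h = lc (fun i => cm α V (e i)) (Scheme.Hom.preimage_mono f h) ∘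
        (fun a i => fres f W (a i)) := by
      funext a; exact cm_lc α e h a
    have h2 : Function.Bijective (fun (a : ι → Γ(X, W)) i => fres f W (a i)) :=
      Function.Bijective.piMap fun _ => fres_bijective (h.trans hV)
    rw [← (hα W (h.trans hV)).of_comp_iff', h1, Function.Bijective.of_comp_iff _ h2]
  constructor
  · intro he W h
    exact (key W h).2 (he _ _)
  · intro he W h
    have h1 : f ''ᵁ W ≤ V := by
      rintro _ ⟨x, hx, rfl⟩; exact h hx
    have h3 := (key (f ''ᵁ W) h1).1 (he _ h1)
    have h2 : f ⁻¹ᵁ (f ''ᵁ W) = W := f.preimage_image_eq W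
    revert h3
    generalize_proofs p
    revert p
    rw [h2]
    exact fun _ h => h

lemma mres_bijective_of_eq (h : V ≤ U) (h' : V = U) :
    Function.Bijective (mres h : Γ(M, U) → Γ(M, V)) := by
  subst h'
  have : (mres h : Γ(M, V) → Γ(M, V)) = id := by funext s; exact mres_self s
  rw [this]; exact Function.bijective_id

variable (f) in
/-- The canonical morphism from `M` to the direct image of its restriction. -/
def restrictUnit (M : X.Modules) : M ⟶ (Scheme.Modules.pushforward f).obj (M.restrict f) :=
  (Scheme.Modules.restrictAdjunction f).unit.app M

lemma cm_restrictUnit (M : X.Modules) (s : Γ(M, U)) :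
    cm (restrictUnit f M) U s = (mres (f.image_preimage_le U) s : Γ(M, f ''ᵁ (f ⁻¹ᵁ U))) :=
  congr($(Scheme.Modules.restrictAdjunction_unit_app_app f M U) s)

lemma restrict_unit_bijective (M : X.Modules) (hU : U ≤ f.opensRange) : Function.Bijective
    (cm (restrictUnit f M) U) := by
  have h : f ''ᵁ (f ⁻¹ᵁ U) = U := by
    rw [f.image_preimage_eq_opensRange_inf, inf_eq_right]; exact hU
  have : (cm (restrictUnit f M) U : Γ(M, U) → Γ(M.restrict f, f ⁻¹ᵁ U)) =
      (mres (f.image_preimage_le U) : Γ(M, U) → Γ(M, f ''ᵁ (f ⁻¹ᵁ U))) := by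
    funext s; exact cm_restrictUnit M s
  rw [this]
  exact mres_bijective_of_eq (f.image_preimage_le U) h

end OpenImmersion

end Comorphism

/-! ### Locally free modules and frames -/

section LocallyFree

variable {X : Scheme.{0}} {M : X.Modules} {U : X.Opens} {ι : Type} [Fintype ι]

lemma isFrame_mres_of_eq {V : X.Opens} {e : ι → Γ(M, V)} (h : U ≤ V) (h' : U = V) :
    IsFrame (fun i => mres h (e i)) ↔ IsFrame e := by
  subst h'
  simp only [mres_self]

/-- `M` has a frame over `U` if and only if its restriction to `U` is free. -/
lemma exists_isFrame_iff [DecidableEq ι] : (∃ e : ι → Γ(M, U), IsFrame e) ↔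
    Nonempty (M.restrict U.ι ≅ (SheafOfModules.free (R := (U : Scheme.{0}).ringCatSheaf) ι :
      (U : Scheme.{0}).Modules)) := by
  have hU : U ≤ U.ι.opensRange := by simp
  have htop : U.ι ⁻¹ᵁ U = ⊤ := by simp
  have hb := fun (W : X.Opens) (hW : W ≤ U.ι.opensRange) => restrict_unit_bijective M hW
  obtain ⟨b, hb'⟩ := exists_isFrame_free (X := (U : Scheme.{0})) ι
  constructor
  · rintro ⟨e, he⟩
    have := (isFrame_cm_iff hb hU e).2 he
    rw [← isFrame_mres_of_eq htop.ge htop.symm] at this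
    exact ⟨this.iso hb'⟩
  · rintro ⟨i⟩
    have h1 := hb'.map_iso i.symm
    have h2 := h1.mres (le_top : U.ι ⁻¹ᵁ U ≤ ⊤)
    choose e he using fun j => (hb U hU).2 (mres le_top (i.symm.hom.app ⊤ (b j)))
    refine ⟨e, (isFrame_cm_iff hb hU e).1 ?_⟩
    simpa only [he] using h2

lemma IsLocallyFreeOfRank_iff (r : ℕ) : IsLocallyFreeOfRank M r ↔
    ∀ x : X, ∃ (U : X.Opens) (e : Fin r → Γ(M, U)), x ∈ U ∧ IsFrame e := by
  refine forall_congr' fun x => exists_congr fun U => ?_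
  rw [← exists_isFrame_iff]
  tauto

lemma IsVectorBundle_iff : IsVectorBundle M ↔
    ∀ x : X, ∃ (U : X.Opens) (r : ℕ) (e : Fin r → Γ(M, U)), x ∈ U ∧ IsFrame e := by
  refine forall_congr' fun x => exists_congr fun U => exists_congr fun r => ?_
  rw [← exists_isFrame_iff]
  tauto

end LocallyFree

/-! ### Frames of pullbacks -/

section Pullback

variable {X Y Z : Scheme.{0}} {f f' : Y ⟶ X} {M N : X.Modules} {P : Y.Modules}
  {U V W : X.Opens} {ι κ : Type} [Fintype ι] [Fintype κ]

variable (f M) in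
/-- The canonical morphism `M ⟶ f_* f^* M`, which maps a section to its pullback. -/
def pullUnit : M ⟶ (Scheme.Modules.pushforward f).obj ((Scheme.Modules.pullback f).obj M) :=
  (Scheme.Modules.pullbackPushforwardAdjunction f).unit.app M

/-- The morphism `f^* M ⟶ P` adjoint to `M ⟶ f_* P`. -/
def pullDesc (α : M ⟶ (Scheme.Modules.pushforward f).obj P) :
    (Scheme.Modules.pullback f).obj M ⟶ P :=
  ((Scheme.Modules.pullbackPushforwardAdjunction f).homEquiv _ _).symm α

lemma pullUnit_comp_pullDesc (α : M ⟶ (Scheme.Modules.pushforward f).obj P) :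
    pullUnit f M ≫ (Scheme.Modules.pushforward f).map (pullDesc α) = α :=
  ((Scheme.Modules.pullbackPushforwardAdjunction f).homEquiv_unit ..).symm.trans
    (Equiv.apply_symm_apply _ α)

lemma pullDesc_app (α : M ⟶ (Scheme.Modules.pushforward f).obj P) (s : Γ(M, U)) :
    (pullDesc α).app (f ⁻¹ᵁ U) (cm (pullUnit f M) U s) = cm α U s :=
  app_of_eq (pullUnit_comp_pullDesc α) U s

lemma pull_hom_ext {φ ψ : (Scheme.Modules.pullback f).obj M ⟶ P}
    (h : ∀ (U : X.Opens) (s : Γ(M, U)), φ.app (f ⁻¹ᵁ U) (cm (pullUnit f M) U s) =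
      ψ.app (f ⁻¹ᵁ U) (cm (pullUnit f M) U s)) : φ = ψ := by
  apply ((Scheme.Modules.pullbackPushforwardAdjunction f).homEquiv _ _).injective
  rw [Adjunction.homEquiv_unit, Adjunction.homEquiv_unit]
  ext U s
  exact h U s

lemma pullMap_app (φ : M ⟶ N) (s : Γ(M, U)) :
    ((Scheme.Modules.pullback f).map φ).app (f ⁻¹ᵁ U) (cm (pullUnit f M) U s) =
      cm (pullUnit f N) U (φ.app U s) :=
  (app_of_eq ((Scheme.Modules.pullbackPushforwardAdjunction f).unit.naturality φ) U s).symm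

lemma pullbackCongr_app (h : f = f') (s : Γ(M, U)) :
    ((Scheme.Modules.pullbackCongr h).hom.app M).app (f ⁻¹ᵁ U) (cm (pullUnit f M) U s) =
      mres (by rw [h]) (cm (pullUnit f' M) U s) := by
  subst h
  rw [mres_self]
  simp [Scheme.Modules.pullbackCongr]

lemma pullbackComp_inv_app (g : Z ⟶ Y) (f : Y ⟶ X) (M : X.Modules) (s : Γ(M, U)) :
    ((Scheme.Modules.pullbackComp g f).inv.app M).app (g ⁻¹ᵁ f ⁻¹ᵁ U)
      (cm (pullUnit (g ≫ f) M) U s) =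
      cm (pullUnit g ((Scheme.Modules.pullback f).obj M)) (f ⁻¹ᵁ U) (cm (pullUnit f M) U s) := by
  have h1 := unit_conjugateEquiv ((Scheme.Modules.pullbackPushforwardAdjunction f).comp
    (Scheme.Modules.pullbackPushforwardAdjunction g))
    (Scheme.Modules.pullbackPushforwardAdjunction (g ≫ f)) (Scheme.Modules.pullbackComp g f).inv M
  rw [Scheme.Modules.conjugateEquiv_pullbackComp_inv] at h1
  exact (app_of_eq h1 U s).symm

lemma pullbackComp_app (g : Z ⟶ Y) (f : Y ⟶ X) (M : X.Modules) (s : Γ(M, U)) :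
    ((Scheme.Modules.pullbackComp g f).hom.app M).app (g ⁻¹ᵁ f ⁻¹ᵁ U)
      (cm (pullUnit g ((Scheme.Modules.pullback f).obj M)) (f ⁻¹ᵁ U) (cm (pullUnit f M) U s)) =
    cm (pullUnit (g ≫ f) M) U s := by
  rw [← pullbackComp_inv_app]
  exact app_of_eq ((Scheme.Modules.pullbackComp g f).inv_hom_id_app M) (g ⁻¹ᵁ f ⁻¹ᵁ U) _

lemma pullUnit_bijective [IsOpenImmersion f] (M : X.Modules) (hU : U ≤ f.opensRange) :
    Function.Bijective (cm (pullUnit f M) U) := by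
  have h1 := Adjunction.unit_leftAdjointUniq_hom_app (Scheme.Modules.restrictAdjunction f)
    (Scheme.Modules.pullbackPushforwardAdjunction f) M
  have h2 : (cm (pullUnit f M) U : Γ(M, U) → _) =
      ((Scheme.Modules.restrictFunctorIsoPullback f).hom.app M).app (f ⁻¹ᵁ U) ∘
        cm (restrictUnit f M) U := by
    funext s
    exact (app_of_eq h1 U s).symm
  rw [h2]
  exact (ConcreteCategory.bijective_of_isIso
    (((Scheme.Modules.restrictFunctorIsoPullback f).hom.app M).app (f ⁻¹ᵁ U))).comp
    (restrict_unit_bijective M hU)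

lemma isFrame_pullUnit_top_aux (e : ι → Γ(M, ⊤)) (he : IsFrame e) (F : Y.Modules)
    (b : ι → Γ(F, f ⁻¹ᵁ ⊤)) (hb : IsFrame (V := ⊤) b) :
    IsFrame (V := f ⁻¹ᵁ ⊤) (fun i => cm (pullUnit f M) ⊤ (e i)) := by
  let ψ : F ⟶ (Scheme.Modules.pullback f).obj M := hb.desc (fun i => cm (pullUnit f M) ⊤ (e i))
  let α : M ⟶ (Scheme.Modules.pushforward f).obj F :=
    he.desc (N := (Scheme.Modules.pushforward f).obj F) b
  let φ := pullDesc α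
  have hφ : ∀ i, φ.app (f ⁻¹ᵁ ⊤) (cm (pullUnit f M) ⊤ (e i)) = b i := fun i =>
    (pullDesc_app α (e i)).trans (he.desc_app (N := (Scheme.Modules.pushforward f).obj F) b i)
  have hψ : ∀ i, ψ.app (f ⁻¹ᵁ ⊤) (b i) = cm (pullUnit f M) ⊤ (e i) := fun i => hb.desc_app _ i
  have h1 : φ ≫ ψ = 𝟙 _ := by
    apply ((Scheme.Modules.pullbackPushforwardAdjunction f).homEquiv _ _).injective
    refine he.hom_ext rfl _ _ fun i => ?_
    rw [Adjunction.homEquiv_unit, Adjunction.homEquiv_unit]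
    refine (congrArg (ψ.app (f ⁻¹ᵁ ⊤)) (hφ i)).trans ?_
    exact hψ i
  have h2 : ψ ≫ φ = 𝟙 _ := hb.hom_ext rfl _ _ fun i =>
    (congrArg (φ.app (f ⁻¹ᵁ ⊤)) (hψ i)).trans (hφ i)
  have := hb.map_iso ⟨ψ, φ, h2, h1⟩
  have h3 : (fun i => cm (pullUnit f M) ⊤ (e i)) = fun i => ψ.app (f ⁻¹ᵁ ⊤) (b i) := by
    funext i; exact (hψ i).symm
  rw [h3]
  exact this

/-- The pullback of a free module is free: this follows from the universal property. -/
lemma isFrame_pullUnit_top (hV : V = ⊤) (e : ι → Γ(M, V)) (he : IsFrame e) :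
    IsFrame (fun i => cm (pullUnit f M) V (e i)) := by
  classical
  subst hV
  obtain ⟨b, hb⟩ := exists_isFrame_free (X := Y) ι
  exact isFrame_pullUnit_top_aux e he _ b hb

/-- The pullback of a module has the pullbacks of frames as frames. -/
lemma isBC_pullUnit (f : Y ⟶ X) (M : X.Modules) : IsBC (pullUnit f M) := by
  intro V ι _ e he
  have hVr : V ≤ V.ι.opensRange := by simp
  have h1 := (isFrame_cm_iff (fun U hU => pullUnit_bijective (f := V.ι) M hU) hVr e).2 he
  have h2 := isFrame_pullUnit_top (f := f ∣_ V) (by simp) _ h1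
  let θ : (Scheme.Modules.pullback (f ∣_ V)).obj ((Scheme.Modules.pullback V.ι).obj M) ≅
      (Scheme.Modules.pullback (f ⁻¹ᵁ V).ι).obj ((Scheme.Modules.pullback f).obj M) :=
    (Scheme.Modules.pullbackComp (f ∣_ V) V.ι).app M ≪≫
      (Scheme.Modules.pullbackCongr (morphismRestrict_ι f V)).app M ≪≫
      ((Scheme.Modules.pullbackComp (f ⁻¹ᵁ V).ι f).app M).symm
  have h3 := h2.map_iso θ
  have hle : (f ∣_ V) ⁻¹ᵁ V.ι ⁻¹ᵁ V ≤ (f ⁻¹ᵁ V).ι ⁻¹ᵁ f ⁻¹ᵁ V := by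
    rw [← Scheme.Hom.comp_preimage, morphismRestrict_ι, Scheme.Hom.comp_preimage]
  have heq : (f ∣_ V) ⁻¹ᵁ V.ι ⁻¹ᵁ V = (f ⁻¹ᵁ V).ι ⁻¹ᵁ f ⁻¹ᵁ V := by
    rw [← Scheme.Hom.comp_preimage, morphismRestrict_ι, Scheme.Hom.comp_preimage]
  have hθ : ∀ i, θ.hom.app ((f ∣_ V) ⁻¹ᵁ V.ι ⁻¹ᵁ V) (cm (pullUnit (f ∣_ V) _) (V.ι ⁻¹ᵁ V)
      (cm (pullUnit V.ι M) V (e i))) =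
      mres hle (cm (pullUnit (f ⁻¹ᵁ V).ι _) (f ⁻¹ᵁ V) (cm (pullUnit f M) V (e i))) := by
    intro i
    have s1 := pullbackComp_app (f ∣_ V) V.ι M (e i)
    have s2 := pullbackCongr_app (morphismRestrict_ι f V) (e i)
    have s3 := pullbackComp_inv_app (f ⁻¹ᵁ V).ι f M (e i)
    refine (congrArg (fun z => ((Scheme.Modules.pullbackComp (f ⁻¹ᵁ V).ι f).inv.app M).app _
      (((Scheme.Modules.pullbackCongr (morphismRestrict_ι f V)).hom.app M).app _ z)) s1).trans ?_
    refine (congrArg (fun z => ((Scheme.Modules.pullbackComp (f ⁻¹ᵁ V).ι f).inv.app M).app _ z)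
      s2).trans ?_
    refine (app_mres ((Scheme.Modules.pullbackComp (f ⁻¹ᵁ V).ι f).inv.app M) hle _).trans ?_
    exact congrArg (mres hle) s3
  simp only [hθ] at h3
  rw [isFrame_mres_of_eq hle heq] at h3
  exact (isFrame_cm_iff (fun U hU => pullUnit_bijective (f := (f ⁻¹ᵁ V).ι) _ hU)
    (by simp) _).1 h3

end Pullback

/-! ### Base change of subbundles -/

section BaseChange

variable {X Y Z : Scheme.{0}} {f : Y ⟶ X} {M : X.Modules} {M' : Y.Modules}
  {U V W : X.Opens} {ι κ : Type} [Fintype ι] [Fintype κ]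

lemma mres_cm_mres (α : M ⟶ (Scheme.Modules.pushforward f).obj M') {W : Y.Opens} (h : V ≤ U)
    (h' : W ≤ f ⁻¹ᵁ V) (s : Γ(M, U)) : mres h' (cm α V (mres h s)) =
      mres (h'.trans (Scheme.Hom.preimage_mono f h)) (cm α U s) := by
  rw [cm_mres, mres_mres]

/-- Restriction maps the span of a set into the span of the restrictions. -/
lemma mres_mem_span {X : Scheme.{0}} {M : X.Modules} {V W : X.Opens} (h : W ≤ V)
    {A : Set Γ(M, V)} {B : Set Γ(M, W)} (hAB : ∀ a ∈ A, mres h a ∈ B) {s : Γ(M, V)}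
    (hs : s ∈ Submodule.span Γ(X, V) A) : mres h s ∈ Submodule.span Γ(X, W) B := by
  refine Submodule.span_induction ?_ ?_ ?_ ?_ hs
  · exact fun a ha => Submodule.subset_span (hAB a ha)
  · rw [map_zero]; exact zero_mem _
  · intro a b _ _ ha hb; rw [map_add]; exact add_mem ha hb
  · intro c a _ ha; rw [mres_smul]; exact Submodule.smul_mem _ _ ha

/-- The pullback of a subsheaf `S ⊂ M` along a morphism `α : M ⟶ f_* M'`: the subsheaf of `M'`
generated by the images of the sections of `S`. -/
def SubMod.bc (S : SubMod M) (α : M ⟶ (Scheme.Modules.pushforward f).obj M') : SubMod M' where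
  carrier W :=
    { carrier := { s | ∀ y ∈ W, ∃ (W' : Y.Opens) (hW : W' ≤ W) (U : X.Opens) (h : W' ≤ f ⁻¹ᵁ U),
        y ∈ W' ∧ mres hW s ∈ Submodule.span Γ(Y, W')
          (Set.range fun n : S.carrier U => mres h (cm α U n.1)) }
      zero_mem' := fun y hy => ⟨W, le_rfl, ⊤, le_top, hy, by rw [map_zero]; exact zero_mem _⟩
      add_mem' := by
        intro s t hs ht y hy
        obtain ⟨W₁, hW₁, U₁, h₁, hy₁, m₁⟩ := hs y hy
        obtain ⟨W₂, hW₂, U₂, h₂, hy₂, m₂⟩ := ht y hy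
        refine ⟨W₁ ⊓ W₂, inf_le_left.trans hW₁, U₁ ⊓ U₂, inf_le_inf h₁ h₂, ⟨hy₁, hy₂⟩, ?_⟩
        rw [map_add]
        refine add_mem ?_ ?_
        · rw [← mres_mres hW₁ inf_le_left]
          refine mres_mem_span _ ?_ m₁
          rintro _ ⟨n, rfl⟩
          refine ⟨⟨_, S.res_mem inf_le_left n.2⟩, ?_⟩
          rw [mres_mres]
          exact (congrArg (mres (inf_le_inf h₁ h₂)) (cm_mres α inf_le_left n.1)).trans
            (mres_mres _ _ _)
        · rw [← mres_mres hW₂ inf_le_right]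
          refine mres_mem_span _ ?_ m₂
          rintro _ ⟨n, rfl⟩
          refine ⟨⟨_, S.res_mem inf_le_right n.2⟩, ?_⟩
          rw [mres_mres]
          exact (congrArg (mres (inf_le_inf h₁ h₂)) (cm_mres α inf_le_right n.1)).trans
            (mres_mres _ _ _)
      smul_mem' := by
        intro c s hs y hy
        obtain ⟨W₁, hW₁, U₁, h₁, hy₁, m₁⟩ := hs y hy
        exact ⟨W₁, hW₁, U₁, h₁, hy₁, by rw [mres_smul]; exact Submodule.smul_mem _ _ m₁⟩ }
  res_mem := by
    intro W₁ W₂ h s hs y hy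
    obtain ⟨W', hW', U, h', hy', m⟩ := hs y (h hy)
    refine ⟨W' ⊓ W₂, inf_le_right, U, inf_le_left.trans h', ⟨hy', hy⟩, ?_⟩
    have : mres (inf_le_right : W' ⊓ W₂ ≤ W₂) (mres h s) = mres inf_le_left (mres hW' s) := by
      rw [mres_mres, mres_mres]
    rw [this]
    refine mres_mem_span _ ?_ m
    rintro _ ⟨n, rfl⟩
    exact ⟨n, (mres_mres _ _ _).symm⟩
  local_mem := by
    intro W s h y hy
    obtain ⟨W₁, hW₁, hy₁, hs⟩ := h y hy
    obtain ⟨W₂, hW₂, U, h₂, hy₂, m⟩ := hs y hy₁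
    exact ⟨W₂, hW₂.trans hW₁, U, h₂, hy₂, by rwa [mres_mres] at m⟩

lemma SubMod.cm_mem_bc {S : SubMod M} (α : M ⟶ (Scheme.Modules.pushforward f).obj M')
    {s : Γ(M, U)} (hs : s ∈ S.carrier U) : cm α U s ∈ (S.bc α).carrier (f ⁻¹ᵁ U) :=
  fun _ hy => ⟨_, le_rfl, U, le_rfl, hy, Submodule.subset_span ⟨⟨s, hs⟩, rfl⟩⟩

/-- The elements spanned by the first part of a frame. -/
def IsFrame.inlSpan {X : Scheme.{0}} {M : X.Modules} {V : X.Opens} {e : ι ⊕ κ → Γ(M, V)}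
    (he : IsFrame e) (W : X.Opens) (h : W ≤ V) : Submodule Γ(X, W) Γ(M, W) where
  carrier := { s | ∀ k, he.coord h s (Sum.inr k) = 0 }
  zero_mem' k := by rw [← lc_zero e h, he.coord_lc]; rfl
  add_mem' {a b} ha hb k := by
    rw [he.coord_add, Pi.add_apply, ha k, hb k, add_zero]
  smul_mem' c a ha k := by
    rw [he.coord_smul, Pi.smul_apply, ha k, smul_zero]

lemma SubMod.IsAdapted.mem_iff_coord {X : Scheme.{0}} {M : X.Modules} {V W : X.Opens} {S : SubMod M}
    {e : ι ⊕ κ → Γ(M, V)} (he : S.IsAdapted e) (h : W ≤ V) (s : Γ(M, W)) :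
    s ∈ S.carrier W ↔ ∀ k, he.isFrame.coord h s (Sum.inr k) = 0 := by
  rw [← he.mem_iff W h, he.isFrame.lc_coord]

lemma SubMod.IsAdapted.bc {S : SubMod M} {e : ι ⊕ κ → Γ(M, V)} (he : S.IsAdapted e)
    {α : M ⟶ (Scheme.Modules.pushforward f).obj M'} (hα : IsBC α) :
    (S.bc α).IsAdapted (fun i => cm α V (e i)) where
  isFrame := hα V _ e he.isFrame
  mem_iff W h a := by
    have hF := hα V _ e he.isFrame
    constructor
    · intro hs k
      refine eq_of_locally_ring fun y hy => ?_
      obtain ⟨W', hW', U, h', hy', m⟩ := hs y hy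
      refine ⟨W', hW', hy', ?_⟩
      have hle : Submodule.span Γ(Y, W') (Set.range fun n : S.carrier U => HiggsGrass.mres h'
        (cm α U n.1)) ≤
          hF.inlSpan W' (hW'.trans h) := by
        rw [Submodule.span_le]
        rintro _ ⟨n, rfl⟩ k
        have h1 := S.res_mem (inf_le_left : U ⊓ V ≤ U) n.2
        have h2 := (he.mem_iff_coord inf_le_right _).1 h1
        have hUV : W' ≤ f ⁻¹ᵁ (U ⊓ V) := le_inf h' (hW'.trans h)
        have h3 := mres_cm_mres α inf_le_left hUV n.1
        rw [← he.isFrame.lc_coord inf_le_right (HiggsGrass.mres inf_le_left n.1), cm_lc, mres_lc]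
          at h3
        change hF.coord _ (HiggsGrass.mres h' (cm α U n.1)) _ = 0
        refine (congrArg (fun z => hF.coord (hW'.trans h) z (Sum.inr k)) h3.symm).trans ?_
        rw [hF.coord_lc, h2 k, map_zero, map_zero]
      have := hle m k
      rw [mres_lc, hF.coord_lc] at this
      rw [this]; exact (map_zero _).symm
    · intro h0 y hy
      refine ⟨W, le_rfl, V, h, hy, ?_⟩
      rw [mres_self, lc_sumElim]
      refine add_mem (sum_mem fun i _ => Submodule.smul_mem _ _ (Submodule.subset_span ?_)) ?_
      · exact ⟨⟨_, he.inl_mem i⟩, rfl⟩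
      · have : a ∘ Sum.inr = 0 := funext h0
        rw [this, lc_zero]; exact zero_mem _

lemma SubMod.IsSub.bc {S : SubMod M} {d : ℕ} (hS : S.IsSub d)
    {α : M ⟶ (Scheme.Modules.pushforward f).obj M'} (hα : IsBC α) : (S.bc α).IsSub d := by
  intro y
  obtain ⟨V, r, e, hV, he⟩ := hS (f y)
  exact ⟨f ⁻¹ᵁ V, r, _, hV, he.bc hα⟩

/-- Along open immersions, membership in a subsheaf can be tested after pullback. -/
lemma SubMod.IsSub.cm_mem_iff [IsOpenImmersion f] {S : SubMod M} {d : ℕ} (hS : S.IsSub d)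
    {α : M ⟶ (Scheme.Modules.pushforward f).obj M'} (hα : IsBC α) (hU : U ≤ f.opensRange)
    (s : Γ(M, U)) : cm α U s ∈ (S.bc α).carrier (f ⁻¹ᵁ U) ↔ s ∈ S.carrier U := by
  refine ⟨fun h => S.local_mem fun x hx => ?_, S.cm_mem_bc α⟩
  obtain ⟨V, r, e, hV, he⟩ := hS x
  refine ⟨U ⊓ V, inf_le_left, ⟨hx, hV⟩, (he.mem_iff_coord inf_le_right _).2 fun k => ?_⟩
  have h1 := (S.bc α).res_mem (Scheme.Hom.preimage_mono f (inf_le_left : U ⊓ V ≤ U)) h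
  rw [← cm_mres α (inf_le_left : U ⊓ V ≤ U), ← he.isFrame.lc_coord inf_le_right
    (mres inf_le_left s), cm_lc] at h1
  have h2 := ((he.bc hα).mem_iff _ _ _).1 h1 k
  exact (fres_bijective (inf_le_left.trans hU)).1 (h2.trans (map_zero _).symm)

end BaseChange

/-! ### Base change along morphisms of schemes over a base -/

section BaseChangeMap

variable {X G T T' : Scheme.{0}} {π : G ⟶ X} {f : T ⟶ X} {f' : T' ⟶ X} {U V W : X.Opens}
  {ι κ : Type} [Fintype ι] [Fintype κ]

/-- For a morphism `g` over `X` from `f : T ⟶ X` to `π : G ⟶ X`, the canonical morphism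
`π^* E ⟶ g_* f^* E`, which presents `f^* E` as the pullback of `π^* E`. -/
def bcm (g : T ⟶ G) (h : g ≫ π = f) (E : X.Modules) : (Scheme.Modules.pullback π).obj E ⟶
    (Scheme.Modules.pushforward g).obj ((Scheme.Modules.pullback f).obj E) :=
  pullUnit g _ ≫ (Scheme.Modules.pushforward g).map
    (((Scheme.Modules.pullbackComp g π).app E ≪≫ (Scheme.Modules.pullbackCongr h).app E).hom)

lemma isBC_bcm (g : T ⟶ G) (h : g ≫ π = f) (E : X.Modules) : IsBC (bcm g h E) :=
  (isBC_pullUnit g _).comp_iso _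

lemma preimage_le_of_comp (g : T ⟶ G) (h : g ≫ π = f) (U : X.Opens) : g ⁻¹ᵁ π ⁻¹ᵁ U ≤ f ⁻¹ᵁ U := by
  subst h; exact le_rfl

lemma bcm_app (g : T ⟶ G) (h : g ≫ π = f) {E : X.Modules} {U : G.Opens}
    (s : Γ((Scheme.Modules.pullback π).obj E, U)) :
    cm (bcm g h E) U s = ((Scheme.Modules.pullbackCongr h).hom.app E).app (g ⁻¹ᵁ U)
      (((Scheme.Modules.pullbackComp g π).hom.app E).app (g ⁻¹ᵁ U) (cm (pullUnit g _) U s)) := rfl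

lemma bcm_pullUnit (g : T ⟶ G) (h : g ≫ π = f) {E : X.Modules} (s : Γ(E, U)) :
    cm (bcm g h E) (π ⁻¹ᵁ U) (cm (pullUnit π E) U s) =
      mres (preimage_le_of_comp g h U) (cm (pullUnit f E) U s) := by
  rw [bcm_app]
  have h1 := pullbackComp_app g π E s
  rw [h1]
  exact pullbackCongr_app h s

lemma cm_congr {M : G.Modules} {P : T.Modules} {g : T ⟶ G}
    {α β : M ⟶ (Scheme.Modules.pushforward g).obj P} (h : α = β) {U : G.Opens} (s : Γ(M, U)) :
    cm α U s = cm β U s := by rw [h]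

lemma bcm_comp (g : T ⟶ G) (h : g ≫ π = f) (g' : T' ⟶ T) (h' : g' ≫ f = f')
    (h'' : (g' ≫ g) ≫ π = f') {E : X.Modules} {U : G.Opens}
    (s : Γ((Scheme.Modules.pullback π).obj E, U)) :
    cm (bcm (g' ≫ g) h'' E) U s = cm (bcm g' h' E) (g ⁻¹ᵁ U) (cm (bcm g h E) U s) := by
  have key : bcm (g' ≫ g) h'' E =
      (bcm g h E ≫ (Scheme.Modules.pushforward g).map (bcm g' h' E) ≫
        (Scheme.Modules.pushforwardComp g' g).hom.app _) := by
    refine pull_hom_ext fun U s => ?_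
    refine (bcm_pullUnit (g' ≫ g) h'' s).trans ?_
    have h1 := bcm_pullUnit g h s
    have h2 := bcm_pullUnit g' h' s
    change _ = cm (bcm g' h' E) (g ⁻¹ᵁ π ⁻¹ᵁ U) (cm (bcm g h E) (π ⁻¹ᵁ U) (cm (pullUnit π E) U s))
    rw [h1, cm_mres]
    refine Eq.trans ?_ (congrArg (mres _) h2.symm)
    exact (mres_mres _ _ _).symm
  exact cm_congr key s

lemma bcm_id (g : T ⟶ T) (hg : g = 𝟙 T) (h : g ≫ f = f) {E : X.Modules} {U : T.Opens}
    (s : Γ((Scheme.Modules.pullback f).obj E, U)) :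
    cm (bcm g h E) U s = mres (by rw [hg]; exact le_rfl) s := by
  subst hg
  refine Eq.trans ?_ (mres_self s).symm
  have key : bcm (𝟙 T) h E = (Scheme.Modules.pushforwardId T).inv.app _ := by
    refine pull_hom_ext fun U s => ?_
    exact (bcm_pullUnit (𝟙 T) h s).trans (mres_self _)
  exact cm_congr key s

lemma bcm_naturality (g : T ⟶ G) (h : g ≫ π = f) {E E' : X.Modules} (φ : E ⟶ E') {U : G.Opens}
    (s : Γ((Scheme.Modules.pullback π).obj E, U)) :
    cm (bcm g h E') U (((Scheme.Modules.pullback π).map φ).app U s) =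
      ((Scheme.Modules.pullback f).map φ).app (g ⁻¹ᵁ U) (cm (bcm g h E) U s) := by
  have key : (Scheme.Modules.pullback π).map φ ≫ bcm g h E' =
      bcm g h E ≫ (Scheme.Modules.pushforward g).map ((Scheme.Modules.pullback f).map φ) := by
    refine pull_hom_ext fun U s => ?_
    have h1 := pullMap_app (f := π) φ s
    have h2 := pullMap_app (f := f) φ s
    refine (congrArg (cm (bcm g h E') (π ⁻¹ᵁ U)) h1).trans ?_
    refine (bcm_pullUnit g h (φ.app U s)).trans ?_
    refine Eq.trans ?_ (congrArg (((Scheme.Modules.pullback f).map φ).app (g ⁻¹ᵁ π ⁻¹ᵁ U))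
      (bcm_pullUnit g h s).symm)
    rw [app_mres, h2]
  exact cm_congr key s

lemma SubMod.bc_bcm_comp {d : ℕ} {E : X.Modules}
    {N : SubMod ((Scheme.Modules.pullback π).obj E)} (hN : N.IsSub d) (g : T ⟶ G) (h : g ≫ π = f)
    (g' : T' ⟶ T) (h' : g' ≫ f = f') (h'' : (g' ≫ g) ≫ π = f') :
    N.bc (bcm (g' ≫ g) h'' E) = (N.bc (bcm g h E)).bc (bcm g' h' E) := by
  refine SubMod.eq_of_adapted fun x => ?_
  obtain ⟨V, r, e, hV, he⟩ := hN (g (g' x))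
  refine ⟨g' ⁻¹ᵁ g ⁻¹ᵁ V, _, _, inferInstance, inferInstance, _, hV, ?_,
    (he.bc (isBC_bcm g h E)).bc (isBC_bcm g' h' E)⟩
  have := he.bc (isBC_bcm (g' ≫ g) h'' E)
  simp only [bcm_comp g h g' h' h''] at this
  exact this

lemma SubMod.bc_bcm_id {d : ℕ} {E : X.Modules}
    {N : SubMod ((Scheme.Modules.pullback f).obj E)} (hN : N.IsSub d) (h : 𝟙 T ≫ f = f) :
    N.bc (bcm (𝟙 T) h E) = N := by
  refine SubMod.eq_of_adapted fun x => ?_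
  obtain ⟨V, r, e, hV, he⟩ := hN x
  have := he.bc (isBC_bcm (𝟙 T) h E)
  simp only [bcm_id (𝟙 T) rfl h] at this
  exact ⟨𝟙 T ⁻¹ᵁ V, _, _, inferInstance, inferInstance, _, hV, this, he.mres _⟩

end BaseChangeMap

/-! ### Subbundles and adapted frames -/

section Subbundle

variable {X : Scheme.{0}} {F E : X.Modules} {U V W : X.Opens} {ι κ : Type} [Fintype ι] [Fintype κ]

/-- A morphism is a monomorphism if it maps, locally, a frame to a part of a frame. -/
lemma isMono_of_frames {i : F ⟶ E}
    (h : ∀ x : X, ∃ (V : X.Opens) (ι κ : Type) (_ : Fintype ι) (_ : Fintype κ)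
      (e : ι ⊕ κ → Γ(E, V)) (t : ι → Γ(F, V)), x ∈ V ∧ IsFrame e ∧ IsFrame t ∧
        ∀ j, i.app V (t j) = e (Sum.inl j)) : Mono i := by
  refine mono_of_injective i fun U => (injective_iff_map_eq_zero (i.app U).hom).2 fun s hs => ?_
  refine eq_of_locally fun x hx => ?_
  obtain ⟨V, ι, κ, _, _, e, t, hxV, he, ht, hi⟩ := h x
  refine ⟨U ⊓ V, inf_le_left, ⟨hx, hxV⟩, ?_⟩
  have h1 : i.app (U ⊓ V) (mres inf_le_left s) = 0 := by
    rw [app_mres]; exact (congrArg _ hs).trans (map_zero _)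
  rw [← ht.lc_coord inf_le_right (mres inf_le_left s), app_lc] at h1
  simp only [hi] at h1
  have h2 : lc e inf_le_right (Sum.elim (ht.coord inf_le_right (mres inf_le_left s)) 0) =
      lc e inf_le_right 0 := by
    rw [lc_sumElim, lc_zero]
    simp only [Sum.elim_comp_inl, Sum.elim_comp_inr, lc_zero, add_zero]
    exact h1
  have h3 := (he _ _).1 h2
  rw [← ht.lc_coord inf_le_right (mres inf_le_left s), map_zero]
  have h4 : ht.coord inf_le_right (mres inf_le_left s) = 0 := funext fun j => congrFun h3
    (Sum.inl j)
  rw [h4, lc_zero]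

lemma isAdapted_imageSub (i : F ⟶ E) [Mono i] {e : ι ⊕ κ → Γ(E, V)} {t : ι → Γ(F, V)}
    (he : IsFrame e) (ht : IsFrame t) (h : ∀ j, i.app V (t j) = e (Sum.inl j)) :
    (imageSub i).IsAdapted e where
  isFrame := he
  mem_iff W hW a := by
    have key : ∀ b : ι → Γ(X, W), i.app W (lc t hW b) = lc e hW (Sum.elim b 0) := by
      intro b
      rw [app_lc, lc_sumElim]
      simp only [Sum.elim_comp_inl, Sum.elim_comp_inr, lc_zero, add_zero, h]
      rfl
    rw [mem_imageSub]
    constructor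
    · rintro ⟨s, hs⟩ k
      rw [← ht.lc_coord hW s, key] at hs
      rw [← (he W hW).1 hs]; rfl
    · intro h0
      refine ⟨lc t hW (a ∘ Sum.inl), ?_⟩
      rw [key]
      congr 1
      funext j
      rcases j with j | j
      · rfl
      · exact (h0 j).symm

/-- The part of an adapted frame that spans the image of `i` lifts to a frame of the source of `i`. -/
lemma SubMod.IsAdapted.exists_lift {i : F ⟶ E} [Mono i] {e : ι ⊕ κ → Γ(E, V)}
    (he : (imageSub i).IsAdapted e) :
    ∃ t : ι → Γ(F, V), IsFrame t ∧ ∀ j, i.app V (t j) = e (Sum.inl j) := by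
  choose t ht using fun j => (mem_imageSub i _).1 (he.inl_mem j)
  refine ⟨t, fun W hW => ?_, ht⟩
  have key : ∀ b : ι → Γ(X, W), i.app W (lc t hW b) = lc e hW (Sum.elim b 0) := by
    intro b
    rw [app_lc, lc_sumElim]
    simp only [Sum.elim_comp_inl, Sum.elim_comp_inr, lc_zero, add_zero, ht]
    rfl
  constructor
  · intro a b hab
    have := (he.isFrame W hW).1 ((key a).symm.trans ((congrArg _ hab).trans (key b)))
    exact funext fun j => congrFun this (Sum.inl j)
  · intro s
    have h1 := (he.mem_iff_coord hW (i.app W s)).1 ⟨s, rfl⟩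
    refine ⟨he.isFrame.coord hW (i.app W s) ∘ Sum.inl, injective_of_mono i W ?_⟩
    rw [key]
    conv_rhs => rw [← he.isFrame.lc_coord hW (i.app W s)]
    congr 1
    funext j
    rcases j with j | j
    · rfl
    · exact (h1 j).symm

/-- A frame of the cokernel lifts to a complement of a frame of the subsheaf. -/
lemma isFrame_of_cokernel (i : F ⟶ E) [Mono i] {t : ι → Γ(F, V)} (ht : IsFrame t)
    {q : κ → Γ(E, V)} (hq : IsFrame fun k => (cokernel.π i).app V (q k)) :
    IsFrame (Sum.elim (fun j => i.app V (t j)) q) := by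
  intro W hW
  have key : ∀ a : ι ⊕ κ → Γ(X, W), lc (Sum.elim (fun j => i.app V (t j)) q) hW a =
      i.app W (lc t hW (a ∘ Sum.inl)) + lc q hW (a ∘ Sum.inr) := by
    intro a; rw [lc_sumElim, app_lc]; rfl
  have hπ : ∀ s, (cokernel.π i).app W (i.app W s) = 0 :=
    fun s => app_of_eq (cokernel.condition i) W s
  have key2 : ∀ a : ι ⊕ κ → Γ(X, W), (cokernel.π i).app W
      (lc (Sum.elim (fun j => i.app V (t j)) q) hW a) =
      lc (fun k => (cokernel.π i).app V (q k)) hW (a ∘ Sum.inr) := by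
    intro a; rw [key, map_add, hπ, zero_add, app_lc]
  constructor
  · intro a b hab
    have h1 := (hq W hW).1 ((key2 a).symm.trans ((congrArg _ hab).trans (key2 b)))
    rw [key, key, h1] at hab
    have h2 := (ht W hW).1 (injective_of_mono i W (add_right_cancel hab))
    funext j
    rcases j with j | j
    · exact congrFun h2 j
    · exact congrFun h1 j
  · intro s
    obtain ⟨b, hb⟩ := (hq W hW).2 ((cokernel.π i).app W s)
    have h1 : (cokernel.π i).app W (s - lc q hW b) = 0 := by
      rw [map_sub, app_lc, hb, sub_self]
    obtain ⟨s', hs'⟩ := exists_of_cokernel_eq_zero i _ h1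
    obtain ⟨a, ha⟩ := (ht W hW).2 s'
    refine ⟨Sum.elim a b, ?_⟩
    rw [key]
    simp only [Sum.elim_comp_inl, Sum.elim_comp_inr, ha, hs', sub_add_cancel]

/-- The complementary part of an adapted frame maps to a frame of the cokernel. -/
lemma SubMod.IsAdapted.isFrame_cokernel {i : F ⟶ E} [Mono i] {e : ι ⊕ κ → Γ(E, V)}
    (he : (imageSub i).IsAdapted e) :
    IsFrame fun k => (cokernel.π i).app V (e (Sum.inr k)) := by
  have hlc : ∀ (W : X.Opens) (hW : W ≤ V) (a : κ → Γ(X, W)),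
      lc (fun k => (cokernel.π i).app V (e (Sum.inr k))) hW a =
        (cokernel.π i).app W (lc e hW (Sum.elim 0 a)) := by
    intro W hW a
    rw [lc_sumElim]
    simp only [Sum.elim_comp_inl, Sum.elim_comp_inr, lc_zero, zero_add]
    rw [app_lc]; rfl
  refine isFrame_of_locally ?_ ?_
  · intro W hW a ha x hx
    rw [hlc] at ha
    obtain ⟨s, hs⟩ := exists_of_cokernel_eq_zero i _ ha
    have := (he.mem_iff W hW _).1 ⟨s, hs⟩
    exact ⟨W, le_rfl, hx, fun k => by rw [rres_self]; exact this k⟩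
  · intro W hW s x hx
    obtain ⟨W', hW', t, hx', ht⟩ := locally_surjective_of_epi (cokernel.π i) s x hx
    refine ⟨W', hW', he.isFrame.coord (hW'.trans hW) t ∘ Sum.inr, hx', ?_⟩
    rw [hlc, ← ht]
    have h2 : (cokernel.π i).app W' (lc e (hW'.trans hW)
        (Sum.elim (he.isFrame.coord (hW'.trans hW) t ∘ Sum.inl) 0)) = 0 := by
      obtain ⟨s', hs'⟩ := (he.mem_iff W' (hW'.trans hW)
        (Sum.elim (he.isFrame.coord (hW'.trans hW) t ∘ Sum.inl) 0)).2 fun _ => rfl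
      rw [← hs']
      exact app_of_eq (cokernel.condition i) W' s'
    conv_rhs => rw [← he.isFrame.lc_coord (hW'.trans hW) t]
    refine (zero_add _).symm.trans ?_
    rw [← h2, ← map_add, ← lc_add]
    congr 2
    funext j
    rcases j with j | j <;> simp

/-- Subbundles are the monomorphisms whose image is spanned, locally, by a part of a frame. -/
lemma isSubbundle_iff (i : F ⟶ E) (d : ℕ) :
    IsSubbundle i d ↔ ∃ _ : Mono i, (imageSub i).IsSub d := by
  constructor
  · rintro ⟨hm, h1, h2⟩
    refine ⟨hm, fun x => ?_⟩
    obtain ⟨U, t, hxU, ht⟩ := (IsLocallyFreeOfRank_iff d).1 h1 x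
    obtain ⟨V, r, c, hxV, hc⟩ := IsVectorBundle_iff.1 h2 x
    choose W hW q hxW hq using fun k : Fin r => locally_surjective_of_epi (cokernel.π i) (c k) x hxV
    let W₀ : X.Opens := U ⊓ V ⊓ Finset.univ.inf W
    have hx0 : x ∈ W₀ := by
      refine ⟨⟨hxU, hxV⟩, ?_⟩
      have : ∀ s : Finset (Fin r), x ∈ s.inf W := by
        intro s
        induction s using Finset.induction_on with
        | empty => simp
        | insert a s _ ih => rw [Finset.inf_insert]; exact ⟨hxW a, ih⟩
      exact this _
    have hW0 : ∀ k, W₀ ≤ W k := fun k => inf_le_right.trans (Finset.inf_le (Finset.mem_univ k))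
    have hU0 : W₀ ≤ U := inf_le_left.trans inf_le_left
    have hV0 : W₀ ≤ V := inf_le_left.trans inf_le_right
    have hq' : IsFrame fun k => (cokernel.π i).app W₀ (mres (hW0 k) (q k)) := by
      have := hc.mres hV0
      convert this using 2 with k
      rw [app_mres, hq, mres_mres]
    have hF := isFrame_of_cokernel i (ht.mres hU0) hq'
    exact ⟨W₀, r, _, hx0, isAdapted_imageSub i hF (ht.mres hU0) fun _ => rfl⟩
  · rintro ⟨hm, h⟩
    refine ⟨hm, (IsLocallyFreeOfRank_iff d).2 fun x => ?_, IsVectorBundle_iff.2 fun x => ?_⟩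
    · obtain ⟨V, r, e, hV, he⟩ := h x
      obtain ⟨t, ht, -⟩ := he.exists_lift
      exact ⟨V, t, hV, ht⟩
    · obtain ⟨V, r, e, hV, he⟩ := h x
      exact ⟨V, r, _, hV, he.isFrame_cokernel⟩

end Subbundle

/-! ### The universal property in terms of subsheaves -/

section Classifying

variable {X G T : Scheme.{0}} {π : G ⟶ X} {f : T ⟶ X} {E : X.Modules} {d : ℕ}
  {ι κ : Type} [Fintype ι] [Fintype κ]

/-- A family of subbundles is classified by `g` if and only if its image is the pullback of the
image of the tautological subbundle. -/
lemma classifies_iff {S : G.Modules} {a : S ⟶ (Scheme.Modules.pullback π).obj E} [Mono a]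
    (ha : (imageSub a).IsSub d) (g : T ⟶ G) {F : T.Modules}
    (i : F ⟶ (Scheme.Modules.pullback f).obj E) [Mono i] :
    Classifies a g f i ↔ ∃ h : g ≫ π = f, (imageSub a).bc (bcm g h E) = imageSub i := by
  refine exists_congr fun h => ?_
  let m : (Scheme.Modules.pullback g).obj S ⟶ (Scheme.Modules.pullback f).obj E :=
    (Scheme.Modules.pullback g).map a ≫
      (Scheme.Modules.pullbackComp g π).hom.app E ≫ (Scheme.Modules.pullbackCongr h).hom.app E
  have key : ∀ {V : G.Opens} (s : Γ(S, V)), m.app (g ⁻¹ᵁ V) (cm (pullUnit g S) V s) =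
      cm (bcm g h E) V (a.app V s) := by
    intro V s
    rw [bcm_app, ← pullMap_app]
    rfl
  have hloc : ∀ y : T, ∃ (V : G.Opens) (r : ℕ) (e : Fin d ⊕ Fin r → _) (t : Fin d → Γ(S, V)),
      y ∈ g ⁻¹ᵁ V ∧ (imageSub a).IsAdapted e ∧ IsFrame t ∧ ∀ j, a.app V (t j) = e (Sum.inl j) := by
    intro y
    obtain ⟨V, r, e, hV, he⟩ := ha (g y)
    obtain ⟨t, ht, h⟩ := he.exists_lift
    exact ⟨V, r, e, t, hV, he, ht, h⟩
  have hmono : Mono m := isMono_of_frames fun y => by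
    obtain ⟨V, r, e, t, hV, he, ht, h'⟩ := hloc y
    exact ⟨g ⁻¹ᵁ V, _, _, inferInstance, inferInstance, _, _, hV, (he.bc (isBC_bcm g h E)).isFrame,
      isBC_pullUnit g S V _ t ht, fun j => (key _).trans (by rw [h'])⟩
  have himg : imageSub m = (imageSub a).bc (bcm g h E) := SubMod.eq_of_adapted fun y => by
    obtain ⟨V, r, e, t, hV, he, ht, h'⟩ := hloc y
    have hb := he.bc (isBC_bcm g h E)
    exact ⟨g ⁻¹ᵁ V, _, _, inferInstance, inferInstance, _, hV, isAdapted_imageSub m hb.isFrame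
      (isBC_pullUnit g S V _ t ht) fun j => (key _).trans (by rw [h']), hb⟩
  rw [← himg]
  constructor
  · rintro ⟨e, he⟩
    have he : i = e.hom ≫ m := he
    ext U s
    simp only [mem_imageSub]
    constructor
    · rintro ⟨t, rfl⟩
      refine ⟨e.inv.app U t, ?_⟩
      rw [he]
      exact congrArg (m.app U) (app_of_eq e.inv_hom_id U t)
    · rintro ⟨t, rfl⟩
      rw [he]
      exact ⟨e.hom.app U t, rfl⟩
  · intro himg'
    exact exists_iso_of_imageSub_eq i m himg'.symm

/-- The universal property of a Grassmann bundle in terms of subsheaves: `N ⊂ π^* E` is the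
universal subbundle of rank `d`. -/
structure IsUniversalSub (π : G ⟶ X) (d : ℕ) (N : SubMod ((Scheme.Modules.pullback π).obj E)) :
    Prop where
  isSub : N.IsSub d
  existsUnique : ∀ {T : Scheme.{0}} (f : T ⟶ X) (S : SubMod ((Scheme.Modules.pullback f).obj E)),
    S.IsSub d → ∃! g : T ⟶ G, ∃ h : g ≫ π = f, N.bc (bcm g h E) = S

instance (K : GrassmannBundle E d) : Mono K.incl := K.isSubbundle.mono

/-- The tautological subsheaf of a Grassmann bundle. -/
def GrassmannBundle.sub (K : GrassmannBundle E d) :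
    SubMod ((Scheme.Modules.pullback K.proj).obj E) := imageSub K.incl

lemma GrassmannBundle.isSub (K : GrassmannBundle E d) : K.sub.IsSub d :=
  ((isSubbundle_iff _ _).1 K.isSubbundle).2

lemma GrassmannBundle.isUniversalSub (K : GrassmannBundle E d) : IsUniversalSub K.proj d K.sub where
  isSub := K.isSub
  existsUnique {T} f S hS := by
    have h1 : IsSubbundle S.incl d := by
      rw [isSubbundle_iff]
      exact ⟨inferInstance, by rwa [imageSub_incl]⟩
    have := K.existsUnique f S.incl h1
    simp only [classifies_iff K.isSub, imageSub_incl] at this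
    exact this

/-- A universal subsheaf gives a Grassmann bundle. -/
def IsUniversalSub.grassmannBundle {N : SubMod ((Scheme.Modules.pullback π).obj E)}
    (hN : IsUniversalSub π d N) : GrassmannBundle E d where
  total := G
  proj := π
  taut := N.toModules
  incl := N.incl
  isSubbundle := by
    rw [isSubbundle_iff]
    exact ⟨inferInstance, by rw [imageSub_incl]; exact hN.isSub⟩
  existsUnique {T} f F i hi := by
    obtain ⟨_, h2⟩ := (isSubbundle_iff _ _).1 hi
    have := hN.existsUnique f (imageSub i) h2
    simp only [classifies_iff (a := N.incl) (by rw [imageSub_incl]; exact hN.isSub), imageSub_incl]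
    exact this

end Classifying

/-! ### The functor of subbundles is a Zariski sheaf -/

section Families

variable {X T T' T'' : Scheme.{0}} {f f' : T ⟶ X} {E : X.Modules} {d : ℕ}

lemma bcm_congr {G : Scheme.{0}} {π : G ⟶ X} {g g' : T ⟶ G} (hg : g = g') (h : g ≫ π = f)
    (h' : g' ≫ π = f) {U : G.Opens} (s : Γ((Scheme.Modules.pullback π).obj E, U)) :
    cm (bcm g h E) U s = mres (by rw [hg]) (cm (bcm g' h' E) U s) := by
  subst hg; exact (mres_self _).symm

lemma bcm_bijective {G : Scheme.{0}} {π : G ⟶ X} (g : T ⟶ G) [IsOpenImmersion g] (h : g ≫ π = f)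
    {U : G.Opens} (hU : U ≤ g.opensRange) : Function.Bijective (cm (bcm g h E) U) :=
  (ConcreteCategory.bijective_of_isIso
    (((Scheme.Modules.pullbackComp g π).app E ≪≫
      (Scheme.Modules.pullbackCongr h).app E).hom.app (g ⁻¹ᵁ U))).comp (pullUnit_bijective _ hU)

/-- Subsheaves that agree on the members of an open cover are equal. -/
lemma SubMod.eq_of_cover (𝒰 : T.OpenCover) {S S' : SubMod ((Scheme.Modules.pullback f).obj E)}
    (hS : S.IsSub d) (hS' : S'.IsSub d)
    (h : ∀ j, S.bc (bcm (𝒰.f j) rfl E) = S'.bc (bcm (𝒰.f j) rfl E)) : S = S' := by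
  have main : ∀ {S S' : SubMod ((Scheme.Modules.pullback f).obj E)} (_ : S'.IsSub d)
      (_ : ∀ j, S.bc (bcm (𝒰.f j) rfl E) = S'.bc (bcm (𝒰.f j) rfl E)) (U : T.Opens) s,
      s ∈ S.carrier U → s ∈ S'.carrier U := by
    intro S S' hS' h U s hs
    refine S'.local_mem fun x hx => ?_
    obtain ⟨j, y, rfl⟩ := 𝒰.exists_eq x
    refine ⟨U ⊓ (𝒰.f j).opensRange, inf_le_left, ⟨hx, ⟨y, rfl⟩⟩, ?_⟩
    rw [← hS'.cm_mem_iff (isBC_bcm (𝒰.f j) rfl E) inf_le_right, ← h j]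
    exact S.cm_mem_bc _ (S.res_mem inf_le_left hs)
  ext U s
  exact ⟨main hS' h U s, main hS (fun j => (h j).symm) U s⟩

variable (E d T) in
/-- A morphism `f : T ⟶ X` together with a subbundle of rank `d` of `f^* E`. -/
structure Fam where
  f : T ⟶ X
  N : SubMod ((Scheme.Modules.pullback f).obj E)
  isSub : N.IsSub d

/-- Pullback of families of subbundles. -/
def Fam.map (s : Fam T E d) (g : T' ⟶ T) : Fam T' E d where
  f := g ≫ s.f
  N := s.N.bc (bcm g rfl E)
  isSub := s.isSub.bc (isBC_bcm g rfl E)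

lemma Fam.map_eq_iff (s : Fam T E d) (g : T' ⟶ T) (t : Fam T' E d) :
    s.map g = t ↔ ∃ h : g ≫ s.f = t.f, s.N.bc (bcm g h E) = t.N := by
  obtain ⟨f, N, hN⟩ := t
  constructor
  · intro h
    obtain ⟨rfl, h⟩ := Fam.mk.inj h
    exact ⟨rfl, eq_of_heq h⟩
  · rintro ⟨h1, h2⟩
    dsimp only at h1 h2
    subst h1 h2
    rfl

lemma Fam.map_id (s : Fam T E d) : s.map (𝟙 T) = s :=
  (s.map_eq_iff _ _).2 ⟨Category.id_comp _, SubMod.bc_bcm_id s.isSub _⟩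

lemma Fam.map_comp (s : Fam T E d) (g : T' ⟶ T) (g' : T'' ⟶ T') :
    s.map (g' ≫ g) = (s.map g).map g' :=
  (s.map_eq_iff _ _).2 ⟨Category.assoc _ _ _, SubMod.bc_bcm_comp s.isSub g rfl g' rfl _⟩

variable (E d) in
/-- The functor represented by a Grassmann bundle. -/
def famFunctor : Scheme.{0}ᵒᵖ ⥤ Type where
  obj T := Fam T.unop E d
  map g := ↾ fun s => s.map g.unop
  map_id T := by ext s; exact s.map_id
  map_comp g h := by ext s; exact s.map_comp g.unop h.unop

lemma Fam.ext_of_cover (𝒰 : T.OpenCover) {s t : Fam T E d}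
    (h : ∀ j, s.map (𝒰.f j) = t.map (𝒰.f j)) : s = t := by
  have h1 : s.f = t.f := 𝒰.hom_ext _ _ fun j => congrArg Fam.f (h j)
  obtain ⟨f, S, hS⟩ := s
  obtain ⟨f', S', hS'⟩ := t
  dsimp only at h1
  subst h1
  have : S = S' := SubMod.eq_of_cover 𝒰 hS hS' fun j => by
    obtain ⟨_, h2⟩ := Fam.mk.inj (h j)
    exact eq_of_heq h2
  subst this
  rfl

section Glue

variable {𝒰 : T.OpenCover} (x : ∀ j, Fam (𝒰.X j) E d)

/-- The subsheaf obtained by gluing subsheaves given on the members of an open cover. -/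
def glueSub (h : ∀ j, 𝒰.f j ≫ f = (x j).f) : SubMod ((Scheme.Modules.pullback f).obj E) where
  carrier U :=
    { carrier := { s | ∀ j, cm (bcm (𝒰.f j) (h j) E) U s ∈ (x j).N.carrier (𝒰.f j ⁻¹ᵁ U) }
      zero_mem' := fun j => by rw [map_zero]; exact zero_mem _
      add_mem' := fun ha hb j => by rw [map_add]; exact add_mem (ha j) (hb j)
      smul_mem' := fun c a ha j => by rw [cm_smul]; exact Submodule.smul_mem _ _ (ha j) }
  res_mem := fun hV s hs j => by rw [cm_mres]; exact (x j).N.res_mem _ (hs j)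
  local_mem := fun {U s} hs j => (x j).N.local_mem fun y hy => by
    obtain ⟨V, hV, hyV, m⟩ := hs _ hy
    exact ⟨𝒰.f j ⁻¹ᵁ V, Scheme.Hom.preimage_mono _ hV, hyV, by rw [← cm_mres]; exact m j⟩

/-- Over the image of a member of the cover, the glued subsheaf is the given one: the conditions at
the other members follow from the compatibility on overlaps. -/
lemma mem_glueSub_iff (h : ∀ j, 𝒰.f j ≫ f = (x j).f)
    (hx : ∀ i j, (x i).map (pullback.fst (𝒰.f i) (𝒰.f j)) =
      (x j).map (pullback.snd (𝒰.f i) (𝒰.f j)))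
    (j : 𝒰.I₀) {U : T.Opens} (hU : U ≤ (𝒰.f j).opensRange) (s) :
    s ∈ (glueSub x h).carrier U ↔
      cm (bcm (𝒰.f j) (h j) E) U s ∈ (x j).N.carrier (𝒰.f j ⁻¹ᵁ U) := by
  refine ⟨fun hs => hs j, fun hs k => ?_⟩
  obtain ⟨h1, h2⟩ : ∃ h : pullback.fst (𝒰.f j) (𝒰.f k) ≫ (x j).f =
      pullback.snd (𝒰.f j) (𝒰.f k) ≫ (x k).f,
      (x j).N.bc (bcm (pullback.fst (𝒰.f j) (𝒰.f k)) h E) =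
        (x k).N.bc (bcm (pullback.snd (𝒰.f j) (𝒰.f k)) rfl E) :=
    ((x j).map_eq_iff _ _).1 (hx j k)
  have hr : 𝒰.f k ⁻¹ᵁ U ≤ (pullback.snd (𝒰.f j) (𝒰.f k)).opensRange := by
    intro y hy
    obtain ⟨z, hz⟩ := hU hy
    obtain ⟨w, -, hw⟩ := Scheme.Pullback.exists_preimage_pullback z y hz
    exact ⟨w, hw⟩
  have h3 := (x j).N.cm_mem_bc (bcm (pullback.fst (𝒰.f j) (𝒰.f k)) h1 E) hs
  rw [h2] at h3
  rw [← (x k).isSub.cm_mem_iff (isBC_bcm (pullback.snd (𝒰.f j) (𝒰.f k)) rfl E) hr]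
  have hc : pullback.snd (𝒰.f j) (𝒰.f k) ≫ (x k).f = pullback.snd (𝒰.f j) (𝒰.f k) ≫ (x k).f := rfl
  have e1 := bcm_comp (𝒰.f j) (h j) (pullback.fst (𝒰.f j) (𝒰.f k)) h1
    (by rw [Category.assoc, h j, h1]) s
  have e2 := bcm_comp (𝒰.f k) (h k) (pullback.snd (𝒰.f j) (𝒰.f k)) hc
    (by rw [Category.assoc, h k]) s
  have e3 := bcm_congr (pullback.condition (f := 𝒰.f j) (g := 𝒰.f k)).symm
    (by rw [Category.assoc, h k]) (by rw [Category.assoc, h j, h1]) s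
  rw [← e2, e3, e1]
  exact SubMod.res_mem _ _ h3

lemma exists_frame_glueSub (h : ∀ j, 𝒰.f j ≫ f = (x j).f)
    (hx : ∀ i j, (x i).map (pullback.fst (𝒰.f i) (𝒰.f j)) =
      (x j).map (pullback.snd (𝒰.f i) (𝒰.f j))) (j : 𝒰.I₀) (y : 𝒰.X j) :
    ∃ (V : T.Opens) (r : ℕ) (e : Fin d ⊕ Fin r → _), 𝒰.f j y ∈ V ∧ (glueSub x h).IsAdapted e ∧
      (x j).N.IsAdapted (V := 𝒰.f j ⁻¹ᵁ V) (fun i => cm (bcm (𝒰.f j) (h j) E) V (e i)) := by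
  obtain ⟨V, r, e, hV, he⟩ := (x j).isSub y
  have hr : 𝒰.f j ''ᵁ V ≤ (𝒰.f j).opensRange := Scheme.Hom.image_le_opensRange _ _
  have hp : 𝒰.f j ⁻¹ᵁ (𝒰.f j ''ᵁ V) ≤ V := by rw [Scheme.Hom.preimage_image_eq]
  have hbij : ∀ U ≤ (𝒰.f j).opensRange, Function.Bijective (cm (bcm (𝒰.f j) (h j) E) U) :=
    fun U hU => bcm_bijective (𝒰.f j) (h j) hU
  choose e' he' using fun i => (hbij _ hr).2 (mres hp (e i))
  have hF : IsFrame e' := by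
    rw [← isFrame_cm_iff hbij hr]
    simp only [he']
    exact he.isFrame.mres hp
  refine ⟨𝒰.f j ''ᵁ V, r, e', ⟨y, hV, rfl⟩, ⟨hF, fun W hW a => ?_⟩, ?_⟩
  · rw [mem_glueSub_iff x h hx j (hW.trans hr), cm_lc]
    simp only [he']
    refine ((he.mres hp).mem_iff _ (Scheme.Hom.preimage_mono _ hW) _).trans ?_
    refine forall_congr' fun k => ?_
    exact map_eq_zero_iff _ (fres_bijective (hW.trans hr)).1
  · simp only [he']
    exact he.mres hp

end Glue

/-- Subbundles glue, so that the functor represented by a Grassmann bundle is a Zariski sheaf. -/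
lemma isSheaf_famFunctor : Presieve.IsSheaf Scheme.zariskiTopology (famFunctor E d) := by
  rw [Precoverage.isSheaf_toGrothendieck_iff_of_isStableUnderBaseChange]
  rintro T S hS x hx
  obtain ⟨(𝒰 : T.OpenCover), rfl⟩ := Scheme.exists_cover_of_mem_pretopology hS
  let y : ∀ j, Fam (𝒰.X j) E d := fun j => x (𝒰.f j) (.mk j)
  have hy : ∀ i j, (y i).map (pullback.fst (𝒰.f i) (𝒰.f j)) =
      (y j).map (pullback.snd (𝒰.f i) (𝒰.f j)) := fun i j => hx _ _ _ _ pullback.condition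
  let f : T ⟶ X := 𝒰.glueMorphisms (fun j => (y j).f) fun i j => congrArg Fam.f (hy i j)
  have hf : ∀ j, 𝒰.f j ≫ f = (y j).f := fun j => 𝒰.ι_glueMorphisms _ _ j
  let t : Fam T E d := ⟨f, glueSub y hf, fun z => by
    obtain ⟨j, w, rfl⟩ := 𝒰.exists_eq z
    obtain ⟨V, r, e, hV, he, -⟩ := exists_frame_glueSub y hf hy j w
    exact ⟨V, r, e, hV, he⟩⟩
  refine ⟨t, ?_, fun t' ht' => ?_⟩
  · rintro Z e ⟨j⟩
    refine (t.map_eq_iff _ _).2 ⟨hf j, SubMod.eq_of_adapted fun w => ?_⟩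
    obtain ⟨V, r, e, hV, he, he'⟩ := exists_frame_glueSub y hf hy j w
    exact ⟨𝒰.f j ⁻¹ᵁ V, _, _, inferInstance, inferInstance, _, hV,
      he.bc (isBC_bcm (𝒰.f j) (hf j) E), he'⟩
  · refine Fam.ext_of_cover 𝒰 fun j => ?_
    refine (ht' (𝒰.f j) (.mk j)).trans (Eq.symm ?_)
    refine (t.map_eq_iff _ _).2 ⟨hf j, SubMod.eq_of_adapted fun w => ?_⟩
    obtain ⟨V, r, e, hV, he, he'⟩ := exists_frame_glueSub y hf hy j w
    exact ⟨𝒰.f j ⁻¹ᵁ V, _, _, inferInstance, inferInstance, _, hV,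
      he.bc (isBC_bcm (𝒰.f j) (hf j) E), he'⟩

end Families

/-! ### Graphs with respect to a frame -/

section Triangular

variable {X Y : Scheme.{0}} {g : Y ⟶ X} {M : X.Modules} {M' : Y.Modules} {U V W : X.Opens}
  {ι κ κ' : Type} [Fintype ι] [Fintype κ] [Fintype κ']

/-- The frame obtained from `e` by adding to the members of its first part a linear combination of
the members of its second part. -/
def tri (e : ι ⊕ κ → Γ(M, V)) (t : ι → κ → Γ(X, V)) : ι ⊕ κ → Γ(M, V) :=
  Sum.elim (fun i => e (Sum.inl i) + ∑ k, t i k • e (Sum.inr k)) fun k => e (Sum.inr k)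

lemma lc_sumElim_single [DecidableEq ι] (e : ι ⊕ κ → Γ(M, V)) (h : W ≤ V) (i : ι)
    (c : κ → Γ(X, W)) : lc e h (Sum.elim (Pi.single i 1) c) =
      mres h (e (Sum.inl i)) + ∑ k, c k • mres h (e (Sum.inr k)) := by
  rw [lc_sumElim, Sum.elim_comp_inl, lc_single, one_smul]
  rfl

lemma lc_tri (e : ι ⊕ κ → Γ(M, V)) (t : ι → κ → Γ(X, V)) (h : W ≤ V) (a : ι ⊕ κ → Γ(X, W)) :
    lc (tri e t) h a = lc e h (Sum.elim (a ∘ Sum.inl)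
      fun k => a (Sum.inr k) + ∑ i, a (Sum.inl i) * rres h (t i k)) := by
  simp only [lc, tri, Fintype.sum_sum_type, Sum.elim_inl, Sum.elim_inr, map_add, map_sum,
    mres_smul, smul_add, Finset.smul_sum, smul_smul, Finset.sum_add_distrib, add_smul,
    Finset.sum_smul, Function.comp]
  rw [Finset.sum_comm (γ := ι)]
  abel

lemma IsFrame.tri {e : ι ⊕ κ → Γ(M, V)} (he : IsFrame e) (t : ι → κ → Γ(X, V)) :
    IsFrame (tri e t) := by
  intro W h
  have : lc (HiggsGrass.tri e t) h = lc e h ∘ fun a => Sum.elim (a ∘ Sum.inl)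
      fun k => a (Sum.inr k) + ∑ i, a (Sum.inl i) * rres h (t i k) := by
    funext a; exact lc_tri e t h a
  rw [this]
  refine (he W h).comp (Function.bijective_iff_has_inverse.2
    ⟨fun a => Sum.elim (a ∘ Sum.inl) fun k => a (Sum.inr k) - ∑ i, a (Sum.inl i) * rres h (t i k),
      fun a => ?_, fun a => ?_⟩) <;>
  · funext j
    rcases j with j | j <;> simp

lemma mres_tri {ι : Type} (h : W ≤ V) (e : ι ⊕ κ → Γ(M, V)) (t : ι → κ → Γ(X, V)) :
    (fun i => mres h (tri e t i)) =
      tri (fun i => mres h (e i)) (fun i k => rres h (t i k)) := by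
  funext j
  rcases j with j | j <;> simp [tri, mres_smul]

lemma cm_tri {ι : Type} (α : M ⟶ (Scheme.Modules.pushforward g).obj M') (e : ι ⊕ κ → Γ(M, V))
    (t : ι → κ → Γ(X, V)) : (fun i => cm α V (tri e t i)) =
      tri (fun i => cm α V (e i)) (fun i k => fres g V (t i k)) := by
  funext j
  rcases j with j | j <;> simp [tri, cm_smul]

/-- A subsheaf is the graph of at most one matrix. -/
lemma SubMod.IsAdapted.tri_unique {S : SubMod M} {e : ι ⊕ κ → Γ(M, V)} {t t' : ι → κ → Γ(X, V)}
    (h : S.IsAdapted (tri e t)) (h' : S.IsAdapted (tri e t')) : t = t' := by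
  classical
  funext i k
  have h1 := h'.inl_mem i
  have h2 : tri e t' (Sum.inl i) =
      lc (tri e t) le_rfl (Sum.elim (Pi.single i 1) fun k => t' i k - t i k) := by
    simp only [lc, tri, Fintype.sum_sum_type, Sum.elim_inl, Sum.elim_inr, mres_self, sub_smul,
      Finset.sum_sub_distrib]
    rw [Finset.sum_eq_single i (fun j _ hj => by rw [Pi.single_eq_of_ne hj, zero_smul])
      (fun h => absurd (Finset.mem_univ _) h)]
    simp
  rw [h2] at h1
  have := (h.mem_iff _ _ _).1 h1 k
  exact (sub_eq_zero.1 this).symm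

/-- Being adapted can be checked locally. -/
lemma SubMod.isAdapted_of_locally {S : SubMod M} {e : ι ⊕ κ → Γ(M, V)} (he : IsFrame e)
    (h : ∀ x ∈ V, ∃ (W : X.Opens) (hW : W ≤ V), x ∈ W ∧ S.IsAdapted (fun i => mres hW (e i))) :
    S.IsAdapted e where
  isFrame := he
  mem_iff W hW a := by
    constructor
    · intro hs k
      refine eq_of_locally_ring fun x hx => ?_
      obtain ⟨W', hW', hxW', hA⟩ := h x (hW hx)
      refine ⟨W ⊓ W', inf_le_left, ⟨hx, hxW'⟩, ?_⟩
      have h1 := S.res_mem (inf_le_left : W ⊓ W' ≤ W) hs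
      rw [mres_lc, ← lc_mres e hW' inf_le_right] at h1
      exact ((hA.mem_iff _ _ _).1 h1 k).trans (map_zero _).symm
    · intro h0
      refine S.local_mem fun x hx => ?_
      obtain ⟨W', hW', hxW', hA⟩ := h x (hW hx)
      refine ⟨W ⊓ W', inf_le_left, ⟨hx, hxW'⟩, ?_⟩
      rw [mres_lc, ← lc_mres e hW' inf_le_right, hA.mem_iff]
      intro k
      rw [h0 k, map_zero]

/-- The largest open set over which the subsheaf `S` is a graph with respect to the frame `e`: it
has a basis of the form `e i + ∑ k, t i k • e k`. -/
def chartOpen (S : SubMod M) (e : ι ⊕ κ → Γ(M, V)) : X.Opens :=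
  sSup { W | ∃ (h : W ≤ V) (t : ι → κ → Γ(X, W)), S.IsAdapted (tri (fun i => mres h (e i)) t) }

lemma mem_chartOpen {S : SubMod M} {e : ι ⊕ κ → Γ(M, V)} {x : X} : x ∈ chartOpen S e ↔
    ∃ (W : X.Opens) (h : W ≤ V) (t : ι → κ → Γ(X, W)), x ∈ W ∧
      S.IsAdapted (tri (fun i => mres h (e i)) t) := by
  rw [chartOpen, TopologicalSpace.Opens.mem_sSup]
  constructor
  · rintro ⟨W, ⟨h, t, ht⟩, hx⟩; exact ⟨W, h, t, hx, ht⟩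
  · rintro ⟨W, h, t, hx, ht⟩; exact ⟨W, ⟨h, t, ht⟩, hx⟩

lemma chartOpen_le (S : SubMod M) (e : ι ⊕ κ → Γ(M, V)) : chartOpen S e ≤ V := by
  intro x hx
  obtain ⟨W, h, t, hx, -⟩ := mem_chartOpen.1 hx
  exact h hx

/-- By uniqueness, the matrices of which `S` is locally the graph glue. -/
lemma exists_isAdapted_chartOpen (S : SubMod M) {e : ι ⊕ κ → Γ(M, V)} (he : IsFrame e) :
    ∃ t : ι → κ → Γ(X, chartOpen S e),
      S.IsAdapted (tri (fun i => mres (chartOpen_le S e) (e i)) t) := by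
  let P : ι → κ → ∀ W : X.Opens, Γ(X, W) → Prop := fun i k W c =>
    ∃ (h : W ≤ V) (t : ι → κ → Γ(X, W)), S.IsAdapted (tri (fun i => mres h (e i)) t) ∧ t i k = c
  have hres : ∀ {W W' : X.Opens} (h : W ≤ V) (h' : W' ≤ W) {t : ι → κ → Γ(X, W)},
      S.IsAdapted (tri (fun i => mres h (e i)) t) →
      S.IsAdapted (tri (fun i => mres (h'.trans h) (e i)) fun i k => rres h' (t i k)) := by
    intro W W' h h' t ht
    have := ht.mres h'
    rw [mres_tri] at this
    simpa only [mres_mres] using this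
  have key : ∀ i k, ∃ c : Γ(X, chartOpen S e), ∀ (W : X.Opens) (h : W ≤ chartOpen S e)
      (t : Γ(X, W)), P i k W t → rres h c = t := by
    intro i k
    refine exists_glue_ring (P i k) ?_ ?_ ?_
    · rintro W W' h' _ ⟨h, t, ht, rfl⟩
      exact ⟨h'.trans h, _, hres h h' ht, rfl⟩
    · rintro W - _ _ ⟨h, t, ht, rfl⟩ ⟨h', t', ht', rfl⟩
      rw [ht.tri_unique ht']
    · intro x hx
      obtain ⟨W, h, t, hxW, ht⟩ := mem_chartOpen.1 hx
      exact ⟨W, le_sSup ⟨h, t, ht⟩, hxW, t i k, h, t, ht, rfl⟩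
  choose c hc using key
  refine ⟨c, SubMod.isAdapted_of_locally ((he.mres _).tri _) fun x hx => ?_⟩
  obtain ⟨W, h, t, hxW, ht⟩ := mem_chartOpen.1 hx
  have hle : W ≤ chartOpen S e := le_sSup ⟨h, t, ht⟩
  refine ⟨W, hle, hxW, ?_⟩
  rw [mres_tri]
  have : (fun i k => rres hle (c i k)) = t := by
    funext i k; exact hc i k W hle _ ⟨h, t, ht, rfl⟩
  rw [this]
  simpa only [mres_mres] using ht

lemma lc_coord_matrix {e : ι ⊕ κ → Γ(M, V)} (he : IsFrame e) (h : W ≤ V) (n : ι ⊕ κ' → Γ(M, W))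
    (h' : U ≤ W) (b : ι ⊕ κ' → Γ(X, U)) (hb : ∀ k, b (Sum.inr k) = 0) :
    lc e (h'.trans h) (fun l => ∑ j, b (Sum.inl j) * rres h' (he.coord h (n (Sum.inl j)) l)) =
      lc n h' b := by
  have h1 : ∀ j, mres h' (n (Sum.inl j)) = lc e (h'.trans h)
      (fun l => rres h' (he.coord h (n (Sum.inl j)) l)) := by
    intro j
    conv_lhs => rw [← he.lc_coord h (n (Sum.inl j))]
    rw [mres_lc]
  rw [lc.eq_def n, Fintype.sum_sum_type]
  simp only [hb, zero_smul, Finset.sum_const_zero, add_zero, h1, ← lc_smul, ← lc_sum]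
  congr 1
  funext l
  simp

variable [DecidableEq ι]

/-- The coordinates, with respect to the first part of `e`, of the first part of `n`. -/
def minor {e : ι ⊕ κ → Γ(M, V)} (he : IsFrame e) (h : W ≤ V) (n : ι ⊕ κ' → Γ(M, W)) :
    Matrix ι ι Γ(X, W) :=
  Matrix.of fun i j => he.coord h (n (Sum.inl i)) (Sum.inl j)

/-- A subsheaf is a graph with respect to `e` exactly where the minor of an adapted frame `n` that
is formed by the first part of `e` is invertible. -/
lemma mem_chartOpen_iff {S : SubMod M} {e : ι ⊕ κ → Γ(M, V)} (he : IsFrame e) (h : W ≤ V)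
    {n : ι ⊕ κ' → Γ(M, W)} (hn : S.IsAdapted n) {x : X} (hx : x ∈ W) :
    x ∈ chartOpen S e ↔ x ∈ X.basicOpen (minor he h n).det := by
  constructor
  · intro hx'
    obtain ⟨W', h', t, hxW', ht⟩ := mem_chartOpen.1 hx'
    have hm : ∀ i, mres (inf_le_right : W ⊓ W' ≤ W') (tri (fun i => mres h' (e i)) t (Sum.inl i)) ∈
        S.carrier (W ⊓ W') := fun i => S.res_mem _ (ht.inl_mem i)
    let b : ι → ι ⊕ κ' → Γ(X, W ⊓ W') := fun i => hn.isFrame.coord inf_le_left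
      (mres inf_le_right (tri (fun i => mres h' (e i)) t (Sum.inl i)))
    have hb : ∀ i, lc n inf_le_left (b i) =
        mres inf_le_right (tri (fun i => mres h' (e i)) t (Sum.inl i)) :=
      fun i => hn.isFrame.lc_coord _ _
    have hb0 : ∀ i k, b i (Sum.inr k) = 0 := fun i => (hn.mem_iff_coord _ _).1 (hm i)
    -- the coordinates `b` of the triangular basis in `n` invert the minor from the left
    have h1 : (Matrix.of fun i j => b i (Sum.inl j)) *
        (minor he h n).map (rres (inf_le_left : W ⊓ W' ≤ W)) = 1 := by
      have hV : W ⊓ W' ≤ V := inf_le_left.trans h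
      have hleft : ∀ i, he.coord hV (lc n inf_le_left (b i)) =
          ∑ j, b i (Sum.inl j) • he.coord hV (mres inf_le_left (n (Sum.inl j))) := by
        intro i
        apply (he _ hV).1
        rw [he.lc_coord, lc_sum]
        simp only [lc_smul, he.lc_coord]
        rw [lc, Fintype.sum_sum_type]
        simp only [hb0, zero_smul, Finset.sum_const_zero, add_zero]
      have hright : ∀ i, he.coord hV (lc n inf_le_left (b i)) =
          Sum.elim (Pi.single i 1) fun k => rres inf_le_right (t i k) := by
        intro i
        apply (he _ hV).1
        rw [he.lc_coord, hb, lc_sumElim_single]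
        simp only [tri, Sum.elim_inl, map_add, map_sum, mres_smul, mres_mres]
      ext i j
      have h2 := congrFun ((hleft i).symm.trans (hright i)) (Sum.inl j)
      simp only [Finset.sum_apply, Pi.smul_apply, smul_eq_mul, Sum.elim_inl] at h2
      rw [Matrix.mul_apply, Matrix.one_apply]
      simp only [Matrix.of_apply, Matrix.map_apply, minor]
      refine Eq.trans (Finset.sum_congr rfl fun l _ => ?_) (h2.trans ?_)
      · rw [he.coord_mres h (inf_le_left : W ⊓ W' ≤ W)]
      · rw [Pi.single_apply]; simp only [eq_comm]
    have h2 : IsUnit (rres (inf_le_left : W ⊓ W' ≤ W) (minor he h n).det) := by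
      rw [RingHom.map_det]
      exact IsUnit.of_mul_eq_one _ ((mul_comm _ _).trans
        ((Matrix.det_mul _ _).symm.trans ((congrArg _ h1).trans Matrix.det_one)))
    have h3 : W ⊓ W' ≤ X.basicOpen (minor he h n).det := by
      have h4 := X.basicOpen_res (minor he h n).det (homOfLE (inf_le_left : W ⊓ W' ≤ W)).op
      have h5 := X.basicOpen_of_isUnit h2
      intro y hy
      rw [← h5] at hy
      exact (h4.le hy).2
    exact h3 ⟨hx, hxW'⟩
  · intro hx'
    set D := (minor he h n).det
    let W' := X.basicOpen D
    have hW' : W' ≤ W := X.basicOpen_le D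
    have hD : IsUnit (rres hW' D) := X.toRingedSpace.isUnit_res_basicOpen D
    let A : Matrix ι ι Γ(X, W') := (minor he h n).map (rres hW')
    have hA : IsUnit A.det := by
      have : A.det = rres hW' D := (RingHom.map_det (rres hW') (minor he h n)).symm
      rw [this]; exact hD
    have hAA : A⁻¹ * A = 1 := Matrix.nonsing_inv_mul A hA
    have hAA' : A * A⁻¹ = 1 := Matrix.mul_nonsing_inv A hA
    have hV : W' ≤ V := hW'.trans h
    let t : ι → κ → Γ(X, W') := fun i k =>
      ∑ j, A⁻¹ i j * rres hW' (he.coord h (n (Sum.inl j)) (Sum.inr k))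
    -- the rows of the inverse of the minor express the triangular basis through `n`
    have htri : ∀ i, tri (fun i => mres hV (e i)) t (Sum.inl i) =
        ∑ j, A⁻¹ i j • mres hW' (n (Sum.inl j)) := by
      intro i
      have hcoord : ∀ j, mres hW' (n (Sum.inl j)) = lc e hV
          (fun l => rres hW' (he.coord h (n (Sum.inl j)) l)) := by
        intro j
        conv_lhs => rw [← he.lc_coord h (n (Sum.inl j))]
        rw [mres_lc]
      simp only [hcoord, ← lc_smul, ← lc_sum]
      have : (∑ j, A⁻¹ i j • fun l => rres hW' (he.coord h (n (Sum.inl j)) l)) =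
          Sum.elim (Pi.single i 1) (t i) := by
        funext l
        rcases l with l | k
        · have := congrFun (congrFun hAA i) l
          rw [Matrix.mul_apply, Matrix.one_apply] at this
          simp only [Finset.sum_apply, Pi.smul_apply, smul_eq_mul, Sum.elim_inl]
          refine Eq.trans ?_ (this.trans ?_)
          · rfl
          · rw [Pi.single_apply]; simp only [eq_comm]
        · simp only [Finset.sum_apply, Pi.smul_apply, smul_eq_mul, Sum.elim_inr, t]
      rw [this, lc_sumElim_single]
      rfl
    have hmem : ∀ (W'' : X.Opens) (h'' : W'' ≤ W') i,
        mres h'' (tri (fun i => mres hV (e i)) t (Sum.inl i)) ∈ S.carrier W'' := by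
      intro W'' h'' i
      refine S.res_mem _ ?_
      rw [htri]
      exact sum_mem fun j _ => Submodule.smul_mem _ _ (S.res_mem _ (hn.inl_mem j))
    refine mem_chartOpen.2 ⟨W', hV, t, hx', ((he.mres _).tri _), fun W'' h'' a => ?_⟩
    have hF := (he.mres hV).tri t
    constructor
    · intro hs
      -- subtracting the first part leaves an element of `S` without first coordinates
      have h1 : lc (tri (fun i => mres hV (e i)) t) h'' (Sum.elim 0 (a ∘ Sum.inr)) ∈
          S.carrier W'' := by
        have : lc (tri (fun i => mres hV (e i)) t) h'' (Sum.elim 0 (a ∘ Sum.inr)) =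
            lc (tri (fun i => mres hV (e i)) t) h'' a -
              ∑ i, a (Sum.inl i) • mres h'' (tri (fun i => mres hV (e i)) t (Sum.inl i)) := by
          simp only [lc, Fintype.sum_sum_type, Sum.elim_inl, Sum.elim_inr, Pi.zero_apply, zero_smul,
            Finset.sum_const_zero, zero_add, Function.comp, add_sub_cancel_left]
        rw [this]
        exact sub_mem hs (sum_mem fun i _ => Submodule.smul_mem _ _ (hmem _ _ _))
      have h2 := (hn.mem_iff_coord (h''.trans hW') _).1 h1
      set b := hn.isFrame.coord (h''.trans hW')
        (lc (tri (fun i => mres hV (e i)) t) h'' (Sum.elim 0 (a ∘ Sum.inr))) with hb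
      have h3 : lc n (h''.trans hW') b =
          lc (tri (fun i => mres hV (e i)) t) h'' (Sum.elim 0 (a ∘ Sum.inr)) :=
        hn.isFrame.lc_coord _ _
      have h4 : lc n (h''.trans hW') b = lc e (h''.trans hV)
          (fun l => ∑ j, b (Sum.inl j) * rres (h''.trans hW') (he.coord h (n (Sum.inl j)) l)) := by
        exact (lc_coord_matrix he h n (h''.trans hW') b h2).symm
      have h5 : lc (tri (fun i => mres hV (e i)) t) h'' (Sum.elim 0 (a ∘ Sum.inr)) =
          lc e (h''.trans hV) (Sum.elim 0 (a ∘ Sum.inr)) := by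
        simp [lc, tri, mres_mres]
      have h6 := (he _ _).1 (h4.symm.trans (h3.trans h5))
      have h7 : Matrix.vecMul (fun j => b (Sum.inl j)) (A.map (rres h'')) = 0 := by
        funext l
        have := congrFun h6 (Sum.inl l)
        simp only [Sum.elim_inl, Pi.zero_apply] at this
        simp only [Matrix.vecMul, dotProduct, Matrix.map_apply, A, minor, Matrix.of_apply,
          rres_rres, Pi.zero_apply]
        exact this
      have h8 : (fun j => b (Sum.inl j)) = 0 := by
        have h9 : A.map (rres h'') * (A⁻¹).map (rres h'') = 1 := by
          rw [← Matrix.map_mul, hAA']; simp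
        have := congrArg (fun v => Matrix.vecMul v ((A⁻¹).map (rres h''))) h7
        simpa only [Matrix.vecMul_vecMul, h9, Matrix.vecMul_one, Matrix.zero_vecMul] using this
      intro k
      have := congrFun h6 (Sum.inr k)
      simp only [Sum.elim_inr, Function.comp] at this
      rw [← this]
      exact Finset.sum_eq_zero fun j _ => by rw [show b (Sum.inl j) = 0 from congrFun h8 j, zero_mul]
    · intro h0
      rw [lc, Fintype.sum_sum_type]
      simp only [h0, zero_smul, Finset.sum_const_zero, add_zero]
      exact sum_mem fun i _ => Submodule.smul_mem _ _ (hmem _ _ _)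

end Triangular

/-! ### Subbundles are locally graphs -/

section Charts

variable {X Y : Scheme.{0}} {g : Y ⟶ X} {M : X.Modules} {M' : Y.Modules} {U V W : X.Opens}
  {ι κ κ' : Type} [Fintype ι] [Fintype κ] [Fintype κ']

/-- The open set over which a subbundle is a graph commutes with base change. -/
lemma mem_chartOpen_bc_iff {d : ℕ} {S : SubMod M} (hS : S.IsSub d)
    {α : M ⟶ (Scheme.Modules.pushforward g).obj M'} (hα : IsBC α) {e : Fin d ⊕ κ → Γ(M, V)}
    (he : IsFrame e) (y : Y) :
    y ∈ chartOpen (S.bc α) (fun i => cm α V (e i)) ↔ g y ∈ chartOpen S e := by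
  have hα' := hα V _ e he
  by_cases hV : g y ∈ V
  · obtain ⟨W, r, n, hW, hn⟩ := hS (g y)
    have hn1 := hn.mres (inf_le_left : W ⊓ V ≤ W)
    rw [mem_chartOpen_iff he inf_le_right hn1 ⟨hW, hV⟩,
      mem_chartOpen_iff hα' (Scheme.Hom.preimage_mono g (inf_le_right : W ⊓ V ≤ V)) (hn1.bc hα)
        (show y ∈ g ⁻¹ᵁ (W ⊓ V) from ⟨hW, hV⟩)]
    have h1 : (minor hα' (Scheme.Hom.preimage_mono g (inf_le_right : W ⊓ V ≤ V))
        (fun i => cm α (W ⊓ V) (mres inf_le_left (n i)))).det =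
        fres g _ (minor he inf_le_right (fun i => mres (inf_le_left : W ⊓ V ≤ W) (n i))).det := by
      rw [RingHom.map_det]
      congr 1
      ext i j
      simp only [minor, Matrix.of_apply, RingHom.mapMatrix_apply, Matrix.map_apply]
      conv_lhs => rw [← he.lc_coord inf_le_right (mres inf_le_left (n (Sum.inl i))), cm_lc]
      rw [hα'.coord_lc]
    have h2 := Scheme.preimage_basicOpen g
      (minor he inf_le_right (fun i => mres (inf_le_left : W ⊓ V ≤ W) (n i))).det
    rw [h1]
    exact (SetLike.ext_iff.1 h2 y).symm
  · exact ⟨fun h => absurd (chartOpen_le _ _ h) hV, fun h => absurd (chartOpen_le _ _ h) hV⟩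

/-- Some minor of a matrix with a right inverse is invertible. -/
lemma exists_minor_ne_zero {K : Type} [Field K] {d m : ℕ} (A : Matrix (Fin d) (Fin m) K)
    (B : Matrix (Fin m) (Fin d) K) (h : A * B = 1) :
    ∃ (r : ℕ) (σ : Fin d ⊕ Fin r ≃ Fin m),
      (Matrix.of fun i j => A i (σ (Sum.inl j))).det ≠ 0 := by
  have hspan : Submodule.span K (Set.range A.col) = ⊤ := by
    rw [← Matrix.range_mulVecLin, LinearMap.range_eq_top]
    intro v
    exact ⟨B.mulVec v, by simp [h]⟩
  obtain ⟨κ, a, ha, hsp, hli⟩ := exists_linearIndependent' K A.col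
  rw [hspan] at hsp
  have : Fintype κ := Fintype.ofInjective a ha
  let b : Module.Basis κ K (Fin d → K) := Module.Basis.mk hli hsp.ge
  have hcard : Fintype.card κ = d := by
    rw [← Module.finrank_eq_card_basis b, Module.finrank_fin_fun]
  let ε : Fin d ≃ κ := (Fintype.equivFinOfCardEq hcard).symm
  let c : Fin d → Fin m := a ∘ ε
  have hc : Function.Injective c := ha.comp ε.injective
  classical
  let τ : {j // j ∉ Set.range c} ≃ Fin (Fintype.card {j // j ∉ Set.range c}) := Fintype.equivFin _
  let σ : Fin d ⊕ Fin (Fintype.card {j // j ∉ Set.range c}) ≃ Fin m :=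
    (Equiv.sumCongr (Equiv.ofInjective c hc) τ.symm).trans
      (Equiv.sumCompl fun j => j ∈ Set.range c)
  refine ⟨_, σ, ?_⟩
  have hσ : ∀ j, σ (Sum.inl j) = c j := fun j => by
    simp [σ]
  simp only [hσ]
  have hunit : IsUnit (Matrix.of fun i j => A i (c j)) := by
    rw [← Matrix.linearIndependent_cols_iff_isUnit]
    exact hli.comp ε ε.injective
  exact ((Matrix.isUnit_iff_isUnit_det _).1 hunit).ne_zero

/-- A subbundle is a graph, locally, with respect to some arrangement of a given frame. -/
lemma exists_mem_chartOpen {d m : ℕ} {S : SubMod M} (hS : S.IsSub d) {b : Fin m → Γ(M, V)}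
    (hb : IsFrame b) {x : X} (hx : x ∈ V) :
    ∃ (r : ℕ) (σ : Fin d ⊕ Fin r ≃ Fin m), x ∈ chartOpen S (b ∘ σ) := by
  obtain ⟨W, r₀, n, hW, hn⟩ := hS x
  have hn1 := hn.mres (inf_le_left : W ⊓ V ≤ W)
  have hxx : x ∈ W ⊓ V := ⟨hW, hx⟩
  have hmul := (hb.mres (inf_le_right : W ⊓ V ≤ V)).coord_mul_coord hn1.isFrame
  let φ : Γ(X, W ⊓ V) →+* X.residueField x := (X.evaluation (W ⊓ V) x hxx).hom
  have hmulK := congrArg (fun A => A.map φ) hmul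
  simp only [Matrix.map_mul] at hmulK
  obtain ⟨r, σ, hσ⟩ := exists_minor_ne_zero (K := X.residueField x)
    (Matrix.of fun i j => φ ((hb.mres (inf_le_right : W ⊓ V ≤ V)).coord le_rfl
      (mres inf_le_left (n (Sum.inl i))) j))
    (Matrix.of fun j i => φ (hn1.isFrame.coord le_rfl (mres inf_le_right (b j)) (Sum.inl i))) (by
      ext i i'
      have := congrFun (congrFun hmulK (Sum.inl i)) (Sum.inl i')
      simp only [Matrix.mul_apply, Matrix.map_apply, Matrix.of_apply] at this ⊢
      refine this.trans ?_
      rw [Matrix.one_apply, Matrix.one_apply]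
      simp only [Sum.inl.injEq]
      split_ifs <;> simp)
  refine ⟨r, σ, ?_⟩
  rw [mem_chartOpen_iff (hb.reindex σ) inf_le_right hn1 hxx]
  have key : φ (minor (hb.reindex σ) (inf_le_right : W ⊓ V ≤ V)
      fun i => mres inf_le_left (n i)).det ≠ 0 := by
    refine ne_of_eq_of_ne ?_ hσ
    rw [RingHom.map_det]
    congr 1
    ext i j
    simp only [minor, RingHom.mapMatrix_apply, Matrix.map_apply, Matrix.of_apply]
    congr 1
    have h1 : (hb.reindex σ).coord (inf_le_right : W ⊓ V ≤ V) (mres inf_le_left (n (Sum.inl i))) =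
        (hb.mres (inf_le_right : W ⊓ V ≤ V)).coord le_rfl (mres inf_le_left (n (Sum.inl i))) ∘ σ := by
      apply ((hb.reindex σ) _ _).1
      rw [IsFrame.lc_coord]
      conv_lhs => rw [← (hb.mres (inf_le_right : W ⊓ V ≤ V)).lc_coord le_rfl
        (mres inf_le_left (n (Sum.inl i)))]
      rw [lc_mres]
      simp only [lc, Function.comp]
      exact (Equiv.sum_comp σ _).symm
    rw [h1]
    rfl
  exact (Scheme.evaluation_ne_zero_iff_mem_basicOpen X x hxx _).1 key

/-- The subsheaf spanned by the first part of a basis. -/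
def IsFrame.subMod {e : ι ⊕ κ → Γ(M, ⊤)} (he : IsFrame e) : SubMod M where
  carrier U := he.inlSpan U le_top
  res_mem h s hs k := by
    have := hs k
    rw [he.coord_mres le_top h]
    simp only [this, map_zero]
  local_mem {U s} h k := eq_of_locally_ring fun x hx => by
    obtain ⟨W, hW, hxW, m⟩ := h x hx
    refine ⟨W, hW, hxW, ?_⟩
    have := m k
    rw [he.coord_mres le_top hW] at this
    exact this.trans (map_zero _).symm

lemma IsFrame.isAdapted_subMod {e : ι ⊕ κ → Γ(M, ⊤)} (he : IsFrame e) :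
    he.subMod.IsAdapted e where
  isFrame := he
  mem_iff W h a := by
    change (∀ k, he.coord _ (lc e h a) (Sum.inr k) = 0) ↔ _
    rw [he.coord_lc]

end Charts

/-! ### Smoothness of affine space -/

section SmoothAffineSpace

/-- Affine space is smooth. -/
lemma smooth_affineSpace (n : Type) [Finite n] (S : Scheme.{0}) : Smooth (𝔸(n; S) ↘ S) := by
  have h : Smooth (terminal.from (Spec (.of (MvPolynomial n (ULift.{0} ℤ))))) := by
    have h1 : terminal.from (Spec (.of (MvPolynomial n (ULift.{0} ℤ)))) =
        Spec.map (CommRingCat.ofHom MvPolynomial.C) ≫ terminal.from (Spec (.of (ULift.{0} ℤ))) :=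
      Subsingleton.elim _ _
    have h2 := isIso_of_isTerminal specULiftZIsTerminal terminalIsTerminal
      (terminal.from (Spec (.of (ULift.{0} ℤ))))
    have h3 : Smooth (Spec.map (CommRingCat.ofHom
        (MvPolynomial.C : ULift.{0} ℤ →+* MvPolynomial n (ULift.{0} ℤ)))) := by
      rw [HasRingHomProperty.Spec_iff (P := @Smooth)]
      change RingHom.Smooth (MvPolynomial.C : ULift.{0} ℤ →+* MvPolynomial n (ULift.{0} ℤ))
      have : (MvPolynomial.C : ULift.{0} ℤ →+* MvPolynomial n (ULift.{0} ℤ)) =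
        algebraMap (ULift.{0} ℤ) (MvPolynomial n (ULift.{0} ℤ)) := rfl
      rw [this, RingHom.smooth_algebraMap]
      exact ⟨inferInstance, inferInstance⟩
    rw [h1]
    infer_instance
  exact smooth_isStableUnderBaseChange.of_isPullback
    (IsPullback.of_hasPullback (terminal.from S) _).flip h

end SmoothAffineSpace

/-! ### Existence and smoothness of Grassmann bundles -/

section Representability

variable {X T T' : Scheme.{0}} {E : X.Modules} {d : ℕ}

variable (E d) in
/-- An open set with a frame of `E` divided into a part of length `d` and a rest; it gives a chart
of the Grassmann bundle. -/
structure GrassChart where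
  V : X.Opens
  r : ℕ
  e : Fin d ⊕ Fin r → Γ(E, V)
  isFrame : IsFrame e

namespace GrassChart

variable (c : GrassChart E d)

/-- The affine space of `d × r`-matrices. -/
def space : Scheme.{0} := 𝔸(Fin d × Fin c.r; c.V)

/-- The projection of a chart to the open set over which it lives. -/
def toOpen : c.space ⟶ c.V := 𝔸(Fin d × Fin c.r; c.V) ↘ (c.V : Scheme.{0})

/-- The structure morphism of a chart. -/
def proj : c.space ⟶ X := c.toOpen ≫ c.V.ι

instance : Smooth c.toOpen := smooth_affineSpace (Fin d × Fin c.r) c.V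

instance : Smooth c.proj := inferInstanceAs (Smooth (c.toOpen ≫ c.V.ι))

/-- The entries of the universal matrix. -/
def entry (j : Fin d) (k : Fin c.r) : Γ(c.space, ⊤) := AffineSpace.coord c.V (j, k)

/-- The morphism to a chart given by a matrix. -/
def lift (l : T ⟶ c.V) (t : Fin d → Fin c.r → Γ(T, ⊤)) : T ⟶ c.space :=
  AffineSpace.homOfVector l fun i => t i.1 i.2

lemma lift_toOpen (l : T ⟶ c.V) (t : Fin d → Fin c.r → Γ(T, ⊤)) : c.lift l t ≫ c.toOpen = l :=
  AffineSpace.homOfVector_over _ _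

lemma fres_lift_entry (l : T ⟶ c.V) (t : Fin d → Fin c.r → Γ(T, ⊤)) (i : Fin d) (j : Fin c.r) :
    fres (c.lift l t) ⊤ (c.entry i j) = t i j := by
  have := AffineSpace.homOfVector_appTop_coord l (fun i => t i.1 i.2) (i, j)
  unfold fres lift entry
  exact this

lemma space_hom_ext {k k' : T ⟶ c.space} (h : k ≫ c.toOpen = k' ≫ c.toOpen)
    (h' : ∀ i j, fres k ⊤ (c.entry i j) = fres k' ⊤ (c.entry i j)) : k = k' :=
  AffineSpace.hom_ext h fun i => h' i.1 i.2

lemma top_le : ⊤ ≤ c.proj ⁻¹ᵁ c.V := by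
  have : c.proj ⁻¹ᵁ c.V = c.toOpen ⁻¹ᵁ c.V.ι ⁻¹ᵁ c.V := rfl
  rw [this, Scheme.Opens.ι_preimage_self]
  exact le_rfl

/-- The pullback of the frame of a chart to a scheme over `X`. -/
def frame (f : T ⟶ X) : Fin d ⊕ Fin c.r → Γ((Scheme.Modules.pullback f).obj E, f ⁻¹ᵁ c.V) :=
  fun i => cm (pullUnit f E) c.V (c.e i)

lemma isFrame_frame (f : T ⟶ X) : IsFrame (c.frame f) := isBC_pullUnit f E _ _ c.e c.isFrame

lemma isFrame_tri : IsFrame (V := (⊤ : c.space.Opens))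
    (tri (fun i => mres c.top_le (c.frame c.proj i)) c.entry) :=
  ((c.isFrame_frame c.proj).mres c.top_le).tri _

/-- The universal family on a chart, spanned by the rows of the universal matrix. -/
def fam : Fam c.space E d where
  f := c.proj
  N := c.isFrame_tri.subMod
  isSub _ := ⟨⊤, c.r, _, trivial, c.isFrame_tri.isAdapted_subMod⟩

lemma cm_frame {f : T ⟶ X} {f' : T' ⟶ X} (g : T' ⟶ T) (h : g ≫ f = f') (i) :
    cm (bcm g h E) (f ⁻¹ᵁ c.V) (c.frame f i) =
      mres (preimage_le_of_comp g h c.V) (c.frame f' i) :=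
  bcm_pullUnit g h (c.e i)

lemma isAdapted_bc (k : T ⟶ c.space) {f : T ⟶ X} (h : k ≫ c.proj = f) (h' : ⊤ ≤ f ⁻¹ᵁ c.V) :
    (c.fam.N.bc (bcm k h E)).IsAdapted (V := (⊤ : T.Opens))
      (tri (fun i => mres h' (c.frame f i)) fun i j => fres k ⊤ (c.entry i j)) := by
  have h1 := c.isFrame_tri.isAdapted_subMod.bc (isBC_bcm k h E)
  rw [cm_tri] at h1
  have h2 : (fun i => cm (bcm k h E) ⊤ (mres c.top_le (c.frame c.proj i))) =
      fun i => mres h' (c.frame f i) := by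
    funext i
    rw [cm_mres, c.cm_frame k h, mres_mres]
    rfl
  rw [h2] at h1
  exact h1

/-- A morphism to a chart classifies the graph of the matrix that it pulls back. -/
lemma map_fam_eq_iff (k : T ⟶ c.space) (s : Fam T E d) : c.fam.map k = s ↔
    ∃ (_ : k ≫ c.proj = s.f) (h' : ⊤ ≤ s.f ⁻¹ᵁ c.V), s.N.IsAdapted (V := (⊤ : T.Opens))
      (tri (fun i => mres h' (c.frame s.f i)) fun i j => fres k ⊤ (c.entry i j)) := by
  rw [Fam.map_eq_iff]
  constructor
  · rintro ⟨h, h1⟩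
    have h' : ⊤ ≤ s.f ⁻¹ᵁ c.V := by
      rw [← h]
      exact Scheme.Hom.preimage_mono k c.top_le
    refine ⟨h, h', ?_⟩
    rw [← h1]
    exact c.isAdapted_bc k h h'
  · rintro ⟨h, h', h1⟩
    exact ⟨h, SubMod.eq_of_adapted fun x => ⟨⊤, _, _, inferInstance, inferInstance, _, trivial,
      c.isAdapted_bc k h h', h1⟩⟩

lemma hom_ext {k k' : T ⟶ c.space} (h : c.fam.map k = c.fam.map k') : k = k' := by
  obtain ⟨h1, h2, h3⟩ := (c.map_fam_eq_iff k _).1 h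
  obtain ⟨-, h2', h3'⟩ := (c.map_fam_eq_iff k' _).1 rfl
  have h4 := h3.tri_unique h3'
  refine c.space_hom_ext ?_ fun i j => congrFun (congrFun h4 i) j
  rw [← cancel_mono c.V.ι, Category.assoc, Category.assoc]
  exact h1

/-- A family that is everywhere a graph with respect to the frame of a chart comes from it. -/
lemma exists_of_top_le (s : Fam T E d) (h : ⊤ ≤ chartOpen s.N (c.frame s.f)) :
    ∃ k : T ⟶ c.space, c.fam.map k = s := by
  obtain ⟨t, ht⟩ := exists_isAdapted_chartOpen s.N (c.isFrame_frame s.f)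
  have ht' := ht.mres h
  rw [mres_tri] at ht'
  simp only [mres_mres] at ht'
  have hV : ⊤ ≤ s.f ⁻¹ᵁ c.V := h.trans (chartOpen_le _ _)
  have hr : Set.range s.f ⊆ Set.range c.V.ι := by
    rintro _ ⟨x, rfl⟩
    rw [Scheme.Opens.range_ι]
    exact hV (show x ∈ ⊤ from trivial)
  let l : T ⟶ c.V := IsOpenImmersion.lift c.V.ι s.f hr
  refine ⟨c.lift l fun i j => rres h (t i j), (c.map_fam_eq_iff _ s).2 ⟨?_, hV, ?_⟩⟩
  · rw [proj, ← Category.assoc, lift_toOpen]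
    exact IsOpenImmersion.lift_fac _ _ _
  · simp only [fres_lift_entry]
    exact ht'

lemma mem_chartOpen_map (s : Fam T E d) (g : T' ⟶ T) (y : T') :
    y ∈ chartOpen (s.map g).N (c.frame (s.map g).f) ↔ g y ∈ chartOpen s.N (c.frame s.f) := by
  rw [← mem_chartOpen_bc_iff s.isSub (isBC_bcm g rfl E) (c.isFrame_frame s.f)]
  have : (fun i => cm (bcm g rfl E) (s.f ⁻¹ᵁ c.V) (c.frame s.f i)) = c.frame (g ≫ s.f) := by
    funext i
    exact (c.cm_frame g rfl i).trans (mres_self _)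
  rw [this]
  rfl

lemma top_le_chartOpen_of_map_eq {k : T ⟶ c.space} {s : Fam T E d} (h : c.fam.map k = s) :
    ⊤ ≤ chartOpen s.N (c.frame s.f) := by
  obtain ⟨-, h2, h3⟩ := (c.map_fam_eq_iff k s).1 h
  exact fun x _ => mem_chartOpen.2 ⟨⊤, h2, _, trivial, h3⟩

/-- The morphism of functors given by the universal family on a chart. -/
def toFunctor : yoneda.obj c.space ⟶ famFunctor E d :=
  (yonedaEquiv (F := famFunctor E d)).symm c.fam

lemma exists_restrict (s : Fam T E d) : ∃ k : (chartOpen s.N (c.frame s.f) : Scheme.{0}) ⟶ c.space,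
    c.fam.map k = s.map (chartOpen s.N (c.frame s.f)).ι := by
  refine c.exists_of_top_le _ fun x _ => ?_
  rw [c.mem_chartOpen_map s]
  exact x.2

lemma map_comp_eq {s : Fam T E d} {k : (chartOpen s.N (c.frame s.f) : Scheme.{0}) ⟶ c.space}
    (hk : c.fam.map k = s.map (chartOpen s.N (c.frame s.f)).ι)
    (h : T' ⟶ (chartOpen s.N (c.frame s.f) : Scheme.{0})) :
    c.fam.map (h ≫ k) = s.map (h ≫ (chartOpen s.N (c.frame s.f)).ι) := by
  rw [Fam.map_comp, hk, ← Fam.map_comp]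

lemma exists_lift {s : Fam T E d} {k : (chartOpen s.N (c.frame s.f) : Scheme.{0}) ⟶ c.space}
    (hk : c.fam.map k = s.map (chartOpen s.N (c.frame s.f)).ι) {k' : T' ⟶ c.space} {h' : T' ⟶ T}
    (e : c.fam.map k' = s.map h') :
    ∃ h : T' ⟶ (chartOpen s.N (c.frame s.f) : Scheme.{0}),
      h ≫ k = k' ∧ h ≫ (chartOpen s.N (c.frame s.f)).ι = h' := by
  have hle := c.top_le_chartOpen_of_map_eq e
  have hr : Set.range h' ⊆ Set.range (chartOpen s.N (c.frame s.f)).ι := by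
    rintro _ ⟨x, rfl⟩
    rw [Scheme.Opens.range_ι]
    exact (c.mem_chartOpen_map s h' x).1 (hle (show x ∈ ⊤ from trivial))
  refine ⟨IsOpenImmersion.lift (chartOpen s.N (c.frame s.f)).ι h' hr, c.hom_ext ?_,
    IsOpenImmersion.lift_fac _ _ _⟩
  rw [c.map_comp_eq hk, IsOpenImmersion.lift_fac, e]

/-- The charts are open subfunctors: their range in a family `s` is `chartOpen`. -/
lemma isOpenImmersion_toFunctor : IsOpenImmersion.presheaf c.toFunctor := by
  refine MorphismProperty.relative.of_exists fun T g => ?_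
  obtain ⟨s, rfl⟩ := (yonedaEquiv (F := famFunctor E d)).symm.surjective g
  change Fam T E d at s
  obtain ⟨k, hk⟩ := c.exists_restrict s
  refine ⟨(chartOpen s.N (c.frame s.f) : Scheme.{0}), yoneda.map k,
    (chartOpen s.N (c.frame s.f)).ι, ?_, inferInstance⟩
  refine IsPullback.of_forall_isPullback_app fun T' => ?_
  rw [Types.isPullback_iff]
  refine ⟨?_, ?_, ?_⟩
  · ext (h : T'.unop ⟶ _)
    exact c.map_comp_eq hk h
  · rintro h h' ⟨-, h2⟩
    exact (cancel_mono (chartOpen s.N (c.frame s.f)).ι).1 h2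
  · intro k' h' e
    exact c.exists_lift hk e

end GrassChart

/-- Every subbundle is locally in the range of some chart. -/
lemma exists_chart (hE : IsVectorBundle E) (s : Fam T E d) (x : T) :
    ∃ c : GrassChart E d, x ∈ chartOpen s.N (c.frame s.f) := by
  obtain ⟨V, m, b, hV, hb⟩ := IsVectorBundle_iff.1 hE (s.f x)
  obtain ⟨r, σ, h⟩ := exists_mem_chartOpen s.isSub (isBC_pullUnit s.f E V _ b hb) (x := x) hV
  exact ⟨⟨V, r, b ∘ σ, hb.reindex σ⟩, h⟩

variable (E d) in
/-- The functor of subbundles as a Zariski sheaf. -/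
def famSheaf : Sheaf Scheme.zariskiTopology.{0} (Type) :=
  ⟨famFunctor E d, (isSheaf_iff_isSheaf_of_type _ _).2 isSheaf_famFunctor⟩

/-- The morphism of sheaves given by the universal family on a chart. -/
def GrassChart.toSheaf (c : GrassChart E d) : yoneda.obj c.space ⟶ (famSheaf E d).1 := c.toFunctor

lemma isLocallySurjective_charts (hE : IsVectorBundle E) :
    Presheaf.IsLocallySurjective Scheme.zariskiTopology
      (Sigma.desc fun c : GrassChart E d => c.toSheaf) where
  imageSieve_mem {T} s := by
    change Fam T E d at s
    choose c hc using exists_chart hE s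
    let 𝒰 := T.openCoverOfIsOpenCover (fun x : T => chartOpen s.N ((c x).frame s.f))
      (.mk (by
        rw [eq_top_iff]
        intro x _
        exact TopologicalSpace.Opens.mem_iSup.2 ⟨x, hc x⟩))
    refine GrothendieckTopology.superset_covering _ ?_ 𝒰.mem_grothendieckTopology
    rintro Z h ⟨W, a, b, ⟨j⟩, rfl⟩
    obtain ⟨k, hk⟩ := (c j).exists_restrict s
    refine ⟨(Sigma.ι (fun c : GrassChart E d => yoneda.obj c.space) (c j)).app (.op Z) (a ≫ k), ?_⟩
    have h1 : Sigma.ι (fun c : GrassChart E d => yoneda.obj c.space) (c j) ≫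
      (Sigma.desc fun c : GrassChart E d => c.toSheaf) = (c j).toSheaf := Sigma.ι_desc _ _
    refine (congr(($h1).app (.op Z) (a ≫ k))).trans ?_
    exact (c j).map_comp_eq hk a

variable (d) in
/-- Grassmann bundles of vector bundles exist, by gluing the charts, and are smooth over the base,
as the charts are. -/
lemma exists_isUniversalSub (hE : IsVectorBundle E) :
    ∃ (G : Scheme.{0}) (π : G ⟶ X) (N : SubMod ((Scheme.Modules.pullback π).obj E)),
      IsUniversalSub π d N ∧ Smooth π := by
  have hf : ∀ c : GrassChart E d, IsOpenImmersion.presheaf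
      c.toSheaf :=
    fun c => c.isOpenImmersion_toFunctor
  have hs : Presheaf.IsLocallySurjective Scheme.zariskiTopology
    (Sigma.desc fun c : GrassChart E d =>
      c.toSheaf) := isLocallySurjective_charts hE
  let R := Scheme.LocalRepresentability.representableBy (F := famSheaf E d) hf
  let G := (Scheme.LocalRepresentability.glueData (F := famSheaf E d) hf).glued
  let u : Fam G E d := R.homEquiv (𝟙 G)
  have hu : ∀ {T : Scheme.{0}} (g : T ⟶ G), R.homEquiv g = u.map g := fun g =>
    R.homEquiv_eq g
  refine ⟨G, u.f, u.N, ⟨u.isSub, fun {T} f S hS => ?_⟩, ?_⟩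
  · have : ∃! g : T ⟶ G, u.map g = ⟨f, S, hS⟩ := by
      refine ⟨R.homEquiv.symm (⟨f, S, hS⟩ : Fam T E d), ?_, fun g hg => ?_⟩
      · exact (hu _).symm.trans (R.homEquiv.apply_symm_apply _)
      · exact (R.homEquiv.eq_symm_apply).2 ((hu g).trans hg)
    simpa only [Fam.map_eq_iff] using this
  · have inst : IsZariskiLocalAtSource @Smooth.{0} :=
      HasRingHomProperty.instIsZariskiLocalAtSource (Q := RingHom.Smooth)
    rw [IsZariskiLocalAtSource.iff_of_openCover (P := @Smooth.{0})
      (Scheme.LocalRepresentability.glueData (F := famSheaf E d) hf).openCover]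
    intro c
    change GrassChart E d at c
    have h1 : u.map (Scheme.LocalRepresentability.toGlued (F := famSheaf E d) hf c) =
      GrassChart.fam c := by
      refine (hu _).symm.trans ?_
      refine (Scheme.LocalRepresentability.yonedaGluedToSheaf_app_toGlued (F := famSheaf E d) hf
        (i := c)).trans ?_
      exact c.fam.map_id
    have h2 : Scheme.LocalRepresentability.toGlued (F := famSheaf E d) hf c ≫ u.f =
      GrassChart.proj c :=
      congrArg Fam.f h1
    change Smooth (Scheme.LocalRepresentability.toGlued (F := famSheaf E d) hf c ≫ u.f)
    rw [h2]
    infer_instance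

lemma nonempty_grassmannBundle (hE : IsVectorBundle E) (d : ℕ) :
    Nonempty (GrassmannBundle E d) := by
  obtain ⟨G, π, N, h, -⟩ := exists_isUniversalSub d hE
  exact ⟨h.grassmannBundle⟩

end Representability

/-! ### Bases of Kähler differentials -/

section KaehlerBases

open KaehlerDifferential

variable {R A B ι κ : Type} [CommRing R] [CommRing A] [CommRing B] [Algebra R A] [Algebra A B]
  [Algebra R B] [IsScalarTower R A B] [Fintype ι] [Fintype κ]

/-- A basis of a module, in the form of the bijectivity of the map of linear combinations. -/
def IsBasis (A : Type) {M : Type} [CommRing A] [AddCommGroup M] [Module A M] (b : ι → M) : Prop :=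
  Function.Bijective (fun a : ι → A => ∑ i, a i • b i)

lemma isBasis_of_basis {M : Type} [AddCommGroup M] [Module A M] (b : Module.Basis ι A M) :
    IsBasis A b := by
  have h : (fun a : ι → A => ∑ i, a i • b i) = b.equivFun.symm := by
    ext a
    simp
  rw [IsBasis, h]
  exact b.equivFun.symm.bijective

/-- A basis in the sense of `IsBasis`, as a bundled basis. -/
def IsBasis.toBasis {A M : Type} [CommRing A] [AddCommGroup M] [Module A M] {b : ι → M}
    (hb : IsBasis A b) : Module.Basis ι A M :=
  Module.Basis.ofEquivFun (LinearEquiv.ofBijective (Fintype.linearCombination A b) hb).symm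

lemma IsBasis.toBasis_apply {A M : Type} [CommRing A] [AddCommGroup M] [Module A M] {b : ι → M}
    (hb : IsBasis A b) (i : ι) : hb.toBasis i = b i := by
  classical
  simp only [toBasis, Module.Basis.coe_ofEquivFun, LinearEquiv.symm_symm]
  exact (Fintype.linearCombination_apply_single A b i 1).trans (one_smul _ _)

/-- The kernel is the image of the first homology of the cotangent complex of `B` over `A`, which
vanishes. -/
lemma mapBaseChange_injective_of_formallySmooth [Algebra.FormallySmooth A B] :
    Function.Injective (mapBaseChange R A B) := by
  rw [injective_iff_map_eq_zero]
  intro x hx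
  obtain ⟨x, rfl⟩ := (Algebra.H1Cotangent.exact_δ_mapBaseChange R A B x).mp hx
  rw [Subsingleton.elim x 0, map_zero]

/-- If `B` is formally smooth over `A`, then a basis of `Ω_A` and lifts of a basis of `Ω_{B/A}`
make up a basis of `Ω_B`. -/
lemma IsBasis.kaehler_sumElim [Algebra.FormallySmooth A B] {b : ι → Ω[A⁄R]} (hb : IsBasis A b)
    {c : κ → Ω[B⁄R]} (hc : IsBasis B (fun k => KaehlerDifferential.map R A B B (c k))) :
    IsBasis B (Sum.elim (fun i => KaehlerDifferential.map R R A B (b i)) c) := by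
  have key : IsBasis B (fun i => (1 : B) ⊗ₜ[A] b i) := by
    refine Eq.subst (motive := IsBasis B) (funext fun i => ?_)
      (isBasis_of_basis (Algebra.TensorProduct.basis B hb.toBasis))
    rw [Algebra.TensorProduct.basis_apply, hb.toBasis_apply]
  have e1 : ∀ a : ι → B, ∑ i, a i • KaehlerDifferential.map R R A B (b i) =
      mapBaseChange R A B (∑ i, a i • (1 : B) ⊗ₜ[A] b i) := by
    intro a; simp
  have e2 : ∀ a : ι ⊕ κ → B, ∑ i, a i • Sum.elim (fun i => KaehlerDifferential.map R R A
    B (b i)) c i =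
      mapBaseChange R A B (∑ i, a (.inl i) • (1 : B) ⊗ₜ[A] b i) + ∑ k, a (.inr k) • c k := by
    intro a; rw [Fintype.sum_sum_type, ← e1]; rfl
  have hex := exact_mapBaseChange_map R A B
  constructor
  · rw [IsBasis] at *
    intro a a' h
    have h := (e2 a).symm.trans (h.trans (e2 a'))
    have h0 := congrArg (KaehlerDifferential.map R A B B) h
    rw [map_add, map_add, hex.apply_apply_eq_zero, hex.apply_apply_eq_zero, zero_add, zero_add,
      map_sum, map_sum] at h0
    simp only [LinearMap.map_smul] at h0
    have h1 : (fun k => a (.inr k)) = fun k => a' (.inr k) := hc.1 h0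
    have h2 : (fun k => a (.inl k)) = fun k => a' (.inl k) := by
      refine key.1 (mapBaseChange_injective_of_formallySmooth (R := R) ?_)
      have h3 : ∑ k, a (.inr k) • c k = ∑ k, a' (.inr k) • c k :=
        Finset.sum_congr rfl fun k _ => by rw [congrFun h1 k]
      rw [h3] at h
      exact add_right_cancel h
    ext (i | k)
    · exact congrFun h2 i
    · exact congrFun h1 k
  · intro x
    obtain ⟨a, ha⟩ := hc.2 (KaehlerDifferential.map R A B B x)
    obtain ⟨y, hy⟩ := (hex (x - ∑ k, a k • c k)).1 (by
      rw [map_sub, map_sum]; simp only [LinearMap.map_smul]; exact sub_eq_zero.2 ha.symm)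
    obtain ⟨a', ha'⟩ := key.2 y
    refine ⟨Sum.elim a' a, (e2 _).trans ?_⟩
    simp only [Sum.elim_inl, Sum.elim_inr]
    rw [show ∑ i, a' i • (1 : B) ⊗ₜ[A] b i = y from ha', hy]
    abel

lemma IsBasis.kaehler_of_formallyEtale [Algebra.FormallyEtale A B] {b : ι → Ω[A⁄R]}
    (hb : IsBasis A b) : IsBasis B (fun i => KaehlerDifferential.map R R A B (b i)) := by
  have := hb.kaehler_sumElim (B := B) (c := (PEmpty.elim : PEmpty → Ω[B⁄R]))
    ⟨fun a a' _ => funext fun k => k.elim, fun x => ⟨PEmpty.elim, Subsingleton.elim _ _⟩⟩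
  constructor
  · intro a a' h
    have h2 := @this.1 (Sum.elim a PEmpty.elim) (Sum.elim a' PEmpty.elim) (by
      simpa [Fintype.sum_sum_type] using h)
    funext i
    exact congrFun h2 (.inl i)
  · intro x
    obtain ⟨a, ha⟩ := this.2 x
    exact ⟨fun i => a (.inl i), by simpa [Fintype.sum_sum_type] using ha⟩

/-- If `B` is standard smooth over `A`, then a basis of `Ω_A` extends to one of `Ω_B`. -/
lemma IsBasis.exists_kaehler_sumElim [Algebra.IsStandardSmooth A B] {b : ι → Ω[A⁄R]}
    (hb : IsBasis A b) : ∃ (r : ℕ) (c : Fin r → Ω[B⁄R]),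
      IsBasis B (Sum.elim (fun i => KaehlerDifferential.map R R A B (b i)) c) := by
  rcases subsingleton_or_nontrivial B with h | h
  · have : Subsingleton Ω[B⁄R] := Module.subsingleton B _
    exact ⟨0, Fin.elim0, fun _ _ _ => Subsingleton.elim _ _, fun x => ⟨0, Subsingleton.elim _ _⟩⟩
  · let w := Module.finBasis B Ω[B⁄A]
    choose c hc using fun i => KaehlerDifferential.map_surjective R A B (w i)
    refine ⟨_, c, hb.kaehler_sumElim ?_⟩
    simp only [hc]
    exact isBasis_of_basis w

lemma exists_isBasis_kaehler (n : ℕ) [Nontrivial B]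
    [Algebra.IsStandardSmoothOfRelativeDimension n A B] :
    ∃ b : Fin n → Ω[B⁄A], IsBasis B b := by
  have := Algebra.IsStandardSmoothOfRelativeDimension.isStandardSmooth (R := A) (S := B) n
  have h := Algebra.IsStandardSmoothOfRelativeDimension.rank_kaehlerDifferential (R := A) (S := B) n
  exact ⟨_, isBasis_of_basis (Module.finBasisOfFinrankEq B Ω[B⁄A] (Module.finrank_eq_of_rank_eq h))⟩

end KaehlerBases

/-! ### Frames of the cotangent sheaf -/

section Cotangent

open PresheafOfModules.DifferentialsConstruction

variable {X Y : Scheme.{0}} (p : X ⟶ Spec (.of ℂ)) {U V W : X.Opens}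

/-- The `ℂ`-algebra structure on sections of the structure sheaf of a `ℂ`-scheme. -/
abbrev algSections (U : X.Opens) : Algebra ℂ Γ(X, U) := ((scalars p).app (.op U)).hom.toAlgebra

/-- The universal derivation, before sheafification. -/
def dP (U : X.Opens) : Γ(X, U) →+ PSec (relativeDifferentials' (scalars p)) U :=
  (derivation' (scalars p)).d

/-- The canonical map from Kähler differentials to sections of the cotangent sheaf. -/
def toCot (U : X.Opens) :
    PSec (relativeDifferentials' (scalars p)) U →ₗ[Γ(X, U)] Γ(cotangent p, U) :=
  toSh (relativeDifferentials' (scalars p)) U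

lemma pres_dP (h : V ≤ U) (a : Γ(X, U)) : pres h (dP p U a) = dP p V (rres h a) :=
  ((derivation' (scalars p)).d_map (homOfLE h).op a).symm

lemma span_range_dP : Submodule.span Γ(X, U) (Set.range (dP p U)) = ⊤ := by
  let := algSections p U
  exact KaehlerDifferential.span_range_derivation ℂ Γ(X, U)

/-- Additive maps on Kähler differentials that are semilinear along the same ring homomorphism
are equal if they agree on exact differentials. -/
lemma differentials_hom_ext {B N : Type} [CommRing B] [AddCommGroup N] [Module B N]
    (σ : Γ(X, U) →+* B) {Φ Ψ : PSec (relativeDifferentials' (scalars p)) U →+ N}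
    (hΦ : ∀ a x, Φ (a • x) = σ a • Φ x) (hΨ : ∀ a x, Ψ (a • x) = σ a • Ψ x)
    (h : ∀ a, Φ (dP p U a) = Ψ (dP p U a)) (x) : Φ x = Ψ x := by
  have hx : x ∈ Submodule.span Γ(X, U) (Set.range (dP p U)) := by
    rw [span_range_dP]; trivial
  induction hx using Submodule.span_induction with
  | mem x hx => obtain ⟨a, rfl⟩ := hx; exact h a
  | zero => rw [map_zero, map_zero]
  | add x y _ _ hx hy => rw [map_add, map_add, hx, hy]
  | smul a x _ hx => rw [hΦ, hΨ, hx]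


lemma sheafifyDesc_toSh {P : PreMod X} {M : X.Modules} (φ : P ⟶ pre M) (s : PSec P U) :
    (sheafifyDesc φ).app U (toSh P U s) = (φ.app (.op U)).hom s := by
  have h : toSheafify P ≫ preMap (sheafifyDesc φ) = φ :=
    ((sheafificationAdj X).homEquiv_unit P M _).symm.trans
      (((sheafificationAdj X).homEquiv P M).apply_symm_apply φ)
  exact congr(($h).app (.op U) s)

variable {p} in
lemma pullbackForms_dSection (f : Y ⟶ X) (U : X.Opens) (a : Γ(X, U)) :
    cm (pullbackForms f p) U (dSection p U a) = dSection (f ≫ p) (f ⁻¹ᵁ U) (fres f U a) := by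
  refine (sheafifyDesc_toSh _ (dP p U a)).trans ?_
  exact PresheafOfModules.Derivation.congr_d ((isUniversal' (scalars p)).fac _) (X := .op U) a

variable {p} in
lemma rres_scalars (h : V ≤ U) (z : ℂ) :
    rres h ((scalars p).app (.op U) z) = (scalars p).app (.op V) z :=
  congr($((scalars p).naturality (homOfLE h).op) z).symm

variable {ι : Type} [Fintype ι]

/-- A basis of the module of differentials of an affine open is a frame of the cotangent sheaf. -/
lemma isFrame_cotangent (hW : IsAffineOpen W) {b : ι → PSec (relativeDifferentials' (scalars p)) W}
    (hb : IsBasis Γ(X, W) b) : IsFrame (fun i => toCot p W (b i)) := by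
  refine isFrame_sheafify b fun W₁ hW₁ x hx => ?_
  obtain ⟨W', hW', hx', hle⟩ := exists_isAffineOpen_mem_and_subset (U := W₁) hx
  refine ⟨W', hle, hx', fun h => ?_⟩
  let := algSections p W
  let := algSections p W'
  let : Algebra Γ(X, W) Γ(X, W') := (rres h).toAlgebra
  have : IsScalarTower ℂ Γ(X, W) Γ(X, W') :=
    IsScalarTower.of_algebraMap_eq fun z => (rres_scalars h z).symm
  have het : (rres (X := X) h).Etale := by
    have := (𝟙 X : X ⟶ X).etale_appLE hW hW' h
    rwa [show (𝟙 X : X ⟶ X).appLE W W' h = X.presheaf.map (homOfLE h).op by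
      exact (by simp [Scheme.Hom.appLE]; exact Category.id_comp _)] at this
  have : Algebra.Etale Γ(X, W) Γ(X, W') := het
  have key := IsBasis.kaehler_of_formallyEtale (R := ℂ) (B := Γ(X, W')) (A := Γ(X, W)) hb
  refine Eq.subst (motive := IsBasis Γ(X, W')) (funext fun i => ?_) key
  symm
  refine differentials_hom_ext p (rres h) (Φ := pres h)
    (Ψ := (KaehlerDifferential.map ℂ ℂ Γ(X, W) Γ(X, W')).toAddMonoidHom) (pres_smul h)
    (fun a x => ?_) (fun a => ?_) (b i)
  · exact LinearMap.map_smul (KaehlerDifferential.map ℂ ℂ Γ(X, W) Γ(X, W')) a x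
  · exact (pres_dP p h a).trans (KaehlerDifferential.map_D ℂ ℂ Γ(X, W) Γ(X, W') a).symm

/-- If `V ⟶ W` is a standard smooth morphism of affine opens, a basis of the differentials of `W`
extends to a frame of the cotangent sheaf over `V`. -/
lemma exists_isFrame_cotangent_sumElim (f : Y ⟶ X)
    {b : ι → PSec (relativeDifferentials' (scalars p)) W}
    (hb : IsBasis Γ(X, W) b) {V : Y.Opens} (hV : IsAffineOpen V) (hVW : V ≤ f ⁻¹ᵁ W)
    (hs : (f.appLE W V hVW).hom.IsStandardSmooth) :
    ∃ (r : ℕ) (η : Fin r → Γ(cotangent (f ≫ p), V)), IsFrame (Sum.elim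
      (fun i => mres hVW (cm (pullbackForms f p) W (toCot p W (b i)))) η) := by
  let := algSections p W
  let := algSections (f ≫ p) V
  let : Algebra Γ(X, W) Γ(Y, V) := (f.appLE W V hVW).hom.toAlgebra
  have happ : ∀ a, f.appLE W V hVW a = rres hVW (fres f W a) := fun a => rfl
  have : IsScalarTower ℂ Γ(X, W) Γ(Y, V) := IsScalarTower.of_algebraMap_eq fun z => by
    refine Eq.trans ?_ (happ _).symm
    exact (rres_scalars (p := f ≫ p) hVW z).symm.trans
      (congrArg (rres hVW) (scalars_comp f p W z).symm)
  have : Algebra.IsStandardSmooth Γ(X, W) Γ(Y, V) := hs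
  obtain ⟨r, c, hc⟩ := IsBasis.exists_kaehler_sumElim (R := ℂ) (B := Γ(Y, V)) hb
  refine ⟨r, fun k => toCot (f ≫ p) V (c k), ?_⟩
  refine Eq.subst (motive := IsFrame) (funext fun i => ?_) (isFrame_cotangent (f ≫ p) hV hc)
  symm
  rcases i with i | k
  · refine differentials_hom_ext p (f.appLE W V hVW).hom
      (Φ := (mres hVW).comp ((cm (pullbackForms f p) W).comp (toCot p W).toAddMonoidHom))
      (Ψ := (toCot (f ≫ p) V).toAddMonoidHom.comp
        (KaehlerDifferential.map ℂ ℂ Γ(X, W) Γ(Y, V)).toAddMonoidHom) (fun a x => ?_)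
          (fun a x => ?_)
      (fun a => ?_) (b i)
    · change mres hVW (cm (pullbackForms f p) W (toCot p W (a • x))) = _
      rw [LinearMap.map_smul, cm_smul, mres_smul]; rfl
    · refine (congrArg (toCot (f ≫ p) V) (LinearMap.map_smul
          (KaehlerDifferential.map ℂ ℂ Γ(X, W) Γ(Y, V)) a x)).trans ?_
      exact (toCot (f ≫ p) V).map_smul (f.appLE W V hVW a) _
    · refine (congrArg (mres hVW) (pullbackForms_dSection f W a)).trans ?_
      refine (dSection_res (f ≫ p) (homOfLE hVW) (fres f W a)).symm.trans ?_
      exact congrArg (toCot (f ≫ p) V)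
        (KaehlerDifferential.map_D ℂ ℂ Γ(X, W) Γ(Y, V) a).symm
  · rfl

end Cotangent

/-! ### Cotangent frames along smooth morphisms -/

section SmoothFrames

open PresheafOfModules.DifferentialsConstruction

variable {X Y : Scheme.{0}}

lemma exists_isStandardSmooth_appLE (f : Y ⟶ X) [Smooth f] {W : X.Opens} (hW : IsAffineOpen W)
    (y : Y) (hy : y ∈ f ⁻¹ᵁ W) : ∃ (V : Y.Opens) (h : V ≤ f ⁻¹ᵁ W), IsAffineOpen V ∧ y ∈ V ∧
      (f.appLE W V h).hom.IsStandardSmooth := by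
  obtain ⟨V, hV, hyV, hVW⟩ := exists_isAffineOpen_mem_and_subset (U := f ⁻¹ᵁ W) hy
  obtain ⟨s, hs, H⟩ := RingHom.smooth_iff_locally_isStandardSmooth.1 (f.smooth_appLE hW hV hVW)
  have hy' : y ∈ ⨆ t : s, Y.basicOpen (t : Γ(Y, V)) := by
    rw [(hV.iSup_basicOpen_eq_self_iff).2 hs]; exact hyV
  obtain ⟨t, hyt⟩ := TopologicalSpace.Opens.mem_iSup.1 hy'
  have hle : Y.basicOpen (t : Γ(Y, V)) ≤ V := Y.basicOpen_le _
  refine ⟨Y.basicOpen (t : Γ(Y, V)), hle.trans hVW, hV.basicOpen _, hyt, ?_⟩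
  have := hV.isLocalization_basicOpen (t : Γ(Y, V))
  have h1 := RingHom.isStandardSmooth_respectsIso.1 _
    (IsLocalization.algEquiv (Submonoid.powers (t : Γ(Y, V))) (Localization.Away (t : Γ(Y, V)))
      Γ(Y, Y.basicOpen (t : Γ(Y, V)))).toRingEquiv (H t t.2)
  convert h1 using 1
  have h2 : f.appLE W (Y.basicOpen (t : Γ(Y, V))) (hle.trans hVW) =
      f.appLE W V hVW ≫ Y.presheaf.map (homOfLE hle).op := (f.appLE_map _ _).symm
  rw [h2]
  ext a
  exact ((IsLocalization.algEquiv (Submonoid.powers (t : Γ(Y, V))) (Localization.Away (t : Γ(Y, V)))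
    Γ(Y, Y.basicOpen (t : Γ(Y, V)))).commutes (f.appLE W V hVW a)).symm

lemma exists_isBasis_differentials (p : X ⟶ Spec (.of ℂ)) (n : ℕ) [SmoothOfRelativeDimension n p]
    (x : X) : ∃ (W : X.Opens) (b : Fin n → PSec (relativeDifferentials' (scalars p)) W),
      IsAffineOpen W ∧ x ∈ W ∧ IsBasis Γ(X, W) b := by
  obtain ⟨U, hU, V, hV, hx, hVU, hs⟩ :=
    SmoothOfRelativeDimension.exists_isStandardSmoothOfRelativeDimension (n := n) (f := p) x
  have hU' : U = ⊤ := by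
    ext z
    have : z = p x := Subsingleton.elim (α := PrimeSpectrum ℂ) _ _
    exact ⟨fun _ => trivial, fun _ => this ▸ hVU hx⟩
  subst hU'
  let := algSections p V
  have : Algebra.IsStandardSmoothOfRelativeDimension n ℂ Γ(X, V) := by
    have h1 := (RingHom.isStandardSmoothOfRelativeDimension_respectsIso (n := n)).2 _
      (Scheme.ΓSpecIso (.of ℂ)).symm.commRingCatIsoToRingEquiv hs
    exact h1
  have : Nonempty V := ⟨⟨x, hx⟩⟩
  obtain ⟨b, hb⟩ := exists_isBasis_kaehler (A := ℂ) (B := Γ(X, V)) n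
  exact ⟨V, b, hV, hx, hb⟩

variable (p : X ⟶ Spec (.of ℂ))

lemma exists_isFrame_cotangent (n : ℕ) [SmoothOfRelativeDimension n p] (x : X) :
    ∃ (W : X.Opens) (e : Fin n → Γ(cotangent p, W)),
    x ∈ W ∧ IsFrame e :=
  have ⟨W, _, hW, hx, hb⟩ := exists_isBasis_differentials p n x
  ⟨W, _, hx, isFrame_cotangent p hW hb⟩

/-- Along a smooth morphism, a local frame of the cotangent sheaf of the base pulls back to a part
of a frame. -/
lemma exists_isFrame_pullbackForms (n : ℕ) [SmoothOfRelativeDimension n p] (f : Y ⟶ X) [Smooth f]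
    (y : Y) :
    ∃ (W : X.Opens) (ω : Fin n → Γ(cotangent p, W)) (V : Y.Opens) (h : V ≤ f ⁻¹ᵁ W)
      (r : ℕ) (η : Fin r → Γ(cotangent (f ≫ p), V)), y ∈ V ∧ IsFrame ω ∧
        IsFrame (Sum.elim (fun i => mres h (cm (pullbackForms f p) W (ω i))) η) := by
  obtain ⟨W, b, hW, hy, hb⟩ := exists_isBasis_differentials p n (f y)
  obtain ⟨V, h, hV, hyV, hs⟩ := exists_isStandardSmooth_appLE f hW y hy
  obtain ⟨r, η, hη⟩ := exists_isFrame_cotangent_sumElim p f hb hV h hs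
  exact ⟨W, _, V, h, r, η, hyV, isFrame_cotangent p hW hb, hη⟩

lemma isVectorBundle_cotangent (n : ℕ) [SmoothOfRelativeDimension n p] :
    IsVectorBundle (cotangent p) :=
  IsVectorBundle_iff.2 fun x =>
    have ⟨W, e, hx, he⟩ := exists_isFrame_cotangent p n x
    ⟨W, n, e, hx, he⟩

/-- The frame of the Simpson system that consists of the section `1` and a frame of the
cotangent sheaf. -/
def simpsonFrame {W : X.Opens} {ι : Type} (e : ι → Γ(cotangent p, W)) :
    Unit ⊕ ι → Γ(simpson p, W) :=
  Sum.elim (fun _ => (biprod.inl : structureSheaf X ⟶ simpson p).app W (secO W 1))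
    (fun k => (biprod.inr : cotangent p ⟶ simpson p).app W (e k))

lemma isFrame_simpsonFrame {W : X.Opens} {ι : Type} [Fintype ι] {e : ι → Γ(cotangent p, W)}
    (he : IsFrame e) :
    IsFrame (simpsonFrame p e) := (isFrame_one W).biprod he

lemma isVectorBundle_simpson (n : ℕ) [SmoothOfRelativeDimension n p] : IsVectorBundle (simpson p) :=
  IsVectorBundle_iff.2 fun x =>
    have ⟨W, _, hx, he⟩ := exists_isFrame_cotangent p n x
    ⟨W, 1 + n, _, hx, (isFrame_simpsonFrame p he).reindex
      (((Equiv.equivPUnit _).symm.sumCongr (Equiv.refl _)).trans finSumFinEquiv).symm⟩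

end SmoothFrames

/-! ### Sections of tensor products and Higgs fields -/

section TensorSections

variable {X Y : Scheme.{0}} {M M' N N' : X.Modules} {U V W : X.Opens} {ι κ : Type} [Fintype ι]
  [Fintype κ]

lemma mres_tmulSection (h : W ≤ V) (m : Γ(M, V)) (n : Γ(N, V)) :
    mres h (tmulSection V m n) = tmulSection W (mres h m) (mres h n) :=
  tmulSection_res (homOfLE h) m n

lemma isFrame_tensor {e : ι → Γ(M, V)} (he : IsFrame e) {f : κ → Γ(N, V)} (hf : IsFrame f) :
    IsFrame (M := tensor M N) (fun ik : ι × κ => tmulSection V (e ik.1) (f ik.2)) := by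
  refine isFrame_sheafify (P := pre M ⊗ pre N) (fun ik : ι × κ =>
    TensorProduct.tmul Γ(X, V) (e ik.1) (f ik.2)) fun W hW x hx => ⟨W, le_rfl, hx, fun h => ?_⟩
  have h1 : IsBasis Γ(X, W) (fun i => mres h (e i)) := he W h
  have h2 : IsBasis Γ(X, W) (fun i => mres h (f i)) := hf W h
  have h3 := isBasis_of_basis (h1.toBasis.tensorProduct h2.toBasis)
  refine Eq.subst (motive := IsBasis Γ(X, W)) (funext fun ik => ?_) h3
  rw [Module.Basis.tensorProduct_apply', IsBasis.toBasis_apply, IsBasis.toBasis_apply]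
  rfl

lemma tensorMap_tmulSection (f : M ⟶ M') (g : N ⟶ N') (m : Γ(M, U)) (n : Γ(N, U)) :
    (tensorMap f g).app U (tmulSection U m n) = tmulSection U (f.app U m) (g.app U n) := by
  have h := (sheafificationAdj X).unit.naturality (preMap f ⊗ₘ preMap g)
  exact congr(($h).app (.op U) (TensorProduct.tmul Γ(X, U) m n)).symm

lemma leftUnitorInv_app (n : Γ(N, U)) :
    (leftUnitorInv N).app U n = tmulSection U (secO U 1) n := by
  have h := Scheme.Modules.fullyFaithfulToPresheafOfModules.map_preimage
    ((λ_ (pre N)).inv ≫ toSheafify (pre (structureSheaf X) ⊗ pre N))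
  exact congr(($h).app (.op U) n)

lemma tensorToPushforward_tmulSection {P P' : Y.Modules} (f : Y ⟶ X)
    (α : M ⟶ (Scheme.Modules.pushforward f).obj P) (β : N ⟶ (Scheme.Modules.pushforward f).obj P')
    (m : Γ(M, U)) (n : Γ(N, U)) :
    cm (tensorToPushforward f α β) U (tmulSection U m n) =
      tmulSection (f ⁻¹ᵁ U) (cm α U m) (cm β U n) :=
  sheafifyDesc_toSh (P := pre M ⊗ pre N) _ (TensorProduct.tmul Γ(X, U) m n)

variable {p : X ⟶ Spec (.of ℂ)}

lemma HiggsField.pullback_app {E : X.Modules} (φ : HiggsField p E) (f : Y ⟶ X) (s : Γ(E, U)) :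
    (φ.pullback f).app (f ⁻¹ᵁ U) (cm (pullUnit f E) U s) =
      cm (tensorToPushforward f (pullUnit f E) (pullbackForms f p)) U (φ.app U s) :=
  pullDesc_app (φ ≫ tensorToPushforward f (pullUnit f E) (pullbackForms f p)) s

lemma simpsonField_inl (a : Γ(structureSheaf X, U)) :
    (simpsonField p).app U ((biprod.inl : structureSheaf X ⟶ simpson p).app U a) = 0 := by
  have h : (biprod.inl : structureSheaf X ⟶ simpson p) ≫ simpsonField p = 0 :=
    (biprod.inl_snd_assoc _).trans zero_comp
  exact app_of_eq h U a

lemma simpsonField_inr (ω : Γ(cotangent p, U)) :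
    (simpsonField p).app U ((biprod.inr : cotangent p ⟶ simpson p).app U ω) =
      tmulSection U ((biprod.inl : structureSheaf X ⟶ simpson p).app U (secO U 1)) ω := by
  have h : (biprod.inr : cotangent p ⟶ simpson p) ≫ simpsonField p =
      leftUnitorInv (cotangent p) ≫ tensorMap biprod.inl (𝟙 (cotangent p)) :=
    biprod.inr_snd_assoc _
  refine (app_of_eq h U ω).trans ?_
  refine (congrArg ((tensorMap biprod.inl (𝟙 (cotangent p))).app U) (leftUnitorInv_app ω)).trans ?_
  exact tensorMap_tmulSection _ _ _ _

end TensorSections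

/-! ### The obstruction in local coordinates -/

section Obstruction

variable {X T G : Scheme.{0}} {p : X ⟶ Spec (.of ℂ)} {U V : T.Opens} {W : X.Opens} {n d : ℕ}

/-- The section `(1, 0)` of the pullback of the Simpson system. -/
def oneSec (p : X ⟶ Spec (.of ℂ)) (f : T ⟶ X) (V : T.Opens) :
    Γ((Scheme.Modules.pullback f).obj (simpson p), V) :=
  mres (U := f ⁻¹ᵁ ⊤) le_top (cm (pullUnit f (simpson p)) ⊤
    ((biprod.inl : structureSheaf X ⟶ simpson p).app ⊤ (secO ⊤ 1)))

lemma mres_oneSec (f : T ⟶ X) (h : V ≤ U) : mres h (oneSec p f U) = oneSec p f V := mres_mres _ _ _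

lemma cm_oneSec {π : G ⟶ X} {f : T ⟶ X} (g : T ⟶ G) (h : g ≫ π = f) (V : G.Opens) :
    cm (bcm g h (simpson p)) V (oneSec p π V) = oneSec p f (g ⁻¹ᵁ V) := by
  have h1 := bcm_pullUnit g h (E := simpson p)
    ((biprod.inl : structureSheaf X ⟶ simpson p).app ⊤ (secO ⊤ 1))
  refine (cm_mres (U := π ⁻¹ᵁ ⊤) (bcm g h (simpson p)) le_top _).trans ?_
  rw [h1]
  exact mres_mres _ _ _

lemma mres_simpsonFrame_inl (f : T ⟶ X) (ω : Fin n → Γ(cotangent p, W)) (h : V ≤ f ⁻¹ᵁ W) :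
    mres h (cm (pullUnit f (simpson p)) W (simpsonFrame p ω (.inl ()))) = oneSec p f V := by
  have h1 : simpsonFrame p ω (.inl ()) = mres le_top
      ((biprod.inl : structureSheaf X ⟶ simpson p).app ⊤ (secO ⊤ 1)) := by
    refine Eq.trans ?_ (app_mres (biprod.inl : structureSheaf X ⟶ simpson p) _ _)
    rw [mres_secO, map_one]
    rfl
  rw [h1, cm_mres]
  exact mres_mres _ _ _

/-- The pulled back Simpson field kills the section `1`. -/
lemma pullback_simpsonField_inl (f : T ⟶ X) :
    ((simpsonField p).pullback f).app V (oneSec p f V) = 0 := by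
  refine (app_mres ((simpsonField p).pullback f) _ _).trans ?_
  refine (congrArg (mres _) (HiggsField.pullback_app (simpsonField p) f _)).trans ?_
  rw [simpsonField_inl, map_zero, map_zero]

/-- The pulled back Simpson field sends a form `ω` to `1 ⊗ ω`. -/
lemma pullback_simpsonField_inr (f : T ⟶ X) (ω : Fin n → Γ(cotangent p, W)) (h : V ≤ f ⁻¹ᵁ W)
    (l : Fin n) : ((simpsonField p).pullback f).app V
        (mres h (cm (pullUnit f (simpson p)) W (simpsonFrame p ω (.inr l)))) =
      tmulSection V (oneSec p f V) (mres h (cm (pullbackForms f p) W (ω l))) := by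
  refine (app_mres ((simpsonField p).pullback f) _ _).trans ?_
  refine (congrArg (mres _) (HiggsField.pullback_app (simpsonField p) f _)).trans ?_
  refine (congrArg (fun s => mres h (cm (tensorToPushforward f (pullUnit f _) (pullbackForms f p))
    W s))
    (simpsonField_inr (ω l))).trans ?_
  refine (congrArg (mres h) (tensorToPushforward_tmulSection f _ _ _ _)).trans ?_
  refine (mres_tmulSection h _ _).trans ?_
  rw [← mres_simpsonFrame_inl f ω h]
  rfl

variable (n) in
/-- Local data over which the obstruction on a Grassmann bundle of the Simpson system is computed:
a frame `ω` of the cotangent sheaf of the base, a frame of the bundle which is adapted to the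
tautological subbundle, and sections `η` which complete the pullback of `ω` to a frame of the
cotangent sheaf of the Grassmann bundle. -/
structure ObstructionChart (G : GrassmannBundle (simpson p) d) where
  V : G.total.Opens
  W : X.Opens
  le : V ≤ G.proj ⁻¹ᵁ W
  isAffineOpen : IsAffineOpen V
  ω : Fin n → Γ(cotangent p, W)
  isFrame_ω : IsFrame ω
  r : ℕ
  e : Fin d ⊕ Fin r → Γ((Scheme.Modules.pullback G.proj).obj (simpson p), V)
  isAdapted : G.sub.IsAdapted e
  s : ℕ
  η : Fin s → Γ(cotangent (G.proj ≫ p), V)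
  isFrame_η : IsFrame (Sum.elim (fun i => mres le (cm (pullbackForms G.proj p) W (ω i))) η)

lemma exists_obstructionChart (G : GrassmannBundle (simpson p) d) [SmoothOfRelativeDimension n p]
    [Smooth G.proj] (z : G.total) : ∃ c : ObstructionChart n G, z ∈ c.V := by
  obtain ⟨W, ω, V, hVW, s, η, hz, hω, hη⟩ := exists_isFrame_pullbackForms p n G.proj z
  obtain ⟨V', r, e, hz', he⟩ := G.isSub z
  obtain ⟨V₀, hV₀, hz₀, hle⟩ := exists_isAffineOpen_mem_and_subset (U := V ⊓ V') ⟨hz, hz'⟩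
  have h1 : V₀ ≤ V := le_trans (b := V ⊓ V') hle inf_le_left
  have h2 : V₀ ≤ V' := le_trans (b := V ⊓ V') hle inf_le_right
  refine ⟨⟨V₀, W, h1.trans hVW, hV₀, ω, hω, r, _, he.mres h2, s, fun k => mres h1 (η k), ?_⟩, hz₀⟩
  refine Eq.subst (motive := IsFrame) (funext fun i => ?_) (hη.mres h1)
  rcases i with i | k
  · exact mres_mres _ _ _
  · rfl

namespace ObstructionChart

variable {G : GrassmannBundle (simpson p) d} (c : ObstructionChart n G)

/-- The frame of the pullback of the Simpson system made up of `1` and of the forms `ω`. -/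
def frame (i : Unit ⊕ Fin n) : Γ((Scheme.Modules.pullback G.proj).obj (simpson p), c.V) :=
  mres c.le (cm (pullUnit G.proj (simpson p)) c.W (simpsonFrame p c.ω i))

lemma isFrame_frame : IsFrame c.frame :=
  (isBC_pullUnit G.proj _ _ _ _ (isFrame_simpsonFrame p c.isFrame_ω)).mres c.le

/-- The coordinates of the section `1` transversal to the tautological subbundle. -/
def y (k : Fin c.r) : Γ(G.total, c.V) :=
  c.isAdapted.isFrame.coord le_rfl (oneSec p G.proj c.V) (.inr k)

/-- The coordinates in `ω` of the frame of the tautological subbundle. -/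
def b (j : Fin d) (l : Fin n) : Γ(G.total, c.V) :=
  c.isFrame_frame.coord le_rfl (c.e (.inl j)) (.inr l)

lemma cokernel_inl (j : Fin d) : (cokernel.π G.incl).app c.V (c.e (.inl j)) = 0 := by
  obtain ⟨t, _, ht⟩ := c.isAdapted.exists_lift (i := G.incl)
  rw [← ht j]
  exact app_of_eq (cokernel.condition G.incl) _ _

/-- Modulo the tautological subbundle, `1` is the combination of the transversal frame with
coefficients `y`. -/
lemma cokernel_oneSec : (cokernel.π G.incl).app c.V (oneSec p G.proj c.V) =
    ∑ k, c.y k • (cokernel.π G.incl).app c.V (c.e (.inr k)) := by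
  rw [← c.isAdapted.isFrame.lc_coord le_rfl (oneSec p G.proj c.V), app_lc, lc,
    Fintype.sum_sum_type]
  simp only [c.cokernel_inl, mres_self, smul_zero, Finset.sum_const_zero, zero_add]
  rfl

/-- The obstruction maps the `j`-th member of the frame of the tautological subbundle to
`∑ b j l * y k • (e k ⊗ ω l)`. -/
lemma higgsObstruction_app (t : Γ(G.taut, c.V)) (j : Fin d) (ht : G.incl.app c.V t = c.e (.inl j)) :
    (higgsObstruction G (simpsonField p)).app c.V t =
      ∑ k, ∑ l, (c.b j l * c.y k) • tmulSection c.V ((cokernel.π G.incl).app c.V (c.e (.inr k)))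
        (mres c.le (cm (pullbackForms G.proj p) c.W (c.ω l))) := by
  change (tensorMap (cokernel.π G.incl) (𝟙 (cotangent (G.proj ≫ p)))).app c.V
    (((simpsonField p).pullback G.proj).app c.V (G.incl.app c.V t)) = _
  rw [ht, ← c.isFrame_frame.lc_coord le_rfl (c.e (.inl j)), app_lc, lc, Fintype.sum_sum_type]
  have h1 : ((simpsonField p).pullback G.proj).app c.V (c.frame (.inl ())) = 0 := by
    rw [frame, mres_simpsonFrame_inl]
    exact pullback_simpsonField_inl _
  have h2 : ∀ l, (tensorMap (cokernel.π G.incl) (𝟙 (cotangent (G.proj ≫ p)))).app c.V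
      (((simpsonField p).pullback G.proj).app c.V (c.frame (.inr l))) =
      ∑ k, c.y k • tmulSection c.V ((cokernel.π G.incl).app c.V (c.e (.inr k)))
        (mres c.le (cm (pullbackForms G.proj p) c.W (c.ω l))) := by
    intro l
    refine (congrArg _ (pullback_simpsonField_inr G.proj c.ω c.le l)).trans ?_
    refine (tensorMap_tmulSection (cokernel.π G.incl) _ _ _).trans ?_
    rw [cokernel_oneSec, map_sum, LinearMap.sum_apply]
    simp only [LinearMap.map_smul, LinearMap.smul_apply]
    rfl
  simp only [Finset.univ_unique, PUnit.default_eq_unit, Finset.sum_singleton, mres_self, h1,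
    smul_zero, zero_add, map_sum, app_smul, h2, Finset.smul_sum, smul_smul]
  rw [Finset.sum_comm]
  rfl

/-- The obstruction vanishes along `g : Z ⟶ Gr_d(E)` if and only if the products of the coordinates
`b` and `y` do: the sections `e k ⊗ ω l` are a part of a frame, as the forms `ω` pulled back to the
Grassmann bundle are. -/
lemma cm_higgsObstruction_eq_zero_iff {Z : Scheme.{0}} (g : Z ⟶ G.total) (t : Γ(G.taut, c.V))
    (j : Fin d) (ht : G.incl.app c.V t = c.e (.inl j)) :
    cm (pullUnit g _) c.V ((higgsObstruction G (simpsonField p)).app c.V t) = 0 ↔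
      ∀ k l, fres g c.V (c.b j l * c.y k) = 0 := by
  have hfr := isBC_pullUnit g _ _ _ _
    (isFrame_tensor (N := cotangent (G.proj ≫ p)) (c.isAdapted.isFrame_cokernel (i := G.incl))
      c.isFrame_η)
  rw [higgsObstruction_app c t j ht]
  -- the coordinates of the obstruction, which are zero at the forms `η`
  set F : Fin c.r × (Fin n ⊕ Fin c.s) → Γ(Z, g ⁻¹ᵁ c.V) := fun ik =>
    Sum.elim (fun l => fres g c.V (c.b j l * c.y ik.1)) 0 ik.2 with hF
  have h1 : cm (pullUnit g (tensor (cokernel G.incl) (cotangent (G.proj ≫ p)))) c.V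
      (∑ k, ∑ l, (c.b j l * c.y k) • tmulSection c.V ((cokernel.π G.incl).app c.V (c.e (.inr k)))
        (mres c.le (cm (pullbackForms G.proj p) c.W (c.ω l)))) = lc
          (fun ik : Fin c.r × (Fin n ⊕ Fin c.s) =>
      cm (pullUnit g (tensor (cokernel G.incl) (cotangent (G.proj ≫ p)))) c.V
        (tmulSection c.V ((cokernel.π G.incl).app c.V (c.e (.inr ik.1)))
          (Sum.elim (fun i => mres c.le (cm (pullbackForms G.proj p) c.W (c.ω i))) c.η ik.2)))
      le_rfl F := by
    rw [lc, Fintype.sum_prod_type, map_sum]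
    refine Finset.sum_congr rfl fun k _ => ?_
    rw [map_sum, Fintype.sum_sum_type]
    simp only [hF, Sum.elim_inl, Sum.elim_inr, Pi.zero_apply, zero_smul, Finset.sum_const_zero,
      add_zero, cm_smul, mres_self]
  rw [h1]
  constructor
  · intro h k l
    exact congrFun ((hfr _ le_rfl).1 (h.trans (lc_zero _ _).symm)) (k, .inl l)
  · intro h
    refine (congrArg (lc _ le_rfl) (funext fun ik => ?_)).trans (lc_zero _ _)
    rcases ik with ⟨k, l | l⟩
    · exact h k l
    · rfl

end ObstructionChart

end Obstruction

/-! ### Extensions by a section -/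

section Extension

variable {T : Scheme.{0}} {M Q : T.Modules} {U V W : T.Opens} {ι κ ι' κ' : Type} [Fintype ι]
    [Fintype κ]
  [Fintype ι'] [Fintype κ']

lemma SubMod.IsAdapted.reindex {S : SubMod M} {e : ι ⊕ κ → Γ(M, V)} (he : S.IsAdapted e)
    (σ : ι' ≃ ι) (τ : κ' ≃ κ) : S.IsAdapted (e ∘ σ.sumCongr τ) where
  isFrame := he.isFrame.reindex _
  mem_iff W h a := by
    have : lc (e ∘ σ.sumCongr τ) h a = lc e h (a ∘ (σ.sumCongr τ).symm) :=
      Fintype.sum_equiv (σ.sumCongr τ) _ _ (fun i => by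
        simp only [Function.comp]
        rw [Equiv.symm_apply_apply])
    rw [this, he.mem_iff]
    exact ⟨fun H k => by simpa using H (τ k), fun H k => H (τ.symm k)⟩

lemma SubMod.IsSub.of_exists {S : SubMod M} {d : ℕ}
    (h : ∀ x : T, ∃ (V : T.Opens) (ι κ : Type) (_ : Fintype ι) (_ : Fintype κ)
      (e : ι ⊕ κ → Γ(M, V)), x ∈ V ∧ Fintype.card ι = d ∧ S.IsAdapted e) : S.IsSub d := by
  intro x
  obtain ⟨V, ι, κ, _, _, e, hx, hd, he⟩ := h x
  exact ⟨V, Fintype.card κ, _, hx, he.reindex (Fintype.equivFinOfCardEq hd).symm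
    (Fintype.equivFin κ).symm⟩

/-- A frame whose first part lies in `S` and whose second part is that of a frame adapted to `S`
is adapted to `S`. -/
lemma SubMod.IsAdapted.of_inl_mem {S : SubMod M} {e : ι ⊕ κ → Γ(M, V)} (he : S.IsAdapted e)
    {e' : ι' ⊕ κ → Γ(M, V)} (he' : IsFrame e') (hl : ∀ i, e' (.inl i) ∈ S.carrier V)
    (hr : ∀ k, e' (.inr k) = e (.inr k)) : S.IsAdapted e' where
  isFrame := he'
  mem_iff W h a := by
    have h1 : lc (e' ∘ Sum.inl) h (a ∘ Sum.inl) ∈ S.carrier W :=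
      sum_mem fun i _ => Submodule.smul_mem _ _ (S.res_mem h (hl i))
    have h2 : lc (e' ∘ Sum.inr) h (a ∘ Sum.inr) = lc e h (Sum.elim 0 (a ∘ Sum.inr)) := by
      rw [lc_sumElim e]
      have : (Sum.elim 0 (a ∘ Sum.inr) : ι ⊕ κ → Γ(T, W)) ∘ Sum.inl = 0 := rfl
      rw [this, lc_zero, zero_add]
      exact congrArg (fun f => lc f h _) (funext hr)
    rw [lc_sumElim, Submodule.add_mem_iff_right _ h1, h2, he.mem_iff]
    rfl

/-- Replacing a member of a frame by a section whose coordinate there is invertible. -/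
lemma IsFrame.update [DecidableEq ι] {e : ι → Γ(M, V)} (he : IsFrame e) (i : ι) (s : Γ(M, V))
    (hs : IsUnit (he.coord le_rfl s i)) : IsFrame (Function.update e i s) := by
  let A : Matrix ι ι Γ(T, V) := (1 : Matrix ι ι Γ(T, V)).updateRow i (he.coord le_rfl s)
  have hA : A.det = he.coord le_rfl s i := by
    -- the determinant of the identity with one row replaced is a value of Cramer's map of the identity
    rw [← Matrix.cramer_transpose_apply, Matrix.transpose_one, Matrix.cramer_one]; rfl
  convert he.of_det A (hA ▸ hs) using 2 with k
  by_cases hk : k = i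
  · subst hk
    simp only [A, Function.update_self, Matrix.updateRow_self, he.lc_coord]
  · simp only [A, Function.update_of_ne hk, Matrix.updateRow_ne hk]
    have : (1 : Matrix ι ι Γ(T, V)) k = Pi.single k 1 := by
      ext j; simp [Matrix.one_apply, Pi.single_apply, eq_comm]
    rw [this, lc_single, one_smul, mres_self]

/-- `u : M ⟶ Q` is locally a split surjection of vector bundles whose kernel is freely generated
by the section `t`. -/
structure IsExtension (u : M ⟶ Q) (t : Γ(M, ⊤)) : Prop where
  app_eq_zero : u.app ⊤ t = 0
  exists_frame : ∀ x : T, ∃ (V : T.Opens) (r : ℕ) (e : Unit ⊕ Fin r → Γ(M, V)), x ∈ V ∧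
    IsFrame e ∧ e (.inl ()) = mres le_top t ∧ IsFrame (fun k => u.app V (e (.inr k)))

namespace IsExtension

variable {u : M ⟶ Q} {t : Γ(M, ⊤)}

lemma lc_unit_inl {e : Unit ⊕ ι → Γ(M, V)} (h : W ≤ V)
    (ht : e (.inl ()) = mres le_top t) (a : Unit ⊕ ι → Γ(T, W)) :
    lc e h a = a (.inl ()) • mres le_top t + lc (e ∘ Sum.inr) h (a ∘ Sum.inr) := by
  rw [lc_sumElim]
  congr 1
  simp [lc, ht, mres_mres]

lemma app_mres_eq_zero (hu : IsExtension u t) (V : T.Opens) : u.app V (mres le_top t) = 0 := by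
  rw [app_mres, hu.app_eq_zero, map_zero]

lemma app_lc_unit (hu : IsExtension u t) {e : Unit ⊕ ι → Γ(M, V)} (h : W ≤ V)
    (ht : e (.inl ()) = mres le_top t) (a : Unit ⊕ ι → Γ(T, W)) :
    u.app W (lc e h a) = lc (fun k => u.app V (e (.inr k))) h (a ∘ Sum.inr) := by
  rw [lc_unit_inl h ht, map_add, app_smul, hu.app_mres_eq_zero, smul_zero, zero_add, app_lc]
  rfl

lemma exists_lift (hu : IsExtension u t) (s : Γ(Q, W)) (x : T) (hx : x ∈ W) :
    ∃ (V : T.Opens) (h : V ≤ W) (s' : Γ(M, V)), x ∈ V ∧ u.app V s' = mres h s := by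
  obtain ⟨V, r, e, hxV, he, ht, hq⟩ := hu.exists_frame x
  refine ⟨W ⊓ V, inf_le_left, lc (e ∘ Sum.inr) inf_le_right
    (hq.coord inf_le_right (mres inf_le_left s)), ⟨hx, hxV⟩, ?_⟩
  rw [app_lc]
  exact hq.lc_coord _ _

/-- The kernel of `u` is locally spanned by `t`. -/
lemma exists_eq_smul (hu : IsExtension u t) (s : Γ(M, W)) (hs : u.app W s = 0) (x : T)
    (hx : x ∈ W) :
    ∃ (V : T.Opens) (h : V ≤ W) (a : Γ(T, V)), x ∈ V ∧ mres h s = a • mres le_top t := by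
  obtain ⟨V, r, e, hxV, he, ht, hq⟩ := hu.exists_frame x
  have h1 : W ⊓ V ≤ V := inf_le_right
  refine ⟨W ⊓ V, inf_le_left, he.coord h1 (mres inf_le_left s) (.inl ()), ⟨hx, hxV⟩, ?_⟩
  have h2 : u.app _ (mres (inf_le_left : W ⊓ V ≤ W) s) = 0 := by rw [app_mres, hs, map_zero]
  have h4 := he.lc_coord h1 (mres inf_le_left s)
  rw [← h4, hu.app_lc_unit h1 ht] at h2
  have h3 := (hq _ h1).1 (h2.trans (lc_zero _ h1).symm)
  rw [lc_unit_inl h1 ht, h3, lc_zero, add_zero] at h4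
  exact h4.symm

lemma eq_zero_of_smul (hu : IsExtension u t) (a : Γ(T, W)) (h : a • (mres le_top t : Γ(M, W)) = 0) :
    a = 0 := by
  refine eq_of_locally_ring fun x hx => ?_
  obtain ⟨V, r, e, hxV, he, ht, hq⟩ := hu.exists_frame x
  have h1 : W ⊓ V ≤ V := inf_le_right
  refine ⟨W ⊓ V, inf_le_left, ⟨hx, hxV⟩, ?_⟩
  have h2 : lc e h1 (Sum.elim (fun _ => rres inf_le_left a) 0) = lc e h1 0 := by
    rw [lc_unit_inl h1 ht, lc_zero]
    have := congrArg (mres (inf_le_left : W ⊓ V ≤ W)) h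
    rw [mres_smul, map_zero, mres_mres] at this
    exact (congrArg₂ (· + ·) this (lc_zero _ h1)).trans (zero_add 0)
  rw [map_zero]
  exact congrFun ((he _ h1).1 h2) (.inl ())

/-- Lifts of a frame of the quotient together with `t` are a frame. -/
lemma isFrame_lift (hu : IsExtension u t) {e : Unit ⊕ ι → Γ(M, V)}
    (ht : e (.inl ()) = mres le_top t)
    (he : IsFrame fun k => u.app V (e (.inr k))) : IsFrame e := by
  refine isFrame_of_locally ?_ ?_
  · intro W h a ha x hx
    have h1 := congrArg (u.app W) ha
    rw [hu.app_lc_unit h ht, map_zero] at h1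
    have h2 := (he W h).1 (h1.trans (lc_zero _ h).symm)
    rw [lc_unit_inl h ht, h2, lc_zero, add_zero] at ha
    have h3 := hu.eq_zero_of_smul _ ha
    refine ⟨W, le_rfl, hx, fun i => ?_⟩
    rw [rres_self]
    rcases i with i | i
    · exact h3
    · exact congrFun h2 i
  · intro W h s x hx
    have h1 : u.app W (s - lc e h (Sum.elim 0 (he.coord h (u.app W s)))) = 0 := by
      rw [map_sub, hu.app_lc_unit h ht]
      exact sub_eq_zero.2 (he.lc_coord h _).symm
    obtain ⟨V', hV', a, hx', ha⟩ := hu.exists_eq_smul _ h1 x hx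
    refine ⟨V', hV', fun i => Sum.elim (fun _ => a)
      (fun i => rres hV' (he.coord h (u.app W s) i)) i,
      hx', ?_⟩
    rw [map_sub, mres_lc, sub_eq_iff_eq_add] at ha
    rw [ha, lc_unit_inl (hV'.trans h) ht, lc_unit_inl (hV'.trans h) ht]
    simp only [Sum.elim_inl, Pi.zero_apply, map_zero, zero_smul, zero_add]
    rfl

/-- The part of a frame complementary to `t` maps to a frame of the quotient. -/
lemma isFrame_app (hu : IsExtension u t) {e : Unit ⊕ ι → Γ(M, V)} (ht : e (.inl ()) = mres le_top t)
    (he : IsFrame e) :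
    IsFrame fun k => u.app V (e (.inr k)) := by
  refine isFrame_of_locally ?_ ?_
  · intro W h a ha x hx
    have h1 : u.app W (lc e h (Sum.elim 0 a)) = 0 := by
      rw [hu.app_lc_unit h ht]; exact ha
    obtain ⟨V', hV', c, hx', hc⟩ := hu.exists_eq_smul _ h1 x hx
    have h2 : lc e (hV'.trans h) (Sum.elim (fun _ => c) 0) = c • mres le_top t := by
      rw [lc_unit_inl (hV'.trans h) ht]
      exact (congrArg (_ + ·) (lc_zero _ (hV'.trans h))).trans (add_zero _)
    rw [mres_lc, ← h2] at hc
    exact ⟨V', hV', hx', fun i => congrFun ((he _ (hV'.trans h)).1 hc) (.inr i)⟩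
  · intro W h s x hx
    obtain ⟨V', hV', s', hx', hs'⟩ := hu.exists_lift s x hx
    refine ⟨V', hV', fun k => he.coord (hV'.trans h) s' (.inr k), hx', ?_⟩
    rw [← hs', ← he.lc_coord (hV'.trans h) s', hu.app_lc_unit _ ht, he.lc_coord]
    rfl

end IsExtension

end Extension

/-! ### Subbundles which contain a given section -/

section Comap

variable {T : Scheme.{0}} {M Q : T.Modules} {U V W : T.Opens} {ι κ : Type} [Fintype ι] [Fintype κ]

/-- The preimage of a subsheaf. -/
def SubMod.comap (u : M ⟶ Q) (S : SubMod Q) : SubMod M where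
  carrier U :=
    { carrier := { s | u.app U s ∈ S.carrier U }
      zero_mem' := by simp
      add_mem' := fun {a b} ha hb => by
        change u.app U (a + b) ∈ S.carrier U
        rw [map_add]; exact add_mem ha hb
      smul_mem' := fun c a ha => by
        change u.app U (c • a) ∈ S.carrier U
        rw [app_smul]; exact Submodule.smul_mem _ _ ha }
  res_mem {_ V} h {s} hs := by
    change u.app V (mres h s) ∈ S.carrier V
    rw [app_mres]; exact S.res_mem h hs
  local_mem {U s} H := by
    refine S.local_mem fun x hx => ?_
    obtain ⟨V, h, hxV, hV⟩ := H x hx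
    exact ⟨V, h, hxV, app_mres u h s ▸ hV⟩

lemma SubMod.mem_comap {u : M ⟶ Q} {S : SubMod Q} {s : Γ(M, U)} :
    s ∈ (S.comap u).carrier U ↔ u.app U s ∈ S.carrier U := Iff.rfl

/-- The image of a subsheaf: the sections which locally lift to sections of it. -/
def SubMod.map (u : M ⟶ Q) (S : SubMod M) : SubMod Q where
  carrier U :=
    { carrier := { s | ∀ x ∈ U, ∃ (V : T.Opens) (h : V ≤ U), x ∈ V ∧
        ∃ s' ∈ S.carrier V, u.app V s' = mres h s }
      zero_mem' := fun x hx => ⟨U, le_rfl, hx, 0, zero_mem _, by simp⟩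
      add_mem' := fun {a b} ha hb x hx => by
        obtain ⟨V, h, hxV, s, hs, hs'⟩ := ha x hx
        obtain ⟨V', h', hxV', s₂, hs₂, hs₂'⟩ := hb x hx
        refine ⟨V ⊓ V', inf_le_left.trans h, ⟨hxV, hxV'⟩, mres inf_le_left s + mres inf_le_right s₂,
          add_mem (S.res_mem _ hs) (S.res_mem _ hs₂), ?_⟩
        rw [map_add, app_mres, app_mres, hs', hs₂', mres_mres, mres_mres, map_add]
      smul_mem' := fun c a ha x hx => by
        obtain ⟨V, h, hxV, s, hs, hs'⟩ := ha x hx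
        exact ⟨V, h, hxV, rres h c • s, Submodule.smul_mem _ _ hs, by
          rw [app_smul, hs', mres_smul]⟩ }
  res_mem {U V} h {s} hs x hx := by
    obtain ⟨V', h', hxV, s', hs', hs''⟩ := hs x (h hx)
    refine ⟨V ⊓ V', inf_le_left, ⟨hx, hxV⟩, mres inf_le_right s', S.res_mem _ hs', ?_⟩
    rw [app_mres, hs'', mres_mres, mres_mres]
  local_mem {U s} H x hx := by
    obtain ⟨V, h, hxV, hV⟩ := H x hx
    obtain ⟨V', h', hxV', s', hs', hs''⟩ := hV x hxV
    exact ⟨V', h'.trans h, hxV', s', hs', by rw [hs'', mres_mres]⟩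

namespace IsExtension

variable {u : M ⟶ Q} {t : Γ(M, ⊤)}

/-- The frame of an extension made up of `t` and `e`, with `t` in the first part. -/
def unitSum (t : Γ(M, ⊤)) (e : ι ⊕ κ → Γ(M, V)) : (Unit ⊕ ι) ⊕ κ → Γ(M, V) :=
  Sum.elim (Sum.elim (fun _ => mres le_top t) (e ∘ Sum.inl)) (e ∘ Sum.inr)

lemma isAdapted_comap (hu : IsExtension u t) {S : SubMod Q} {e : ι ⊕ κ → Γ(M, V)}
    (he : S.IsAdapted fun i => u.app V (e i)) : (S.comap u).IsAdapted (unitSum t e) := by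
  let e' : Unit ⊕ (ι ⊕ κ) → Γ(M, V) := Sum.elim (fun _ => mres le_top t) e
  have h1 : IsFrame e' := hu.isFrame_lift rfl he.isFrame
  have h2 : unitSum t e = e' ∘ (Equiv.sumAssoc Unit ι κ) := by
    funext i; rcases i with (i | i) | i <;> rfl
  refine ⟨h2 ▸ h1.reindex _, fun W h a => ?_⟩
  have h3 : lc (unitSum t e) h a = lc e' h (a ∘ (Equiv.sumAssoc Unit ι κ).symm) := by
    rw [h2]
    exact Fintype.sum_equiv (Equiv.sumAssoc Unit ι κ) _ _ (fun i => by
      simp only [Function.comp]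
      rw [Equiv.symm_apply_apply])
  rw [h3, SubMod.mem_comap, hu.app_lc_unit h rfl]
  exact he.mem_iff W h _

lemma isSub_comap (hu : IsExtension u t) {S : SubMod Q} {d : ℕ} (hS : S.IsSub d) :
    (S.comap u).IsSub (d + 1) := by
  refine SubMod.IsSub.of_exists fun x => ?_
  obtain ⟨V, r, e, hxV, he⟩ := hS x
  have H : ∀ i, ∃ (V' : T.Opens) (h : V' ≤ V) (s : Γ(M, V')), x ∈ V' ∧ u.app V' s = mres h (e i) :=
    fun i => hu.exists_lift (e i) x hxV
  choose V' h s hx hs using H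
  let V₀ : T.Opens := V ⊓ Finset.univ.inf V'
  have hV₀ : ∀ i, V₀ ≤ V' i := fun i => inf_le_right.trans (Finset.inf_le (Finset.mem_univ i))
  have hx₀ : x ∈ V₀ := by
    refine ⟨hxV, ?_⟩
    have : ∀ t : Finset (Fin d ⊕ Fin r), x ∈ t.inf V' := fun t => by
      classical
      induction t using Finset.induction_on with
      | empty => simp
      | insert a t _ ih => rw [Finset.inf_insert]; exact ⟨hx a, ih⟩
    exact this _
  refine ⟨V₀, _, _, inferInstance, inferInstance, unitSum t fun i => mres (hV₀ i) (s i), hx₀, ?_,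
    hu.isAdapted_comap ?_⟩
  · simp [add_comm]
  · refine Eq.subst (motive := S.IsAdapted) (funext fun i => ?_)
      (he.mres (inf_le_left : V₀ ≤ V))
    rw [app_mres, hs, mres_mres]

/-- Taking preimages is injective, since `u` is locally surjective. -/
lemma comap_injective (hu : IsExtension u t) {S S' : SubMod Q} (h : S.comap u = S'.comap u) :
    S = S' := by
  have main : ∀ {S S' : SubMod Q} (_ : S.comap u = S'.comap u) (U : T.Opens) (s : Γ(Q, U)),
      s ∈ S.carrier U → s ∈ S'.carrier U := by
    intro S S' h U s hs
    refine S'.local_mem fun x hx => ?_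
    obtain ⟨V, hV, s', hxV, hs'⟩ := hu.exists_lift s x hx
    have h1 : s' ∈ (S.comap u).carrier V := by
      rw [SubMod.mem_comap, hs']; exact S.res_mem _ hs
    rw [h, SubMod.mem_comap, hs'] at h1
    exact ⟨V, hV, hxV, h1⟩
  ext U s
  exact ⟨main h U s, main h.symm U s⟩

/-- Near every point, a subbundle which contains `t` has an adapted frame one of whose members is
`t`: `t` is nowhere zero, so it can be exchanged for a member of a given adapted frame. -/
lemma exists_isAdapted_unitSum (hu : IsExtension u t) {S : SubMod M} {d : ℕ} (hS : S.IsSub (d + 1))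
    (ht : t ∈ S.carrier ⊤) (x : T) : ∃ (V : T.Opens) (r : ℕ) (e : Fin d ⊕ Fin r → Γ(M, V)),
      x ∈ V ∧ S.IsAdapted (unitSum t e) := by
  classical
  obtain ⟨V₁, r, e₁, hx₁, he₁⟩ := hS x
  obtain ⟨V₂, r₂, f₂, hx₂, hf₂, hft₂, -⟩ := hu.exists_frame x
  let V := V₁ ⊓ V₂
  have hx : x ∈ V := ⟨hx₁, hx₂⟩
  have he := he₁.mres (inf_le_left : V ≤ V₁)
  have hf := hf₂.mres (inf_le_right : V ≤ V₂)
  set e : Fin (d + 1) ⊕ Fin r → Γ(M, V) := fun i => mres (inf_le_left : V ≤ V₁) (e₁ i)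
  set f : Unit ⊕ Fin r₂ → Γ(M, V) := fun i => mres (inf_le_right : V ≤ V₂) (f₂ i)
  have hft : f (.inl ()) = mres le_top t := by simp only [f, hft₂, mres_mres]
  set c := he.isFrame.coord le_rfl (mres le_top t)
  have hc : ∀ k, c (.inr k) = 0 := (he.mem_iff_coord le_rfl _).1 (S.res_mem _ ht)
  -- some coordinate of `t` in the adapted frame does not vanish at `x`
  have hsum : ∑ j, c (.inl j) * hf.coord le_rfl (e (.inl j)) (.inl ()) = 1 := by
    have h1 : f (.inl ()) = lc e le_rfl c := hft.trans (he.isFrame.lc_coord le_rfl _).symm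
    have h2 := hf.coord_self le_rfl (.inl ())
    rw [mres_self, h1, lc] at h2
    have h3 : ∀ (s : Finset (Fin (d + 1) ⊕ Fin r)), hf.coord le_rfl
      (∑ i ∈ s, c i • mres le_rfl (e i)) =
        ∑ i ∈ s, c i • hf.coord le_rfl (e i) := by
      intro s
      induction s using Finset.induction_on with
      | empty => rw [Finset.sum_empty, Finset.sum_empty, ← lc_zero f le_rfl, hf.coord_lc]
      | insert a s ha ih =>
        rw [Finset.sum_insert ha, Finset.sum_insert ha, hf.coord_add, ih, hf.coord_smul, mres_self]
    rw [h3] at h2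
    have h4 := congrFun h2 (.inl ())
    rw [Finset.sum_apply, Fintype.sum_sum_type] at h4
    simpa [hc] using h4
  obtain ⟨j, hj⟩ : ∃ j, x ∈ T.basicOpen (c (.inl j)) := by
    by_contra! H
    have h1 := congrArg (T.evaluation V x hx).hom hsum
    rw [map_sum, map_one] at h1
    refine zero_ne_one (h1.symm.trans ?_).symm
    refine Finset.sum_eq_zero fun j _ => ?_
    rw [map_mul]
    have := mt (T.evaluation_ne_zero_iff_mem_basicOpen x hx (c (.inl j))).1 (H j)
    rw [not_not] at this
    exact mul_eq_zero_of_left this _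
  let V' := T.basicOpen (c (.inl j))
  have hV' : V' ≤ V := T.basicOpen_le _
  have he' := he.mres hV'
  have hunit : IsUnit (he'.isFrame.coord le_rfl (mres le_top t) (.inl j)) := by
    have h1 : he'.isFrame.coord le_rfl (mres le_top t) = fun i => rres hV' (c i) := by
      apply (he'.isFrame _ le_rfl).1
      rw [he'.isFrame.lc_coord, lc_mres, ← mres_lc e le_rfl hV', he.isFrame.lc_coord, mres_mres]
    rw [h1]
    exact RingedSpace.isUnit_res_basicOpen _ _
  -- the `j`-th member of the adapted frame is replaced by `t`, and then moved to the front
  have hfr := he'.isFrame.update _ _ hunit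
  let σ : Unit ⊕ Fin d ≃ Fin (d + 1) := ((finSuccEquiv' j).trans
    ((Equiv.optionEquivSumPUnit _).trans (Equiv.sumComm _ _))).symm
  have hσ1 : σ (.inl ()) = j := by simp [σ]
  have hσ2 : ∀ i, σ (.inr i) = j.succAbove i := fun i => by simp [σ]
  have hA := (he'.of_inl_mem hfr (fun i => ?_) (fun k => ?_)).reindex σ (Equiv.refl _)
  · refine ⟨V', r, Sum.elim (fun i => mres hV' (e (.inl (j.succAbove i))))
      (fun k => mres hV' (e (.inr k))), hj, ?_⟩
    convert hA using 1
    funext i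
    rcases i with (i | i) | k
    · simp [unitSum, hσ1]
    · simp [unitSum, hσ2, Fin.succAbove_ne]
    · simp [unitSum]
  · by_cases hi : i = j
    · subst hi
      rw [Function.update_self]
      exact S.res_mem _ ht
    · rw [Function.update_of_ne (by simpa using hi)]
      exact he'.inl_mem i
  · rw [Function.update_of_ne (by simp)]

/-- If an adapted frame of `S` contains `t`, the others of its members map to a frame adapted to the
image. -/
lemma isAdapted_map (hu : IsExtension u t) {S : SubMod M} (ht : t ∈ S.carrier ⊤)
    {e : ι ⊕ κ → Γ(M, V)} (he : S.IsAdapted (unitSum t e)) :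
    (S.map u).IsAdapted fun i => u.app V (e i) := by
  let e' : Unit ⊕ (ι ⊕ κ) → Γ(M, V) := Sum.elim (fun _ => mres le_top t) e
  have h2 : e' = unitSum t e ∘ (Equiv.sumAssoc Unit ι κ).symm := by
    funext i; rcases i with i | i | i <;> rfl
  have hF : IsFrame e' := h2 ▸ he.isFrame.reindex _
  have hq : IsFrame fun i => u.app V (e i) := hu.isFrame_app (e := e') rfl hF
  have key : ∀ (W : T.Opens) (h : W ≤ V) (a : ι ⊕ κ → Γ(T, W)),
      lc e h a ∈ S.carrier W ↔ ∀ k, a (.inr k) = 0 := by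
    intro W h a
    have : lc e h a = lc (unitSum t e) h (Sum.elim (Sum.elim 0 (a ∘ Sum.inl)) (a ∘ Sum.inr)) := by
      simp [lc, unitSum]
    rw [this, he.mem_iff]
    rfl
  refine ⟨hq, fun W h a => ?_⟩
  rw [show lc (fun i => u.app V (e i)) h a = u.app W (lc e h a) from (app_lc u e h a).symm]
  constructor
  · intro hs k
    refine eq_of_locally_ring fun x hx => ?_
    obtain ⟨V₁, hV₁, hx₁, s', hs', hs''⟩ := hs x hx
    obtain ⟨V₂, hV₂, c, hx₂, hc⟩ := hu.exists_eq_smul (s' - mres hV₁ (lc e h a)) (by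
      rw [map_sub, hs'', app_mres, sub_self]) x hx₁
    refine ⟨V₂, hV₂.trans hV₁, hx₂, ?_⟩
    rw [map_zero]
    refine (key V₂ ((hV₂.trans hV₁).trans h) fun i => rres (hV₂.trans hV₁) (a i)).1 ?_ k
    rw [← mres_lc e h (hV₂.trans hV₁), ← mres_mres hV₁ hV₂]
    rw [map_sub, sub_eq_iff_eq_add, add_comm, ← sub_eq_iff_eq_add] at hc
    rw [← hc]
    exact sub_mem (S.res_mem _ hs') (Submodule.smul_mem _ _ (S.res_mem _ ht))
  · intro hk x hx
    exact ⟨W, le_rfl, hx, lc e h a, (key W h a).2 hk, (mres_self _).symm⟩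

lemma isSub_map (hu : IsExtension u t) {S : SubMod M} {d : ℕ} (hS : S.IsSub (d + 1))
    (ht : t ∈ S.carrier ⊤) : (S.map u).IsSub d := by
  intro x
  obtain ⟨V, r, e, hx, he⟩ := hu.exists_isAdapted_unitSum hS ht x
  exact ⟨V, r, _, hx, hu.isAdapted_map ht he⟩

/-- A subbundle which contains `t` is the preimage of its image. -/
lemma comap_map (hu : IsExtension u t) {S : SubMod M} {d : ℕ} (hS : S.IsSub (d + 1))
    (ht : t ∈ S.carrier ⊤) : (S.map u).comap u = S := by
  refine SubMod.eq_of_adapted fun x => ?_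
  obtain ⟨V, r, e, hx, he⟩ := hu.exists_isAdapted_unitSum hS ht x
  exact ⟨V, _, _, inferInstance, inferInstance, _, hx, hu.isAdapted_comap (hu.isAdapted_map ht he),
    he⟩

lemma mem_comap (hu : IsExtension u t) (S : SubMod Q) : t ∈ (S.comap u).carrier ⊤ := by
  rw [SubMod.mem_comap, hu.app_eq_zero]
  exact zero_mem _

end IsExtension

end Comap

/-! ### The cone map -/

section SimpsonExtension

variable {X T T' G K : Scheme.{0}} {p : X ⟶ Spec (.of ℂ)} {n d : ℕ}

/-- The pullback of the projection `𝒪 ⊕ Ω¹ ⟶ Ω¹`. -/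
abbrev pullSnd (p : X ⟶ Spec (.of ℂ)) (f : T ⟶ X) :
    (Scheme.Modules.pullback f).obj (simpson p) ⟶ (Scheme.Modules.pullback f).obj (cotangent p) :=
  (Scheme.Modules.pullback f).map biprod.snd

/-- The pullback of `𝒪 ⊕ Ω¹` is an extension of the pullback of `Ω¹` by the section `1`. -/
lemma isExtension_pullSnd (n : ℕ) [SmoothOfRelativeDimension n p] (f : T ⟶ X) :
    IsExtension (pullSnd p f) (oneSec p f ⊤) where
  app_eq_zero := by
    have h0 : (biprod.inl : structureSheaf X ⟶ simpson p) ≫ (biprod.snd : simpson p ⟶ cotangent p) =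
      0 :=
      biprod.inl_snd
    have h : (biprod.snd : simpson p ⟶ cotangent p).app ⊤
      ((biprod.inl : structureSheaf X ⟶ simpson p).app ⊤ (secO ⊤ 1)) = 0 := app_of_eq h0 ⊤ _
    have h1 := pullMap_app (f := f) (biprod.snd : simpson p ⟶ cotangent p)
      ((biprod.inl : structureSheaf X ⟶ simpson p).app ⊤ (secO ⊤ 1))
    have h2 := h1.trans ((congrArg (cm (pullUnit f (cotangent p)) ⊤) h).trans (map_zero _))
    exact (app_mres (pullSnd p f) _ _).trans ((congrArg (mres _) h2).trans (map_zero _))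
  exists_frame x := by
    obtain ⟨W, ω, hx, hω⟩ := exists_isFrame_cotangent p n (f x)
    refine ⟨f ⁻¹ᵁ W, n, fun i => cm (pullUnit f _) W (simpsonFrame p ω i), hx,
      isBC_pullUnit f _ _ _ _ (isFrame_simpsonFrame p hω), ?_, ?_⟩
    · exact (mres_self _).symm.trans
        ((mres_simpsonFrame_inl f ω le_rfl).trans (mres_oneSec _ _).symm)
    · have h0 : (biprod.inr : cotangent p ⟶ simpson p) ≫ (biprod.snd : simpson p ⟶ cotangent p) =
          𝟙 _ :=
        biprod.inr_snd
      refine Eq.subst (motive := IsFrame) (funext fun k => ?_) (isBC_pullUnit f _ _ _ _ hω)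
      refine Eq.trans ?_ (pullMap_app _ _).symm
      exact congrArg (cm (pullUnit f (cotangent p)) W) (app_of_eq h0 W (ω k)).symm

/-- Taking preimages in `𝒪 ⊕ Ω¹` is compatible with base change. -/
lemma bc_comap_pullSnd (n : ℕ) [SmoothOfRelativeDimension n p] {f : T ⟶ X} {f' : T' ⟶ X}
    (g : T' ⟶ T) (h : g ≫ f = f') {S : SubMod ((Scheme.Modules.pullback f).obj (cotangent p))}
    (hS : S.IsSub d) : (S.comap (pullSnd p f)).bc (bcm g h (simpson p)) =
      (S.bc (bcm g h (cotangent p))).comap (pullSnd p f') := by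
  have hu := isExtension_pullSnd (p := p) n f
  have hu' := isExtension_pullSnd (p := p) n f'
  refine SubMod.eq_of_adapted fun x => ?_
  obtain ⟨V, r, e, hx, he⟩ := hu.exists_isAdapted_unitSum (hu.isSub_comap hS) (hu.mem_comap S) (g x)
  have h1 : S.IsAdapted fun i => (pullSnd p f).app V (e i) := by
    have h2 := hu.isAdapted_map (hu.mem_comap S) he
    have h3 : (S.comap (pullSnd p f)).map (pullSnd p f) = S :=
      hu.comap_injective (hu.comap_map (hu.isSub_comap hS) (hu.mem_comap S))
    rwa [h3] at h2
  refine ⟨g ⁻¹ᵁ V, _, _, inferInstance, inferInstance, _, hx, he.bc (isBC_bcm g h _), ?_⟩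
  have h4 : S.bc (bcm g h (cotangent p)) |>.IsAdapted fun i =>
      (pullSnd p f').app (g ⁻¹ᵁ V) (cm (bcm g h (simpson p)) V (e i)) := by
    refine Eq.subst (motive := (S.bc (bcm g h (cotangent p))).IsAdapted) (funext fun i => ?_)
      (h1.bc (isBC_bcm g h _))
    exact bcm_naturality g h biprod.snd (e i)
  convert hu'.isAdapted_comap h4 using 1
  funext i
  rcases i with (i | i) | k
  · refine (cm_mres _ _ _).trans ?_
    simp only [IsExtension.unitSum, Sum.elim_inl]
    refine (congrArg (mres _) (cm_oneSec g h ⊤)).trans ?_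
    exact (mres_oneSec _ _).trans (mres_oneSec _ _).symm
  · rfl
  · rfl

variable {π : G ⟶ X} {q : K ⟶ X} {N : SubMod ((Scheme.Modules.pullback π).obj (simpson p))}
  {S : SubMod ((Scheme.Modules.pullback q).obj (cotangent p))} {j : K ⟶ G}

/-- `j` is the cone map from the Grassmann bundle of `Ω¹`, with universal subsheaf `S`, to that of
`𝒪 ⊕ Ω¹`, with universal subsheaf `N`, which is given by `F ↦ 𝒪 ⊕ F`. The subsheaf `𝒪 ⊕ F` is
expressed as the preimage of `F`. -/
structure IsConeMap (π : G ⟶ X) (q : K ⟶ X) (N : SubMod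
    ((Scheme.Modules.pullback π).obj (simpson p)))
    (S : SubMod ((Scheme.Modules.pullback q).obj (cotangent p))) (j : K ⟶ G) : Prop where
  comp_eq : j ≫ π = q
  bc_eq : N.bc (bcm j comp_eq (simpson p)) = S.comap (pullSnd p q)

lemma exists_isConeMap (n : ℕ) [SmoothOfRelativeDimension n p] (hN : IsUniversalSub π (d + 1) N)
    (hS : IsUniversalSub q d S) : ∃ j, IsConeMap π q N S j := by
  obtain ⟨j, ⟨h, hj⟩, -⟩ := hN.existsUnique q (S.comap (pullSnd p q))
    ((isExtension_pullSnd n q).isSub_comap hS.isSub)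
  exact ⟨j, h, hj⟩

namespace IsConeMap

/-- The cone map takes the family classified by `k` to its preimage in `𝒪 ⊕ Ω¹`. -/
lemma bc_comp (hj : IsConeMap π q N S j) (n : ℕ) [SmoothOfRelativeDimension n p]
    (hN : IsUniversalSub π (d + 1) N) (hS : IsUniversalSub q d S) {f : T ⟶ X} (k : T ⟶ K)
    (h : (k ≫ j) ≫ π = f) (h' : k ≫ q = f) : N.bc (bcm (k ≫ j) h (simpson p)) =
      (S.bc (bcm k h' (cotangent p))).comap (pullSnd p f) := by
  rw [← bc_comap_pullSnd n k h' hS.isSub, ← hj.bc_eq]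
  exact SubMod.bc_bcm_comp hN.isSub j hj.comp_eq k h' h

/-- The image of the cone map is the locus of subbundles which contain `𝒪`. -/
lemma exists_fac_iff (hj : IsConeMap π q N S j) (n : ℕ) [SmoothOfRelativeDimension n p]
    (hN : IsUniversalSub π (d + 1) N) (hS : IsUniversalSub q d S) {f : T ⟶ X} (g : T ⟶ G)
    (h : g ≫ π = f) : oneSec p f ⊤ ∈ (N.bc (bcm g h (simpson p))).carrier ⊤ ↔ ∃ k, k ≫ j = g := by
  have hu := isExtension_pullSnd (p := p) n f
  constructor
  · intro h1
    have h2 := hN.isSub.bc (isBC_bcm g h (simpson p))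
    obtain ⟨k, ⟨hk, hk'⟩, -⟩ := hS.existsUnique f _ (hu.isSub_map h2 h1)
    refine ⟨k, ?_⟩
    have h3 : (k ≫ j) ≫ π = f := by rw [Category.assoc, hj.comp_eq, hk]
    refine (hN.existsUnique f _ h2).unique ⟨h3, ?_⟩ ⟨h, rfl⟩
    rw [hj.bc_comp n hN hS k h3 hk, hk', hu.comap_map h2 h1]
  · rintro ⟨k, rfl⟩
    rw [hj.bc_comp n hN hS k h (by rw [← hj.comp_eq, ← Category.assoc, h])]
    exact hu.mem_comap _

lemma mono (hj : IsConeMap π q N S j) (n : ℕ) [SmoothOfRelativeDimension n p]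
    (hN : IsUniversalSub π (d + 1) N) (hS : IsUniversalSub q d S) : Mono j where
  right_cancellation {T} k k' hkk' := by
    have h1 : k ≫ q = k' ≫ q := by
      rw [← hj.comp_eq, ← Category.assoc, hkk', Category.assoc]
    have h2 : (k ≫ j) ≫ π = k ≫ q := by rw [Category.assoc, hj.comp_eq]
    have h3 : (k' ≫ j) ≫ π = k ≫ q := by rw [← hkk', h2]
    have h4 := hj.bc_comp n hN hS k h2 rfl
    have h5 := hj.bc_comp n hN hS k' h3 h1.symm
    have h6 : N.bc (bcm (k ≫ j) h2 (simpson p)) = N.bc (bcm (k' ≫ j) h3 (simpson p)) := by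
      have : ∀ g (_ : g = k' ≫ j) (h : g ≫ π = k ≫ q),
          N.bc (bcm g h (simpson p)) = N.bc (bcm (k' ≫ j) h3 (simpson p)) := by
        rintro _ rfl _; rfl
      exact this _ hkk' h2
    rw [h4, h5] at h6
    exact (hS.existsUnique _ _ (hS.isSub.bc (isBC_bcm k rfl _))).unique ⟨rfl, rfl⟩
      ⟨h1.symm, ((isExtension_pullSnd n _).comap_injective h6).symm⟩

end IsConeMap

end SimpsonExtension

/-! ### Monomorphisms which represent the vanishing of an ideal -/

section LocallyClosed

variable {K G : Scheme.{0}}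

lemma top_le_SpecMap_fromSpec {V : G.Opens} (hV : IsAffineOpen V) {R : CommRingCat.{0}}
    (φ : Γ(G, V) ⟶ R) : ⊤ ≤ (Spec.map φ ≫ hV.fromSpec) ⁻¹ᵁ V := by
  rw [Scheme.Hom.comp_preimage, hV.fromSpec_preimage_self]
  exact le_rfl

lemma appLE_SpecMap_fromSpec {V : G.Opens} (hV : IsAffineOpen V) {R : CommRingCat.{0}}
    (φ : Γ(G, V) ⟶ R) (h : ⊤ ≤ (Spec.map φ ≫ hV.fromSpec) ⁻¹ᵁ V) :
    (Spec.map φ ≫ hV.fromSpec).appLE V ⊤ h = φ ≫ (Scheme.ΓSpecIso R).inv := by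
  have h1 : ⊤ ≤ hV.fromSpec ⁻¹ᵁ V := by rw [hV.fromSpec_preimage_self]
  have h2 : hV.fromSpec.appLE V ⊤ h1 = (Scheme.ΓSpecIso Γ(G, V)).inv := by
    rw [Scheme.Hom.appLE, hV.fromSpec_app_self, Category.assoc, ← Functor.map_comp]
    exact (congrArg _ ((Spec Γ(G, V)).presheaf.map_id _)).trans (Category.comp_id _)
  have h3 : (Spec.map φ).appLE ⊤ ⊤ le_top = (Spec.map φ).appTop := by
    simp [Scheme.Hom.appLE]
    exact Category.comp_id _
  rw [← Scheme.Hom.appLE_comp_appLE (Spec.map φ) hV.fromSpec V ⊤ ⊤ h1 le_top, h2, h3,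
    Scheme.ΓSpecIso_inv_naturality]

lemma fres_eq_zero_iff_appLE {T : Scheme.{0}} (g : T ⟶ G) {V : G.Opens} (h : ⊤ ≤ g ⁻¹ᵁ V)
    (s : Γ(G, V)) : fres g V s = 0 ↔ (g.appLE V ⊤ h).hom s = 0 := by
  have h1 : g ⁻¹ᵁ V = ⊤ := top_le_iff.1 h
  have h2 : g.appLE V ⊤ h = g.app V ≫ T.presheaf.map (homOfLE h).op := rfl
  have : IsIso (homOfLE h) := ⟨homOfLE h1.le, rfl, rfl⟩
  have h3 : Function.Injective (T.presheaf.map (homOfLE h).op).hom :=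
    (ConcreteCategory.bijective_of_isIso (T.presheaf.map (homOfLE h).op)).1
  rw [h2]
  exact (map_eq_zero_iff _ h3).symm

variable {j : K ⟶ G} {V : G.Opens} {I : Ideal Γ(G, V)}

/-- If, over the affine open `V`, the morphism `j` represents the vanishing of the ideal `I`, then
the closed subscheme of `V` defined by `I` factors through `j`. -/
lemma exists_quotient_fac (hV : IsAffineOpen V) (H : ∀ {T : Scheme.{0}} (g : T ⟶ G), ⊤ ≤ g ⁻¹ᵁ V →
      ((∃ k, k ≫ j = g) ↔ ∀ s ∈ I, fres g V s = 0)) :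
    ∃ k : Spec (.of (Γ(G, V) ⧸ I)) ⟶ K,
      k ≫ j = Spec.map (CommRingCat.ofHom (Ideal.Quotient.mk I)) ≫ hV.fromSpec := by
  refine (H _ (top_le_SpecMap_fromSpec hV _)).2 fun s hs => ?_
  rw [fres_eq_zero_iff_appLE _ (top_le_SpecMap_fromSpec hV _), appLE_SpecMap_fromSpec]
  have : Ideal.Quotient.mk I s = 0 := Ideal.Quotient.eq_zero_iff_mem.2 hs
  exact (congrArg (Scheme.ΓSpecIso _).inv.hom this).trans (map_zero _)

/-- If, over the affine open `V`, the monomorphism `j` represents the vanishing of an ideal, then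
`j⁻¹ V` is the image of the closed subscheme of `V` defined by that ideal, hence compact. -/
lemma isCompact_preimage_of_fac [Mono j] (hV : IsAffineOpen V)
    (H : ∀ {T : Scheme.{0}} (g : T ⟶ G), ⊤ ≤ g ⁻¹ᵁ V →
      ((∃ k, k ≫ j = g) ↔ ∀ s ∈ I, fres g V s = 0)) :
    IsCompact (j ⁻¹ᵁ V : Set K) := by
  obtain ⟨k, hk⟩ := exists_quotient_fac hV H
  let W := j ⁻¹ᵁ V
  have hW : ⊤ ≤ (W.ι ≫ j) ⁻¹ᵁ V := by
    rw [Scheme.Hom.comp_preimage]; exact (Scheme.Opens.ι_preimage_self W).ge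
  have h1 := (H (W.ι ≫ j) hW).1 ⟨_, rfl⟩
  let m₀ : (W : Scheme.{0}) ⟶ Spec Γ(G, V) := W.toSpecΓ ≫ Spec.map (j.app V)
  have hm₀ : m₀ ≫ hV.fromSpec = W.ι ≫ j := by simp [m₀, W]
  have h2 : I ≤ RingHom.ker ((Scheme.ΓSpecIso Γ(G, V)).inv ≫ m₀.appTop).hom := by
    intro s hs
    have h3 := h1 s hs
    rw [fres_eq_zero_iff_appLE _ hW] at h3
    have h4 : ⊤ ≤ hV.fromSpec ⁻¹ᵁ V := by rw [hV.fromSpec_preimage_self]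
    have h5 : hV.fromSpec.appLE V ⊤ h4 = (Scheme.ΓSpecIso Γ(G, V)).inv := by
      have := appLE_SpecMap_fromSpec hV (𝟙 Γ(G, V)) (by simp)
      simpa using this
    have h6 : (W.ι ≫ j).appLE V ⊤ hW = (Scheme.ΓSpecIso Γ(G, V)).inv ≫ m₀.appTop := by
      have h7 := Scheme.Hom.appLE_comp_appLE m₀ hV.fromSpec V ⊤ ⊤ h4 le_top
      rw [h5] at h7
      have h8 : m₀.appLE ⊤ ⊤ le_top = m₀.appTop := by
        simp [Scheme.Hom.appLE]
        exact Category.comp_id _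
      rw [h8] at h7
      rw [h7]
      simp only [hm₀]
    rw [h6] at h3
    exact h3
  -- `j⁻¹ V ⟶ V` factors through the closed subscheme defined by `I`, so its range lies in that of `k`
  let m := m₀.liftQuotient I h2
  have hm : m ≫ k = W.ι := by
    rw [← cancel_mono j, Category.assoc, hk, Scheme.Hom.liftQuotient_comp_assoc, hm₀]
  have h9 : (j ⁻¹ᵁ V : Set K) = Set.range k := by
    apply Set.Subset.antisymm
    · intro z hz
      exact ⟨m (⟨z, hz⟩ : W), congr($hm (⟨z, hz⟩ : W))⟩
    · rintro _ ⟨z, rfl⟩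
      have h10 : z ∈ (k ≫ j) ⁻¹ᵁ V := by
        rw [hk]; exact top_le_SpecMap_fromSpec hV _ trivial
      exact h10
  rw [h9]
  exact isCompact_range k.continuous

/-- If, over the affine open `V`, the morphism `j` represents the vanishing of the ideal `I`, then
`I` is the ideal of functions on `V` whose pullback along `j` is zero. -/
lemma ker_eq_of_fac (hV : IsAffineOpen V) (H : ∀ {T : Scheme.{0}} (g : T ⟶ G), ⊤ ≤ g ⁻¹ᵁ V →
      ((∃ k, k ≫ j = g) ↔ ∀ s ∈ I, fres g V s = 0)) :
    RingHom.ker (j.app V).hom = I := by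
  apply le_antisymm
  · intro s hs
    obtain ⟨k, hk⟩ := exists_quotient_fac hV H
    have h1 : fres (k ≫ j) V s = 0 := by
      change fres k (j ⁻¹ᵁ V) (fres j V s) = 0
      rw [show fres j V s = 0 from hs, map_zero]
    rw [hk, fres_eq_zero_iff_appLE _ (top_le_SpecMap_fromSpec hV _), appLE_SpecMap_fromSpec] at h1
    rw [← Ideal.Quotient.eq_zero_iff_mem]
    exact (map_eq_zero_iff _ (ConcreteCategory.bijective_of_isIso (Scheme.ΓSpecIso _).inv).1).1 h1
  · intro s hs
    let W := j ⁻¹ᵁ V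
    have hW : ⊤ ≤ (W.ι ≫ j) ⁻¹ᵁ V := by
      rw [Scheme.Hom.comp_preimage]; exact (Scheme.Opens.ι_preimage_self W).ge
    have h1 := (H (W.ι ≫ j) hW).1 ⟨_, rfl⟩ s hs
    have h2 : Function.Injective (fres W.ι W) :=
      (fres_bijective (f := W.ι) (U := W) (by simp)).1
    exact (map_eq_zero_iff _ h2).1 h1

end LocallyClosed

/-! ### Vanishing of the obstruction -/

section Vanishing

variable {X T G K Z : Scheme.{0}} {p : X ⟶ Spec (.of ℂ)} {n d : ℕ}

/-- The pullback of a morphism vanishes if it kills the pullbacks of frames. -/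
lemma pullMap_eq_zero {A B : G.Modules} (ψ : A ⟶ B) (g : Z ⟶ G)
    (h : ∀ z : Z, ∃ (V : G.Opens) (ι : Type) (_ : Fintype ι) (e : ι → Γ(A, V)),
      g z ∈ V ∧ IsFrame e ∧
      ∀ i, cm (pullUnit g B) V (ψ.app V (e i)) = 0) : (Scheme.Modules.pullback g).map ψ = 0 := by
  refine pull_hom_ext fun U s => ?_
  rw [pullMap_app]
  refine Eq.trans (b := 0) ?_ rfl
  refine eq_of_locally fun z hz => ?_
  obtain ⟨V, ι, _, e, hzV, he, h0⟩ := h z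
  have hle : g ⁻¹ᵁ (U ⊓ V) ≤ g ⁻¹ᵁ U := Scheme.Hom.preimage_mono g inf_le_left
  refine ⟨g ⁻¹ᵁ (U ⊓ V), hle, ⟨hz, hzV⟩, ?_⟩
  have h1 : V ⊓ U ≤ V := inf_le_left
  rw [map_zero]
  have h2 := cm_mres (pullUnit g B) (inf_le_left : U ⊓ V ≤ U) (ψ.app U s)
  rw [← app_mres, ← he.lc_coord inf_le_right (mres inf_le_left s), app_lc, cm_lc] at h2
  refine h2.symm.trans ?_
  simp [lc, h0]

/-- Let `a, b` be the coordinates with respect to `1, ω` of a member `s` of the frame of the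
tautological subbundle. Let `x` and `u` be the coordinates of `1` and `ω` along `s`, and `y'` and
`v` those along a member of the transversal frame: then `h1` and `h2` say that `s` has coordinates
`1` and `0` there. If the products `b l * y` are in `I`, where `y` is another transversal coordinate
of `1`, then so is `y * y'`. -/
lemma mul_mem_of_mul_mem {R : Type} [CommRing R] (I : Ideal R) (a x y y' : R) (b u v : Fin n → R)
    (h1 : a * x + ∑ l, b l * u l = 1) (h2 : a * y' + ∑ l, b l * v l = 0)
    (h : ∀ l, b l * y ∈ I) : y * y' ∈ I := by
  have h3 : y * y' = (∑ l, (b l * y) * (u l * y')) - ∑ l, (b l * y) * (x * v l) := by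
    have e1 : ∑ l, (b l * y) * (u l * y') = y * y' * ∑ l, b l * u l := by
      rw [Finset.mul_sum]; exact Finset.sum_congr rfl fun l _ => by ring
    have e2 : ∑ l, (b l * y) * (x * v l) = x * y * ∑ l, b l * v l := by
      rw [Finset.mul_sum]; exact Finset.sum_congr rfl fun l _ => by ring
    rw [e1, e2]
    linear_combination (-(y * y')) * h1 + x * y * h2
  rw [h3]
  exact sub_mem (sum_mem fun l _ => I.mul_mem_right _ (h l))
    (sum_mem fun l _ => I.mul_mem_right _ (h l))

lemma IsFrame.coord_lc_family {M : G.Modules} {V W : G.Opens} {ι κ : Type} [Fintype ι] [Fintype κ]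
    {e : ι → Γ(M, V)} (he : IsFrame e) (h : W ≤ V) (f : κ → Γ(M, W)) (a : κ → Γ(G, W)) (i : ι) :
    he.coord h (lc f le_rfl a) i = ∑ k, a k * he.coord h (f k) i := by
  have h1 : lc f le_rfl a = lc e h (fun i => ∑ k, a k * he.coord h (f k) i) := by
    have : f = fun k => lc (fun i => HiggsGrass.mres h (e i)) le_rfl (he.coord h (f k)) := by
      funext k; rw [lc_mres, he.lc_coord]
    conv_lhs => rw [this]
    rw [lc_matrix, lc_mres]
    simp only [rres_self]
  rw [h1, he.coord_lc]

lemma IsFrame.coord_cm {M : G.Modules} {P : T.Modules} {g : T ⟶ G}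
    {α : M ⟶ (Scheme.Modules.pushforward g).obj P} (hα : IsBC α) {V : G.Opens} {ι : Type}
      [Fintype ι]
    {e : ι → Γ(M, V)} (he : IsFrame e) (s : Γ(M, V)) :
    (hα V ι e he).coord le_rfl (cm α V s) = fun i => fres g V (he.coord le_rfl s i) := by
  conv_lhs => rw [← he.lc_coord le_rfl s, cm_lc]
  exact (hα V ι e he).coord_lc le_rfl _

namespace ObstructionChart

variable {G : GrassmannBundle (simpson p) d} (c : ObstructionChart n G)

/-- The vanishing of the obstruction forces the products of the transversal coordinates of `1` to
vanish. It is enough to consider a single member of the frame of the tautological subbundle. -/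
lemma y_mul_y_mem (I : Ideal Γ(G.total, c.V)) (j : Fin d) (h : ∀ k l, c.b j l * c.y k ∈ I)
    (k k' : Fin c.r) : c.y k * c.y k' ∈ I := by
  classical
  have h1 : c.e (.inl j) = lc c.frame le_rfl (c.isFrame_frame.coord le_rfl (c.e (.inl j))) :=
    (c.isFrame_frame.lc_coord _ _).symm
  have h2 := c.isAdapted.isFrame.coord_self le_rfl (.inl j)
  rw [mres_self, h1] at h2
  have h3 : ∀ i, c.isAdapted.isFrame.coord le_rfl (c.e (.inl j)) i =
      c.isFrame_frame.coord le_rfl (c.e (.inl j)) (.inl ()) *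
        c.isAdapted.isFrame.coord le_rfl (oneSec p G.proj c.V) i +
      ∑ l, c.b j l * c.isAdapted.isFrame.coord le_rfl (c.frame (.inr l)) i := by
    intro i
    conv_lhs => rw [h1]
    rw [c.isAdapted.isFrame.coord_lc_family, Fintype.sum_sum_type]
    simp only [Finset.univ_unique, PUnit.default_eq_unit, Finset.sum_singleton]
    rw [show c.frame (.inl ()) = oneSec p G.proj c.V from mres_simpsonFrame_inl _ _ _]
    rfl
  rw [← h1] at h2
  have h4 := h3 (.inl j)
  have h5 := h3 (.inr k')
  rw [h2] at h4 h5
  rw [Pi.single_eq_same] at h4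
  rw [Pi.single_eq_of_ne (by simp)] at h5
  exact mul_mem_of_mul_mem I _ _ _ _ _ _ _ h4.symm h5.symm (h k)

/-- In a chart, the subbundle classified by `g` contains `1` if and only if the functions `y` vanish
along `g`. -/
lemma oneSec_mem_iff {f : T ⟶ X} (g : T ⟶ G.total) (h : g ≫ G.proj = f) :
    oneSec p f (g ⁻¹ᵁ c.V) ∈ (G.sub.bc (bcm g h (simpson p))).carrier (g ⁻¹ᵁ c.V) ↔
      ∀ k, fres g c.V (c.y k) = 0 := by
  rw [(c.isAdapted.bc (isBC_bcm g h _)).mem_iff_coord le_rfl, ← cm_oneSec g h]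
  refine forall_congr' fun k => ?_
  rw [IsFrame.coord_cm (isBC_bcm g h _) c.isAdapted.isFrame]
  rfl

end ObstructionChart

end Vanishing

/-! ### Smooth schemes over a field are reduced -/

section Reduced

open TensorProduct Polynomial

/-- A smooth algebra `R` over a field `k` is reduced: if `s` is nilpotent, `s ⊗ X` is integral over
`R`, hence comes from the integral closure of `k` in `k[X]`, which consists of constants. -/
lemma isReduced_of_smooth_field (k R : Type) [Field k] [CommRing R] [Algebra k R]
    [Algebra.Smooth k R] :
    IsReduced R where
  eq_zero s hs := by
    have h1 : IsIntegral R (s ⊗ₜ[k] (X : k[X])) := by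
      obtain ⟨m, hm⟩ := hs
      refine IsIntegral.of_pow m.succ_pos ?_
      rw [Algebra.TensorProduct.tmul_pow, pow_succ, hm, zero_mul, zero_tmul]
      exact isIntegral_zero
    obtain ⟨z, hz⟩ := TensorProduct.toIntegralClosure_bijective_of_smooth.2
      (⟨_, h1⟩ : integralClosure R (R ⊗[k] k[X]))
    -- extraction of the coefficient of `X` kills the constants and maps `s ⊗ X` to `s ⊗ 1`
    let φ : R ⊗[k] k[X] →ₗ[k] R ⊗[k] k := LinearMap.lTensor R (lcoeff k 1)
    have h3 : ∀ z, φ (TensorProduct.toIntegralClosure k R k[X] z) = 0 := by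
      intro z
      induction z with
      | zero => simp
      | add x y hx hy => rw [map_add, Subalgebra.coe_add, map_add, hx, hy, add_zero]
      | tmul x y =>
        have h4 : y.1.coeff 1 = 0 := by
          by_contra h5
          have h6 : y.1.natDegree ≠ 0 := fun h7 => h5 (coeff_eq_zero_of_natDegree_lt (by omega))
          refine y.1.transcendental h6 ?_ y.2.isAlgebraic
          exact mem_nonZeroDivisors_of_ne_zero (leadingCoeff_ne_zero.2 fun h => h6 (by simp [h]))
        change x ⊗ₜ[k] (y.1.coeff 1) = 0
        rw [h4, tmul_zero]
    have h8 := h3 z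
    rw [hz] at h8
    have h9 : s ⊗ₜ[k] (1 : k) = 0 := by simpa [φ] using h8
    simpa using congrArg (TensorProduct.rid k R) h9

lemma isReduced_of_smooth {K : Scheme.{0}} (q : K ⟶ Spec (.of ℂ)) [Smooth q] : IsReduced K := by
  refine ⟨fun U => ⟨fun s hs => eq_of_locally_ring fun x hx => ?_⟩⟩
  obtain ⟨V, hV, hxV, hVU⟩ := exists_isAffineOpen_mem_and_subset hx
  have : _root_.IsReduced Γ(K, V) := by
    let := algSections q V
    have : Algebra.Smooth ℂ Γ(K, V) :=
      RingHom.Smooth.respectsIso.2 _ (Scheme.ΓSpecIso (.of ℂ)).symm.commRingCatIsoToRingEquiv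
        (q.smooth_appLE (isAffineOpen_top _) hV (le_top (a := V)))
    exact isReduced_of_smooth_field ℂ _
  refine ⟨V, hVU, hxV, ?_⟩
  rw [map_zero]
  exact (hs.map (rres hVU)).eq_zero

end Reduced

/-! ### Isomorphisms of Grassmann bundles -/

section Uniqueness

variable {X G G' : Scheme.{0}} {E E' : X.Modules} {π : G ⟶ X} {π' : G' ⟶ X} {d d' : ℕ}
  {N : SubMod ((Scheme.Modules.pullback π).obj E)} {N' : SubMod
    ((Scheme.Modules.pullback π').obj E')}

/-- A bijection, compatible with base change, between the subbundles of rank `d` of `E` and those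
of rank `d'` of `E'` gives an isomorphism of Grassmann bundles. -/
lemma IsUniversalSub.nonempty_iso_of_bijection (hN : IsUniversalSub π d N)
    (hN' : IsUniversalSub π' d' N')
    (Φ : ∀ {T : Scheme.{0}} (f : T ⟶ X), SubMod ((Scheme.Modules.pullback f).obj E) →
      SubMod ((Scheme.Modules.pullback f).obj E'))
    (Ψ : ∀ {T : Scheme.{0}} (f : T ⟶ X), SubMod ((Scheme.Modules.pullback f).obj E') →
      SubMod ((Scheme.Modules.pullback f).obj E))
    (hΦ : ∀ {T : Scheme.{0}} (f : T ⟶ X) S, S.IsSub d → (Φ f S).IsSub d')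
    (hΨ : ∀ {T : Scheme.{0}} (f : T ⟶ X) S, S.IsSub d' → (Ψ f S).IsSub d)
    (hΨΦ : ∀ {T : Scheme.{0}} (f : T ⟶ X) S, S.IsSub d → Ψ f (Φ f S) = S)
    (hΦΨ : ∀ {T : Scheme.{0}} (f : T ⟶ X) S, S.IsSub d' → Φ f (Ψ f S) = S)
    (bcΦ : ∀ {T T' : Scheme.{0}} {f : T ⟶ X} {f' : T' ⟶ X} (g : T' ⟶ T) (h : g ≫ f = f') S,
      S.IsSub d → Φ f' (S.bc (bcm g h E)) = (Φ f S).bc (bcm g h E'))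
    (bcΨ : ∀ {T T' : Scheme.{0}} {f : T ⟶ X} {f' : T' ⟶ X} (g : T' ⟶ T) (h : g ≫ f = f') S,
      S.IsSub d' → Ψ f' (S.bc (bcm g h E')) = (Ψ f S).bc (bcm g h E)) :
    Nonempty (Over.mk π ≅ Over.mk π') := by
  obtain ⟨g, ⟨hg, hgN⟩, -⟩ := hN'.existsUnique π (Φ π N) (hΦ _ _ hN.isSub)
  obtain ⟨g', ⟨hg', hgN'⟩, -⟩ := hN.existsUnique π' (Ψ π' N') (hΨ _ _ hN'.isSub)
  have h1 : g ≫ g' = 𝟙 G := by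
    refine (hN.existsUnique π N hN.isSub).unique ⟨by rw [Category.assoc, hg', hg], ?_⟩
      ⟨Category.id_comp _, SubMod.bc_bcm_id hN.isSub _⟩
    rw [SubMod.bc_bcm_comp hN.isSub g' hg' g hg, hgN', ← bcΨ g hg _ hN'.isSub, hgN,
      hΨΦ _ _ hN.isSub]
  have h2 : g' ≫ g = 𝟙 G' := by
    refine (hN'.existsUnique π' N' hN'.isSub).unique ⟨by rw [Category.assoc, hg, hg'], ?_⟩
      ⟨Category.id_comp _, SubMod.bc_bcm_id hN'.isSub _⟩
    rw [SubMod.bc_bcm_comp hN'.isSub g hg g' hg', hgN, ← bcΦ g' hg' _ hN.isSub, hgN',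
      hΦΨ _ _ hN'.isSub]
  exact ⟨Over.isoMk ⟨g, g', h1, h2⟩ hg⟩

/-- All Grassmann bundles are smooth, as they are isomorphic to the one obtained from charts. -/
lemma IsUniversalSub.smooth (hE : IsVectorBundle E) (hN : IsUniversalSub π d N) : Smooth π := by
  obtain ⟨G', π', N', hN', h⟩ := exists_isUniversalSub d hE
  obtain ⟨e⟩ := hN.nonempty_iso_of_bijection hN' (fun _ => id) (fun _ => id) (fun _ _ => id)
    (fun _ _ => id) (fun _ _ _ => rfl) (fun _ _ _ => rfl) (fun _ _ _ _ => rfl) (fun _ _ _ _ => rfl)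
  have h1 : ∃ i : G ⟶ G', IsIso i ∧ i ≫ π' = π :=
    ⟨e.hom.left, inferInstanceAs (IsIso ((Over.forget X).map e.hom)), Over.w e.hom⟩
  obtain ⟨i, _, rfl⟩ := h1
  infer_instance

end Uniqueness

/-! ### The ideal of the Higgs Grassmannian -/

section HiggsIdeal

variable {X T K : Scheme.{0}} {p : X ⟶ Spec (.of ℂ)} {n d : ℕ}
    {G : GrassmannBundle (simpson p) (d + 1)}
  {q : K ⟶ X} {S : SubMod ((Scheme.Modules.pullback q).obj (cotangent p))} {j : K ⟶ G.total}

namespace IsConeMap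

/-- In a chart, the cone map represents the vanishing of the functions `y`. -/
lemma exists_fac_iff_chart (n : ℕ) [SmoothOfRelativeDimension n p]
    (hj : IsConeMap G.proj q G.sub S j)
    (hS : IsUniversalSub q d S) (c : ObstructionChart n G) (g : T ⟶ G.total) (hg : ⊤ ≤ g ⁻¹ᵁ c.V) :
    (∃ k, k ≫ j = g) ↔ ∀ s ∈ Ideal.span (Set.range c.y), fres g c.V s = 0 := by
  rw [← hj.exists_fac_iff n G.isUniversalSub hS g rfl]
  have h1 : oneSec p (g ≫ G.proj) ⊤ ∈ (G.sub.bc (bcm g rfl (simpson p))).carrier ⊤ ↔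
      oneSec p (g ≫ G.proj) (g ⁻¹ᵁ c.V) ∈
        (G.sub.bc (bcm g rfl (simpson p))).carrier (g ⁻¹ᵁ c.V) := by
    constructor
    · intro h
      rw [← mres_oneSec (U := ⊤) _ le_top]
      exact SubMod.res_mem _ _ h
    · intro h
      rw [← mres_oneSec (U := g ⁻¹ᵁ c.V) _ hg]
      exact SubMod.res_mem _ _ h
  rw [h1, c.oneSec_mem_iff g rfl]
  have h2 : (∀ s ∈ Ideal.span (Set.range c.y), fres g c.V s = 0) ↔
      Ideal.span (Set.range c.y) ≤ RingHom.ker (fres g c.V) := Iff.rfl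
  rw [h2, Ideal.span_le]
  exact (Set.forall_mem_range (p := fun s => s ∈ RingHom.ker (fres g c.V))).symm

lemma quasiCompact (n : ℕ) [SmoothOfRelativeDimension n p] [Smooth G.proj]
    (hj : IsConeMap G.proj q G.sub S j)
    (hS : IsUniversalSub q d S) : QuasiCompact j := by
  have := hj.mono n G.isUniversalSub hS
  choose c hc using exists_obstructionChart (n := n) G
  refine (@HasAffineProperty.iff_of_iSup_eq_top @QuasiCompact (fun X _ _ _ => CompactSpace X)
    instHasAffinePropertyQuasiCompactCompactSpaceCarrierCarrierCommRingCat _ _ j _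
    (fun z => ⟨(c z).V, (c z).isAffineOpen⟩) (top_le_iff.1 fun z _ =>
      TopologicalSpace.Opens.mem_iSup.2 ⟨z, hc z⟩)).2 ?_
  intro z
  exact isCompact_iff_compactSpace.1
    (isCompact_preimage_of_fac (c z).isAffineOpen fun g hg => hj.exists_fac_iff_chart n hS
      (c z) g hg)

/-- The image of the cone map is defined in a chart by the functions `y`. -/
lemma ker_ideal (n : ℕ) [SmoothOfRelativeDimension n p] [Smooth G.proj]
    (hj : IsConeMap G.proj q G.sub S j)
    (hS : IsUniversalSub q d S) (c : ObstructionChart n G) :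
    j.ker.ideal ⟨c.V, c.isAffineOpen⟩ = Ideal.span (Set.range c.y) := by
  have := hj.quasiCompact n hS
  rw [Scheme.Hom.ker_apply]
  exact ker_eq_of_fac c.isAffineOpen fun g hg => hj.exists_fac_iff_chart n hS c g hg

/-- The obstruction vanishes on the image of the cone map, where the functions `y` vanish. -/
lemma zeroLocus_le_ker (n : ℕ) [SmoothOfRelativeDimension n p] [Smooth G.proj]
    (hj : IsConeMap G.proj q G.sub S j)
    (hS : IsUniversalSub q d S) : higgsIdeal G (simpsonField p) ≤ j.ker := by
  refine sInf_le ?_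
  refine pullMap_eq_zero _ _ fun z => ?_
  obtain ⟨c, hc⟩ := exists_obstructionChart (n := n) G (j.ker.subschemeι z)
  obtain ⟨t, ht, ht'⟩ := c.isAdapted.exists_lift (i := G.incl)
  refine ⟨c.V, Fin (d + 1), inferInstance, t, hc, ht, fun i => ?_⟩
  rw [c.cm_higgsObstruction_eq_zero_iff _ (t i) i (ht' i)]
  intro k l
  have h1 : c.b i l * c.y k ∈ RingHom.ker (j.ker.subschemeι.app c.V).hom := by
    rw [j.ker.ker_subschemeι_app ⟨c.V, c.isAffineOpen⟩, hj.ker_ideal n hS]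
    exact Ideal.mul_mem_left _ _ (Ideal.subset_span ⟨k, rfl⟩)
  exact h1

/-- The square of the ideal of the image of the cone map is contained in the ideal of the Higgs
Grassmannian: where the obstruction vanishes, so do the products of two of the functions `y`. -/
lemma ker_sq_le (n : ℕ) [SmoothOfRelativeDimension n p] [Smooth G.proj]
    (hj : IsConeMap G.proj q G.sub S j)
    (hS : IsUniversalSub q d S) : j.ker ^ 2 ≤ higgsIdeal G (simpsonField p) := by
  refine le_sInf fun I hI => ?_
  choose c hc using exists_obstructionChart (n := n) G
  -- `I` is any of the ideals of which `higgsIdeal` is the infimum: the obstruction vanishes along `I.subschemeι`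
  refine Scheme.IdealSheafData.le_of_iSup_eq_top (fun z => ⟨(c z).V, (c z).isAffineOpen⟩)
    (top_le_iff.1 fun z _ => TopologicalSpace.Opens.mem_iSup.2 ⟨z, hc z⟩) fun z => ?_
  generalize c z = c
  obtain ⟨t, ht, ht'⟩ := c.isAdapted.exists_lift (i := G.incl)
  have h1 : ∀ k l, c.b 0 l * c.y k ∈ I.ideal ⟨c.V, c.isAffineOpen⟩ := by
    intro k l
    rw [← I.ker_subschemeι_app ⟨c.V, c.isAffineOpen⟩]
    refine (c.cm_higgsObstruction_eq_zero_iff I.subschemeι (t 0) 0 (ht' 0)).1 ?_ k l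
    have h2 := pullMap_app (f := I.subschemeι) (higgsObstruction G (simpsonField p)) (t 0)
    rw [show (Scheme.Modules.pullback I.subschemeι).map (higgsObstruction G (simpsonField p)) = 0
      from hI] at h2
    exact h2.symm
  rw [Scheme.IdealSheafData.ideal_pow, Pi.pow_apply, hj.ker_ideal n hS, pow_two,
    Ideal.span_mul_span',
    Ideal.span_le]
  rintro _ ⟨_, ⟨k, rfl⟩, _, ⟨k', rfl⟩, rfl⟩
  exact c.y_mul_y_mem _ 0 h1 k k'

/-- The ideal of the Higgs Grassmannian lies between the ideal of the image of the cone map and its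
square; the former is radical since `K` is reduced, so it is the radical of the ideal of the Higgs
Grassmannian. -/
lemma radical_higgsIdeal (n : ℕ) [SmoothOfRelativeDimension n p] [Smooth G.proj] [IsReduced K]
    (hj : IsConeMap G.proj q G.sub S j) (hS : IsUniversalSub q d S) :
    (higgsIdeal G (simpsonField p)).radical = j.ker := by
  have := hj.quasiCompact n hS
  refine Scheme.IdealSheafData.ext (funext fun U => ?_)
  have h1 : (j.ker.ideal U).IsRadical := by
    rw [Scheme.Hom.ker_apply]
    intro s hs
    obtain ⟨m, hm⟩ := hs
    exact (show IsNilpotent ((j.app U).hom s) from ⟨m, by rw [← map_pow]; exact hm⟩).eq_zero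
  rw [Scheme.IdealSheafData.radical_ideal]
  apply le_antisymm
  · exact h1.radical_le_iff.2 (hj.zeroLocus_le_ker n hS U)
  · intro s hs
    refine ⟨2, hj.ker_sq_le n hS U ?_⟩
    rw [Scheme.IdealSheafData.ideal_pow]
    exact Ideal.pow_mem_pow hs 2

/-- The cone map is an isomorphism onto the reduced Higgs Grassmannian. -/
lemma exists_iso_higgsGrassmannianRed (n : ℕ) [SmoothOfRelativeDimension n p] [Smooth G.proj]
    [IsReduced K]
    (hj : IsConeMap G.proj q G.sub S j) (hS : IsUniversalSub q d S) :
    ∃ e : K ≅ higgsGrassmannianRed G (simpsonField p),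
      e.hom ≫ higgsGrassmannianRedι G (simpsonField p) = j := by
  have := hj.mono n G.isUniversalSub hS
  suffices h : ∀ J : G.total.IdealSheafData, J = j.ker → ∃ e : K ≅ J.subscheme,
      e.hom ≫ J.subschemeι = j from h _ (hj.radical_higgsIdeal n hS)
  rintro _ rfl
  -- the scheme-theoretic image of `j` factors through `j`, since `1` is in the subbundle over it
  have h1 : ∃ k, k ≫ j = j.ker.subschemeι := by
    rw [← hj.exists_fac_iff n G.isUniversalSub hS j.ker.subschemeι rfl]
    refine SubMod.local_mem _ fun z _ => ?_
    obtain ⟨c, hc⟩ := exists_obstructionChart (n := n) G (j.ker.subschemeι z)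
    refine ⟨j.ker.subschemeι ⁻¹ᵁ c.V, le_top, hc, ?_⟩
    rw [mres_oneSec, c.oneSec_mem_iff]
    intro k
    have h2 : c.y k ∈ RingHom.ker (j.ker.subschemeι.app c.V).hom := by
      rw [j.ker.ker_subschemeι_app ⟨c.V, c.isAffineOpen⟩, hj.ker_ideal n hS]
      exact Ideal.subset_span ⟨k, rfl⟩
    exact h2
  obtain ⟨k, hk⟩ := h1
  refine ⟨⟨j.toImage, k, ?_, ?_⟩, j.toImage_imageι⟩
  · rw [← cancel_mono j, Category.assoc, hk, Scheme.Hom.toImage_imageι, Category.id_comp]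
  · rw [← cancel_mono j.ker.subschemeι, Category.assoc]
    refine (congrArg (k ≫ ·) j.toImage_imageι).trans ?_
    rw [hk, Category.id_comp]

end IsConeMap

end HiggsIdeal

/-! ### Rank zero subbundles and the line subbundle of the Simpson system -/

section RankOne

variable {X T T' : Scheme.{0}} {p : X ⟶ Spec (.of ℂ)}

/-- The zero subsheaf. -/
def zeroSub (M : T.Modules) : SubMod M where
  carrier _ := ⊥
  res_mem h s hs := by
    rw [Submodule.mem_bot] at hs ⊢
    rw [hs, map_zero]
  local_mem {U s} h := by
    rw [Submodule.mem_bot]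
    refine eq_of_locally fun x hx => ?_
    obtain ⟨V, hV, hxV, h0⟩ := h x hx
    exact ⟨V, hV, hxV, h0.trans (map_zero _).symm⟩

lemma IsFrame.isAdapted_zeroSub {M : T.Modules} {V : T.Opens} {κ : Type} [Fintype κ]
    {e : Fin 0 ⊕ κ → Γ(M, V)} (he : IsFrame e) : (zeroSub M).IsAdapted e where
  isFrame := he
  mem_iff W h a := by
    change lc _ h a = 0 ↔ _
    constructor
    · intro h2 k
      have h3 : a = 0 := (he W h).1 (h2.trans (lc_zero _ _).symm)
      rw [h3]; rfl
    · intro h2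
      have h3 : a = 0 := by
        funext i
        rcases i with i | k
        · exact i.elim0
        · exact h2 k
      rw [h3]
      exact lc_zero _ _

lemma isSub_zeroSub {M : T.Modules} (hM : IsVectorBundle M) : (zeroSub M).IsSub 0 := fun x =>
  have ⟨U, r, _, hx, he⟩ := IsVectorBundle_iff.1 hM x
  ⟨U, r, _, hx, (he.reindex (Equiv.emptySum (Fin 0) (Fin r))).isAdapted_zeroSub⟩

lemma SubMod.IsSub.eq_zeroSub {M : T.Modules} {S : SubMod M} (hS : S.IsSub 0) : S = zeroSub M :=
  SubMod.eq_of_adapted fun x =>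
    have ⟨V, _, e, hx, he⟩ := hS x
    ⟨V, _, _, inferInstance, inferInstance, e, hx, he, he.isFrame.isAdapted_zeroSub⟩

/-- The base itself is the Grassmann bundle of rank `0` subbundles. -/
lemma isUniversalSub_id_zeroSub {E : X.Modules} (hE : IsVectorBundle
    ((Scheme.Modules.pullback (𝟙 X)).obj E)) :
    IsUniversalSub (E := E) (𝟙 X) 0 (zeroSub _) where
  isSub := isSub_zeroSub hE
  existsUnique f S hS := by
    refine ⟨f, ⟨Category.comp_id _, ?_⟩, fun g hg => ?_⟩
    · rw [hS.eq_zeroSub]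
      exact ((isSub_zeroSub hE).bc (isBC_bcm f _ _)).eq_zeroSub
    · obtain ⟨h, -⟩ := hg
      rw [← h, Category.comp_id]

lemma isVectorBundle_pullback {E : X.Modules} (hE : IsVectorBundle E) (f : T ⟶ X) :
    IsVectorBundle ((Scheme.Modules.pullback f).obj E) :=
  IsVectorBundle_iff.2 fun x =>
    have ⟨U, r, _, hx, he⟩ := IsVectorBundle_iff.1 hE (f x)
    ⟨f ⁻¹ᵁ U, r, _, hx, isBC_pullUnit f _ _ _ _ he⟩

/-- The decomposition of the identity of a biproduct, transported along isomorphisms of the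
biproduct and of its second summand. -/
lemma comp_biprod_total {C : Type*} [Category* C] [Preadditive C] [HasBinaryBiproducts C]
    {A B P Q : C}
    (i : P ≅ A ⊞ B) (j : Q ≅ B) (u : P ⟶ Q) (h : u ≫ j.hom = i.hom ≫ biprod.snd) :
    (i.hom ≫ biprod.fst) ≫ biprod.inl ≫ i.inv + u ≫ j.hom ≫ biprod.inr ≫ i.inv = 𝟙 P := by
  rw [reassoc_of% h]
  have h1 := biprod.total (X := A) (Y := B)
  calc _ = i.hom ≫ (biprod.fst ≫ biprod.inl + biprod.snd ≫ biprod.inr) ≫ i.inv := by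
        simp only [Preadditive.add_comp, Preadditive.comp_add, Category.assoc]
    _ = 𝟙 P := by rw [h1, Category.id_comp, i.hom_inv_id]

lemma simpsonLine_comp (p : X ⟶ Spec (.of ℂ)) :
    simpsonLine p ≫ (Scheme.Modules.pullbackId X).hom.app (simpson p) =
      (biprod.inl : structureSheaf X ⟶ simpson p) := by
  unfold simpsonLine
  rw [Category.assoc, Iso.inv_hom_id_app]
  exact Category.comp_id _

instance mono_simpsonLine (p : X ⟶ Spec (.of ℂ)) : Mono (simpsonLine p) := by
  have h : Mono (simpsonLine p ≫ (Scheme.Modules.pullbackId X).hom.app (simpson p)) := by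
    rw [simpsonLine_comp]
    exact inferInstanceAs (Mono (biprod.inl : structureSheaf X ⟶ structureSheaf X ⊞ cotangent p))
  exact mono_of_mono _ ((Scheme.Modules.pullbackId X).hom.app (simpson p))

/-- The kernel of `𝒪 ⊕ Ω¹ ⟶ Ω¹` is `𝒪`. -/
lemma comap_zeroSub_pullSnd (p : X ⟶ Spec (.of ℂ)) :
    (zeroSub _).comap (pullSnd p (𝟙 X)) = imageSub (simpsonLine p) := by
  have h1 : pullSnd p (𝟙 X) ≫ (Scheme.Modules.pullbackId X).hom.app (cotangent p) =
      (Scheme.Modules.pullbackId X).hom.app (simpson p) ≫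
        (biprod.snd : simpson p ⟶ cotangent p) :=
    (Scheme.Modules.pullbackId X).hom.naturality (biprod.snd : simpson p ⟶ cotangent p)
  have h2 : simpsonLine p ≫ pullSnd p (𝟙 X) = 0 := by
    rw [← cancel_mono ((Scheme.Modules.pullbackId X).hom.app (cotangent p)), Category.assoc, h1,
      ← Category.assoc, simpsonLine_comp, zero_comp]
    exact biprod.inl_snd
  have h3 : ((Scheme.Modules.pullbackId X).hom.app (simpson p) ≫
        (biprod.fst : simpson p ⟶ structureSheaf X)) ≫ simpsonLine p +
      pullSnd p (𝟙 X) ≫ (Scheme.Modules.pullbackId X).hom.app (cotangent p) ≫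
        (biprod.inr : cotangent p ⟶ simpson p) ≫ (Scheme.Modules.pullbackId X).inv.app (simpson p) =
      𝟙 _ := by
    exact comp_biprod_total ((Scheme.Modules.pullbackId X).app (simpson p))
      ((Scheme.Modules.pullbackId X).app (cotangent p)) _ h1
  ext U s
  rw [SubMod.mem_comap, mem_imageSub]
  constructor
  · intro h
    have h4 := app_of_eq h3 U s
    refine ⟨((Scheme.Modules.pullbackId X).hom.app (simpson p) ≫
        (biprod.fst : simpson p ⟶ structureSheaf X)).app U s, Eq.trans ?_ h4⟩
    refine (add_zero _).symm.trans (congrArg (_ + ·) ?_)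
    refine (map_zero (((Scheme.Modules.pullbackId X).hom.app (cotangent p) ≫
      (biprod.inr : cotangent p ⟶ simpson p) ≫
        (Scheme.Modules.pullbackId X).inv.app (simpson p)).app U).hom).symm.trans
      (congrArg _ (Eq.symm ?_))
    exact h
  · rintro ⟨t, rfl⟩
    exact app_of_eq h2 U t

end RankOne

/-! ### The reduced Higgs Grassmannian -/

section Reduction

variable {X : Scheme.{0}} (p : X ⟶ Spec (.of ℂ)) {d : ℕ}

/-- For rank `1`, the source of the cone map is `X`, as the Grassmann bundle of rank `0` subbundles,
and the cone map classifies the preimage `𝒪` of `0`. -/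
lemma higgsGrassmannianRed_iso_base (n : ℕ) [SmoothOfRelativeDimension n p]
    (G : GrassmannBundle (simpson p) 1) :
    ∃ e : X ≅ higgsGrassmannianRed G (simpsonField p),
      Classifies G.incl (e.hom ≫ higgsGrassmannianRedι G (simpsonField p)) (𝟙 X) (simpsonLine p) := by
  have : Smooth p := SmoothOfRelativeDimension.smooth n p
  have : Smooth G.proj := G.isUniversalSub.smooth (isVectorBundle_simpson p n)
  have : IsReduced X := isReduced_of_smooth p
  have hS := isUniversalSub_id_zeroSub (isVectorBundle_pullback (isVectorBundle_cotangent p n)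
    (𝟙 X))
  obtain ⟨j, hj⟩ := exists_isConeMap n G.isUniversalSub hS
  obtain ⟨e, he⟩ := hj.exists_iso_higgsGrassmannianRed n hS
  refine ⟨e, ?_⟩
  rw [he, classifies_iff G.isSub]
  exact ⟨hj.comp_eq, hj.bc_eq.trans (comap_zeroSub_pullSnd p)⟩

/-- The inverse of the isomorphism is the cone map. -/
lemma higgsGrassmannianRed_iso_cotangent (n : ℕ) [SmoothOfRelativeDimension n p]
    (G : GrassmannBundle (simpson p) (d + 1))
    (K : GrassmannBundle (cotangent p) d) :
    Nonempty (Over.mk (higgsGrassmannianRedι G (simpsonField p) ≫ G.proj) ≅ Over.mk K.proj) := by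
  have : Smooth p := SmoothOfRelativeDimension.smooth n p
  have : Smooth G.proj := G.isUniversalSub.smooth (isVectorBundle_simpson p n)
  have : Smooth K.proj := K.isUniversalSub.smooth (isVectorBundle_cotangent p n)
  have : IsReduced K.total := isReduced_of_smooth (K.proj ≫ p)
  obtain ⟨j, hj⟩ := exists_isConeMap n G.isUniversalSub K.isUniversalSub
  obtain ⟨e, he⟩ := hj.exists_iso_higgsGrassmannianRed n K.isUniversalSub
  refine ⟨(Over.isoMk e ?_).symm⟩
  exact (Category.assoc _ _ _).symm.trans ((congrArg (· ≫ G.proj) he).trans hj.comp_eq)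

end Reduction

/-! ### Orthogonal subbundles -/

section Duality

variable {X : Scheme.{0}} {M M' : X.Modules} {U V W : X.Opens} {ι κ σ τ : Type} [Fintype ι]
    [Fintype κ]
  [Fintype σ] [Fintype τ]

lemma IsFrame.coord_of_mres {e : ι → Γ(M, V)} (he : IsFrame e) (h : W ≤ V) (h' : U ≤ W)
    (s : Γ(M, U)) :
    (he.mres h).coord h' s = he.coord (h'.trans h) s :=
  (he U (h'.trans h)).1 (by
    rw [he.lc_coord, ← lc_mres e h h', IsFrame.lc_coord])

lemma IsFrame.coord_reindex {e : ι → Γ(M, V)} (he : IsFrame e) (ρ : κ ≃ ι) (h : W ≤ V) (s : Γ(M, W))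
    (k : κ) : (he.reindex ρ).coord h s k = he.coord h s (ρ k) := by
  have h1 : lc e h (he.coord h s) = lc (e ∘ ρ) h (he.coord h s ∘ ρ) :=
    (Fintype.sum_equiv ρ _ _ fun k => rfl).symm
  have h2 : (he.reindex ρ).coord h s = he.coord h s ∘ ρ :=
    ((he.reindex ρ) W h).1 (by rw [IsFrame.lc_coord, ← h1, he.lc_coord])
  rw [h2]; rfl

/-- Given sections `e'` of a module which are regarded as dual to a frame `e` of another module, the
sections dual to the frame `E`, i.e. the images of the `e'` under the inverse transpose of the
matrix which takes `e` to `E`. -/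
def dualOf (e : ι → Γ(M, V)) (e' : ι → Γ(M', V)) {E : κ → Γ(M, V)} (hE : IsFrame E) (l : κ) :
    Γ(M', V) :=
  lc e' le_rfl fun i => hE.coord le_rfl (e i) l

/-- The sections `e'` are recovered from the sections dual to `E`. -/
lemma lc_dualOf {e : ι → Γ(M, V)} (he : IsFrame e) (e' : ι → Γ(M', V)) {E : κ → Γ(M, V)}
    (hE : IsFrame E)
    (i : ι) : lc (dualOf e e' hE) le_rfl (fun l => he.coord le_rfl (E l) i) = e' i := by
  classical
  have h1 := hE.coord_mul_coord he
  unfold dualOf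
  rw [lc_matrix]
  have h2 : (fun j => ∑ l, he.coord le_rfl (E l) i * rres le_rfl (hE.coord le_rfl (e j) l)) =
      Pi.single i 1 := by
    funext j
    have h3 := congrFun (congrFun h1 j) i
    rw [Matrix.mul_apply] at h3
    simp only [rres_self]
    refine ((Finset.sum_congr rfl fun l _ => mul_comm _ _).trans h3).trans ?_
    rw [Matrix.one_apply, Pi.single_apply]
  rw [h2, lc_single, one_smul, mres_self]

lemma isFrame_dualOf {e : ι → Γ(M, V)} (he : IsFrame e) {e' : ι → Γ(M', V)} (he' : IsFrame e')
    {E : κ → Γ(M, V)} (hE : IsFrame E) : IsFrame (dualOf e e' hE) := by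
  classical
  refine he'.of_matrix ((Matrix.of fun i => hE.coord le_rfl (e i)).transpose)
    ((Matrix.of fun k => he.coord le_rfl (E k)).transpose) ?_ ?_
  · rw [← Matrix.transpose_mul, he.coord_mul_coord hE, Matrix.transpose_one]
  · rw [← Matrix.transpose_mul, hE.coord_mul_coord he, Matrix.transpose_one]

lemma coord_dualOf {e : ι → Γ(M, V)} (he : IsFrame e) {e' : ι → Γ(M', V)} (he' : IsFrame e')
    {E : κ → Γ(M, V)} (hE : IsFrame E) (i : ι) (l : κ) :
    (isFrame_dualOf he he' hE).coord le_rfl (e' i) l = he.coord le_rfl (E l) i := by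
  conv_lhs => rw [← lc_dualOf he e' hE i]
  rw [IsFrame.coord_lc]

/-- Passing from a pair of dual frames to another one does not affect the pairing. -/
lemma sum_coord_dualOf {e : ι → Γ(M, V)} (he : IsFrame e) {e' : ι → Γ(M', V)} (he' : IsFrame e')
    {E : κ → Γ(M, V)} (hE : IsFrame E) (h : W ≤ V) (m : Γ(M, W)) (s : Γ(M', W)) :
    ∑ l, hE.coord h m l * (isFrame_dualOf he he' hE).coord h s l =
      ∑ i, he.coord h m i * he'.coord h s i := by
  have h1 : ∀ l, (isFrame_dualOf he he' hE).coord h s l =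
      ∑ i, he'.coord h s i * rres h (he.coord le_rfl (E l) i) := by
    intro l
    have h2 : s = lc (fun i => lc (dualOf e e' hE) le_rfl (fun l => he.coord le_rfl (E l) i)) h
        (he'.coord h s) := by
      simp only [lc_dualOf, he'.lc_coord]
    conv_lhs => rw [h2]
    rw [lc_matrix, IsFrame.coord_lc]
  have h3 : ∀ i, he.coord h m i = ∑ l, hE.coord h m l * rres h (he.coord le_rfl (E l) i) := by
    intro i
    have h4 : m = lc (fun l => lc e le_rfl (he.coord le_rfl (E l))) h (hE.coord h m) := by
      simp only [he.lc_coord, hE.lc_coord]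
    conv_lhs => rw [h4]
    rw [lc_matrix, IsFrame.coord_lc]
  simp only [h1, h3, Finset.mul_sum, Finset.sum_mul]
  rw [Finset.sum_comm]
  exact Finset.sum_congr rfl fun i _ => Finset.sum_congr rfl fun l _ => by ring

lemma dualOf_mres (e : ι → Γ(M, V)) (e' : ι → Γ(M', V)) {E : κ → Γ(M, V)} (hE : IsFrame E)
    (h : W ≤ V) (l : κ) : dualOf (fun i => mres h (e i)) (fun i => mres h (e' i)) (hE.mres h) l =
      mres h (dualOf e e' hE l) := by
  unfold dualOf
  rw [mres_lc e' le_rfl h, lc_mres]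
  congr 1
  funext i
  rw [hE.coord_of_mres, hE.coord_mres le_rfl h]

lemma dualOf_cm {T : Scheme.{0}} {g : T ⟶ X} {P P' : T.Modules}
    {α : M ⟶ (Scheme.Modules.pushforward g).obj P} (hα : IsBC α)
    (α' : M' ⟶ (Scheme.Modules.pushforward g).obj P') (e : ι → Γ(M, V)) (e' : ι → Γ(M', V))
    {E : κ → Γ(M, V)} (hE : IsFrame E) (l : κ) :
    dualOf (fun i => cm α V (e i)) (fun i => cm α' V (e' i)) (hα V κ E hE) l =
      cm α' V (dualOf e e' hE l) := by
  unfold dualOf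
  rw [cm_lc]
  congr 1
  funext i
  rw [IsFrame.coord_cm hα hE]

/-- The data of a perfect pairing between two modules which are locally free of rank `n`, in the
form of the relation `D` which holds between dual frames. -/
structure IsDuality (n : ℕ) (D : ∀ V : X.Opens, (Fin n → Γ(M, V)) → (Fin n → Γ(M', V)) → Prop) :
    Prop where
  left : ∀ {V e e'}, D V e e' → IsFrame e
  right : ∀ {V e e'}, D V e e' → IsFrame e'
  res : ∀ {V W e e'} (h : W ≤ V), D V e e' → D W (fun i => mres h (e i)) (fun i => mres h (e' i))
  exists_mem : ∀ x : X, ∃ V e e', x ∈ V ∧ D V e e'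
  eq_dualOf : ∀ {V e e' E E'}, D V e e' → D V E E' → ∀ hE : IsFrame E, E' = dualOf e e' hE

namespace IsDuality

variable {n d d' : ℕ} {D : ∀ V : X.Opens, (Fin n → Γ(M, V)) → (Fin n → Γ(M', V)) → Prop}

/-- The roles of the two modules can be exchanged. -/
lemma swap (hD : IsDuality n D) : IsDuality n fun V e e' => D V e' e where
  left h := hD.right h
  right h := hD.left h
  res h h' := hD.res h h'
  exists_mem x :=
    have ⟨V, e, e', hx, h⟩ := hD.exists_mem x
    ⟨V, e', e, hx, h⟩
  eq_dualOf {V e' e E' E} h hE hE' := by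
    funext l
    have hF := hD.left hE
    have h1 := hD.eq_dualOf h hE hF
    clear hE
    subst h1
    unfold dualOf
    conv_lhs => rw [← (hD.left h).lc_coord le_rfl (E l)]
    congr 1
    funext i
    exact (coord_dualOf (hD.left h) (hD.right h) hF i l).symm

/-- The orthogonal of a subsheaf: the sections whose pairing with it, computed in dual frames, is
zero. -/
def perp (hD : IsDuality n D) (N : SubMod M) : SubMod M' where
  carrier U :=
    { carrier := { s | ∀ (W : X.Opens) (h : W ≤ U) (e e') (he : IsFrame e) (he' : IsFrame e'),
        D W e e' → ∀ m ∈ N.carrier W, ∑ i, he.coord le_rfl m i * he'.coord le_rfl (mres h s) i = 0 }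
      zero_mem' := fun W h e e' he he' _ m _ => by
        have h1 : he'.coord le_rfl (0 : Γ(M', W)) = 0 := by
          rw [← lc_zero e' le_rfl, he'.coord_lc]
        simp [h1]
      add_mem' := fun {a b} ha hb W h e e' he he' hW m hm => by
        rw [map_add, he'.coord_add]
        simp only [Pi.add_apply, mul_add, Finset.sum_add_distrib]
        rw [ha W h e e' he he' hW m hm, hb W h e e' he he' hW m hm, add_zero]
      smul_mem' := fun c a ha W h e e' he he' hW m hm => by
        rw [mres_smul, he'.coord_smul]
        have h1 := congrArg (rres h c * ·) (ha W h e e' he he' hW m hm)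
        simp only [mul_zero, Finset.mul_sum] at h1
        refine (Finset.sum_congr rfl fun i _ => ?_).trans h1
        simp only [Pi.smul_apply, smul_eq_mul]
        ring }
  res_mem h s hs W hW e e' he he' hD m hm := by
    rw [mres_mres]
    exact hs W (hW.trans h) e e' he he' hD m hm
  local_mem {U s} H W hW e e' he he' h m hm := by
    refine eq_of_locally_ring fun x hx => ?_
    obtain ⟨V, hV, hxV, hs⟩ := H x (hW hx)
    have h1 : W ⊓ V ≤ W := inf_le_left
    refine ⟨W ⊓ V, h1, ⟨hx, hxV⟩, ?_⟩
    have h2 := hs (W ⊓ V) inf_le_right _ _ (he.mres h1) (he'.mres h1) (hD.res h1 h)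
      (mres h1 m) (N.res_mem h1 hm)
    rw [map_zero, map_sum, ← h2]
    refine Finset.sum_congr rfl fun i _ => ?_
    rw [map_mul, he.coord_of_mres, he'.coord_of_mres, he.coord_mres le_rfl h1, mres_mres,
      ← mres_mres hW h1, he'.coord_mres le_rfl h1]

/-- The orthogonal of the span of a part of a frame is spanned by the complementary part of the dual
frame. -/
lemma isAdapted_perp (hD : IsDuality n D) {e : Fin n → Γ(M, V)} {e' : Fin n → Γ(M', V)}
    (h : D V e e')
    {N : SubMod M} {E : σ ⊕ τ → Γ(M, V)} (hE : N.IsAdapted E) :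
    (hD.perp N).IsAdapted (dualOf e e' hE.isFrame ∘ Equiv.sumComm τ σ) where
  isFrame := (isFrame_dualOf (hD.left h) (hD.right h) hE.isFrame).reindex _
  mem_iff W hW a := by
    classical
    have hE' := isFrame_dualOf (hD.left h) (hD.right h) hE.isFrame
    set s := lc (dualOf e e' hE.isFrame ∘ Equiv.sumComm τ σ) hW a with hs
    have h1 : ∀ l, hE'.coord hW s l = a ((Equiv.sumComm τ σ).symm l) := by
      intro l
      have h2 := (hE'.reindex (Equiv.sumComm τ σ)).coord_lc hW a
      rw [← h2, hE'.coord_reindex, Equiv.apply_symm_apply]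
    constructor
    · intro H k
      have h3 := H W le_rfl _ _ ((hD.left h).mres hW) ((hD.right h).mres hW) (hD.res hW h)
        (mres hW (E (.inl k))) (N.res_mem hW (hE.inl_mem k))
      simp only [(hD.left h).coord_of_mres hW, (hD.right h).coord_of_mres hW] at h3
      rw [← sum_coord_dualOf (hD.left h) (hD.right h) hE.isFrame, hE.isFrame.coord_self hW,
        mres_self,
        Finset.sum_eq_single (.inl k) (fun l _ hl => by rw [Pi.single_eq_of_ne hl, zero_mul]) (by simp),
        Pi.single_eq_same, one_mul, h1] at h3
      exact h3
    · intro H W' hW' ε ε' hε hε' hε'' m hm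
      have h4 := hD.eq_dualOf (hD.res (hW'.trans hW) h) hε'' hε
      subst h4
      rw [sum_coord_dualOf ((hD.left h).mres (hW'.trans hW)) ((hD.right h).mres (hW'.trans hW)) hε]
      simp only [(hD.left h).coord_of_mres (hW'.trans hW), (hD.right h).coord_of_mres
        (hW'.trans hW)]
      rw [← sum_coord_dualOf (hD.left h) (hD.right h) hE.isFrame]
      refine Finset.sum_eq_zero fun l _ => ?_
      rcases l with k | k
      · rw [hE'.coord_mres hW hW']
        simp only [h1]
        rw [show a ((Equiv.sumComm τ σ).symm (.inl k)) = 0 from H k, map_zero, mul_zero]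
      · rw [(hE.mem_iff_coord (hW'.trans hW) m).1 hm k, zero_mul]

lemma isSub_perp (hD : IsDuality n D) (hn : d + d' = n) {N : SubMod M} (hN : N.IsSub d) :
    (hD.perp N).IsSub d' := by
  intro x
  obtain ⟨V, r, E, hx, hE⟩ := hN x
  obtain ⟨V', e, e', hx', h⟩ := hD.exists_mem x
  have h1 : V ⊓ V' ≤ V := inf_le_left
  have h2 : V ⊓ V' ≤ V' := inf_le_right
  have h3 := hD.isAdapted_perp (hD.res h2 h) (hE.mres h1)
  have : Nonempty (V ⊓ V' : X.Opens) := ⟨⟨x, hx, hx'⟩⟩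
  have h4 : Fintype.card (Fin n) = Fintype.card (Fin d ⊕ Fin r) :=
    Matrix.square_of_invertible _ _
      ((hE.isFrame.mres h1).coord_mul_coord ((hD.left h).mres h2))
      (((hD.left h).mres h2).coord_mul_coord (hE.isFrame.mres h1))
  have h5 : r = d' := by simp at h4; omega
  subst h5
  exact ⟨V ⊓ V', d, _, ⟨hx, hx'⟩, h3⟩

lemma perp_perp (hD : IsDuality n D) {N : SubMod M} (hN : N.IsSub d) :
    hD.swap.perp (hD.perp N) = N := by
  refine SubMod.eq_of_adapted fun x => ?_
  obtain ⟨V, r, E, hx, hE⟩ := hN x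
  obtain ⟨V', e, e', hx', h⟩ := hD.exists_mem x
  have h1 : V ⊓ V' ≤ V := inf_le_left
  have h2 : V ⊓ V' ≤ V' := inf_le_right
  have hE := hE.mres h1
  have h := hD.res h2 h
  have h3 := hD.isAdapted_perp h hE
  refine ⟨V ⊓ V', _, _, inferInstance, inferInstance, _, ⟨hx, hx'⟩, ?_, hE⟩
  refine Eq.subst (motive := (hD.swap.perp (hD.perp N)).IsAdapted) (funext fun l => ?_)
    (hD.swap.isAdapted_perp h h3)
  have h4 := isFrame_dualOf (hD.left h) (hD.right h) hE.isFrame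
  conv_rhs => rw [← (hD.left h).lc_coord le_rfl (mres h1 (E l))]
  refine congrArg (lc (fun i => mres h2 (e i)) le_rfl) (funext fun i => ?_)
  refine (h4.coord_reindex (Equiv.sumComm _ _) le_rfl _ _).trans ?_
  refine (coord_dualOf (hD.left h) (hD.right h) hE.isFrame i _).trans ?_
  congr 2
  rcases l with l | l <;> rfl

/-- Taking orthogonals commutes with base change. -/
lemma perp_bc {T : Scheme.{0}} {g : T ⟶ X} {P P' : T.Modules}
    {α : M ⟶ (Scheme.Modules.pushforward g).obj P}
    (hα : IsBC α) {α' : M' ⟶ (Scheme.Modules.pushforward g).obj P'} (hα' : IsBC α')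
    {D' : ∀ V : T.Opens, (Fin n → Γ(P, V)) → (Fin n → Γ(P', V)) → Prop} (hD : IsDuality n D)
    (hD' : IsDuality n D') (H : ∀ {V e e'}, D V e e' →
      D' (g ⁻¹ᵁ V) (fun i => cm α V (e i)) (fun i => cm α' V (e' i)))
    {N : SubMod M} (hN : N.IsSub d) : hD'.perp (N.bc α) = (hD.perp N).bc α' := by
  refine SubMod.eq_of_adapted fun x => ?_
  obtain ⟨V, r, E, hx, hE⟩ := hN (g x)
  obtain ⟨V', e, e', hx', h⟩ := hD.exists_mem (g x)
  have h1 : V ⊓ V' ≤ V := inf_le_left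
  have h2 : V ⊓ V' ≤ V' := inf_le_right
  have hE := hE.mres h1
  have h := hD.res h2 h
  refine ⟨g ⁻¹ᵁ (V ⊓ V'), _, _, inferInstance, inferInstance, _, ⟨hx, hx'⟩, ?_,
    (hD.isAdapted_perp h hE).bc hα'⟩
  refine Eq.subst (motive := (hD'.perp (N.bc α)).IsAdapted) (funext fun l => ?_)
    (hD'.isAdapted_perp (H h) (hE.bc hα))
  exact dualOf_cm hα α' _ _ hE.isFrame _

end IsDuality

/-- The pullback of a duality, given by the pullbacks of dual frames. -/
def pullDual {T : Scheme.{0}} (f : T ⟶ X) {n : ℕ}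
    (D : ∀ V : X.Opens, (Fin n → Γ(M, V)) → (Fin n → Γ(M', V)) → Prop) (V : T.Opens)
    (E : Fin n → Γ((Scheme.Modules.pullback f).obj M, V))
    (E' : Fin n → Γ((Scheme.Modules.pullback f).obj M', V)) : Prop :=
  ∃ (W : X.Opens) (h : V ≤ f ⁻¹ᵁ W) (e : Fin n → Γ(M, W)) (e' : Fin n → Γ(M', W)), D W e e' ∧
    E = (fun i => mres h (cm (pullUnit f M) W (e i))) ∧
    E' = fun i => mres h (cm (pullUnit f M') W (e' i))

lemma IsDuality.pullDual {T : Scheme.{0}} (f : T ⟶ X) {n : ℕ}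
    {D : ∀ V : X.Opens, (Fin n → Γ(M, V)) → (Fin n → Γ(M', V)) → Prop} (hD : IsDuality n D) :
    IsDuality n (pullDual f D) where
  left := by
    rintro V _ _ ⟨W, h, e, e', hW, rfl, rfl⟩
    exact (isBC_pullUnit f _ _ _ _ (hD.left hW)).mres h
  right := by
    rintro V _ _ ⟨W, h, e, e', hW, rfl, rfl⟩
    exact (isBC_pullUnit f _ _ _ _ (hD.right hW)).mres h
  res := by
    rintro V V' _ _ hV ⟨W, h, e, e', hW, rfl, rfl⟩
    exact ⟨W, hV.trans h, e, e', hW, funext fun i => mres_mres _ _ _, funext fun i =>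
      mres_mres _ _ _⟩
  exists_mem x :=
    have ⟨V, e, e', hx, h⟩ := hD.exists_mem (f x)
    ⟨f ⁻¹ᵁ V, _, _, hx, V, le_rfl, e, e', h, rfl, rfl⟩
  eq_dualOf := by
    rintro V _ _ _ _ ⟨W, h, e, e', hW, rfl, rfl⟩ ⟨W₁, h₁, E, E', hW₁, rfl, rfl⟩
    have h2 : W ⊓ W₁ ≤ W := inf_le_left
    have h3 : W ⊓ W₁ ≤ W₁ := inf_le_right
    have h4 : V ≤ f ⁻¹ᵁ (W ⊓ W₁) := fun x hx => ⟨h hx, h₁ hx⟩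
    have hA := hD.res h2 hW
    have hB := hD.res h3 hW₁
    intro hE
    funext l
    have key := hD.eq_dualOf hA hB (hD.left hB)
    have h6 := dualOf_mres (fun i => cm (pullUnit f M) _ (mres h2 (e i)))
      (fun i => cm (pullUnit f M') _ (mres h2 (e' i))) (isBC_pullUnit f M _ _ _ (hD.left hB)) h4 l
    rw [dualOf_cm (isBC_pullUnit f M) (pullUnit f M') _ _ (hD.left hB), ← key] at h6
    have h7 : ∀ {N : X.Modules} {W W' : X.Opens} (h' : W' ≤ W) (h : V ≤ f ⁻¹ᵁ W')
      (h'' : V ≤ f ⁻¹ᵁ W)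
        (s : Γ(N, W)), mres h (cm (pullUnit f N) W' (mres h' s)) = mres h''
          (cm (pullUnit f N) W s) := by
      intro N W W' h' h h'' s
      rw [cm_mres, mres_mres]
    simp only [h7 h2 h4 h, h7 h3 h4 h₁] at h6
    exact h6.symm

lemma pullDual_bcm {T T' : Scheme.{0}} {f : T ⟶ X} {f' : T' ⟶ X} (g : T' ⟶ T) (h : g ≫ f = f')
    {n : ℕ}
    {D : ∀ V : X.Opens, (Fin n → Γ(M, V)) → (Fin n → Γ(M', V)) → Prop} {V : T.Opens}
    {e : Fin n → Γ((Scheme.Modules.pullback f).obj M, V)}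
    {e' : Fin n → Γ((Scheme.Modules.pullback f).obj M', V)} (H : pullDual f D V e e') :
    pullDual f' D (g ⁻¹ᵁ V) (fun i => cm (bcm g h M) V (e i)) (fun i => cm (bcm g h M') V (e' i)) := by
  obtain ⟨W, hW, e, e', H, rfl, rfl⟩ := H
  have h1 : g ⁻¹ᵁ V ≤ f' ⁻¹ᵁ W := (Scheme.Hom.preimage_mono g hW).trans (preimage_le_of_comp g h W)
  have h2 : ∀ {N : X.Modules} (s : Γ(N, W)), cm (bcm g h N) V (mres hW (cm (pullUnit f N) W s)) =
      mres h1 (cm (pullUnit f' N) W s) := by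
    intro N s
    rw [cm_mres, bcm_pullUnit]
    exact mres_mres _ _ _
  exact ⟨W, h1, e, e', H, funext fun i => h2 _, funext fun i => h2 _⟩

/-- The Grassmann bundles of complementary rank of two bundles in duality are isomorphic. -/
lemma IsDuality.nonempty_iso {n d d' : ℕ}
    {D : ∀ V : X.Opens, (Fin n → Γ(M, V)) → (Fin n → Γ(M', V)) → Prop} (hD : IsDuality n D)
    (hd : d + d' = n) (K : GrassmannBundle M d) (L : GrassmannBundle M' d') :
    Nonempty (Over.mk K.proj ≅ Over.mk L.proj) :=
  K.isUniversalSub.nonempty_iso_of_bijection L.isUniversalSub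
    (fun f => (hD.pullDual f).perp) (fun f => (hD.pullDual f).swap.perp)
    (fun f _ hS => (hD.pullDual f).isSub_perp hd hS)
    (fun f _ hS => (hD.pullDual f).swap.isSub_perp ((add_comm _ _).trans hd) hS)
    (fun f _ hS => (hD.pullDual f).perp_perp hS)
    (fun f _ hS => (hD.pullDual f).swap.perp_perp hS)
    (fun {_ _ f f'} g h _ hS => (hD.pullDual f).perp_bc (isBC_bcm g h M) (isBC_bcm g h M')
      (hD.pullDual f') (pullDual_bcm g h) hS)
    (fun {_ _ f f'} g h _ hS => (hD.pullDual f).swap.perp_bc (isBC_bcm g h M') (isBC_bcm g h M)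
      (hD.pullDual f').swap (pullDual_bcm g h) hS)

end Duality

/-! ### The duality of the cotangent and the tangent sheaf -/

section Dual

variable {X : Scheme.{0}} {M : X.Modules} {U V W : X.Opens} {ι κ : Type} [Fintype ι] [Fintype κ]

/-- The value of a linear form on a section. -/
def evalForm (h : W ≤ U) (m : Γ(M, W)) : PSec (homPresheaf M (structureSheaf X)) U →+
    Γ(structureSheaf X, W) where
  toFun f := (show homSections M (structureSheaf X) U from f).1 ⟨W, h⟩ m
  map_zero' := rfl
  map_add' _ _ := rfl

lemma evalForm_smul (h : W ≤ U) (m : Γ(M, W)) (a : Γ(X, U))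
    (f : PSec (homPresheaf M (structureSheaf X)) U) : evalForm h m (a • f) =
      rres h a • evalForm h m f := rfl

lemma evalForm_pres (h : W ≤ V) (h' : V ≤ U) (m : Γ(M, W))
    (f : PSec (homPresheaf M (structureSheaf X)) U) : evalForm h m (pres h' f) = evalForm
      (h.trans h') m f := rfl

lemma form_ext {f g : PSec (homPresheaf M (structureSheaf X)) U}
    (H : ∀ (W : X.Opens) (h : W ≤ U) (m : Γ(M, W)), evalForm h m f = evalForm h m g) : f = g :=
  Subtype.ext (funext fun W => LinearMap.ext fun m => H W.1 W.2 m)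

lemma evalForm_lc (f : PSec (homPresheaf M (structureSheaf X)) U) (e : ι → Γ(M, U)) (h : W ≤ U)
    (a : ι → Γ(X, W)) :
    evalForm h (lc e h a) f = secO W (∑ i, a i * rres h
      ((secO U).symm (evalForm le_rfl (e i) f))) := by
  have h1 : ∀ i, evalForm h (mres h (e i)) f = secO W
    (rres h ((secO U).symm (evalForm le_rfl (e i) f))) :=
    fun i => (show homSections M (structureSheaf X) U from f).2 ⟨U, le_rfl⟩ ⟨W, h⟩ h (e i)
  have h2 : evalForm h (lc e h a) f = ∑ i, a i • evalForm h (mres h (e i)) f :=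
    (map_sum ((show homSections M (structureSheaf X) U from f).1 ⟨W, h⟩) _ _).trans
      (Finset.sum_congr rfl fun i _ => LinearMap.map_smul _ _ _)
  rw [h2, map_sum]
  exact Finset.sum_congr rfl fun i _ => by rw [h1, ← smul_eq_mul, map_smul]

/-- The coordinate functions of a frame, as linear forms. -/
def IsFrame.coordForm {e : ι → Γ(M, V)} (he : IsFrame e) (i : ι) :
    PSec (homPresheaf M (structureSheaf X)) V :=
  show homSections M (structureSheaf X) V from
  ⟨fun W =>
    { toFun s := secO W.1 (he.coord W.2 s i)
      map_add' s t := by rw [he.coord_add]; rfl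
      map_smul' c s := by rw [he.coord_smul]; rfl },
    fun W W' h s => congrArg (secO W'.1) (congrFun (he.coord_mres W.2 h s) i)⟩

lemma IsFrame.evalForm_coordForm {e : ι → Γ(M, V)} (he : IsFrame e) (i : ι) (h : W ≤ V)
    (s : Γ(M, W)) :
    evalForm h s (he.coordForm i) = secO W (he.coord h s i) := rfl

lemma IsFrame.evalForm_sum {e : ι → Γ(M, V)} (he : IsFrame e) (h : U ≤ V) (h' : W ≤ U)
    (a : ι → Γ(X, U))
    (s : Γ(M, W)) : evalForm h' s (∑ i, a i • pres h (he.coordForm i)) =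
      secO W (∑ i, rres h' (a i) * he.coord (h'.trans h) s i) := by
  rw [map_sum, map_sum]
  refine Finset.sum_congr rfl fun i _ => ?_
  rw [evalForm_smul, evalForm_pres, he.evalForm_coordForm, ← smul_eq_mul, map_smul]

/-- The frame of the dual module which is dual to a given frame. -/
def IsFrame.dualFrame {e : ι → Γ(M, V)} (he : IsFrame e) (i : ι) :
    Γ(sheafHom M (structureSheaf X), V) :=
  toSh (homPresheaf M (structureSheaf X)) V (he.coordForm i)

lemma IsFrame.isFrame_dualFrame {e : ι → Γ(M, V)} (he : IsFrame e) : IsFrame he.dualFrame := by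
  classical
  refine isFrame_sheafify _ fun W hW x hx => ⟨W, le_rfl, hx, fun h =>
    ⟨fun a b hab => ?_, fun f => ?_⟩⟩
  · funext i
    have h1 := congrArg (evalForm le_rfl (HiggsGrass.mres h (e i))) hab
    simp only [he.evalForm_sum, he.coord_self, rres_self] at h1
    simpa [Pi.single_apply] using (secO W).injective h1
  · refine ⟨fun i => (secO W).symm (evalForm le_rfl (HiggsGrass.mres h (e i)) f),
        form_ext fun U hU s => ?_⟩
    rw [he.evalForm_sum]
    have h2 : s = lc (fun i => HiggsGrass.mres h (e i)) hU (he.coord (hU.trans h) s) := by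
      rw [lc_mres, he.lc_coord]
    conv_rhs => rw [h2, evalForm_lc]
    congr 1
    exact Finset.sum_congr rfl fun i _ => mul_comm _ _

/-- Dual frames transform by the inverse transpose. -/
lemma IsFrame.dualFrame_eq_dualOf {e : ι → Γ(M, V)} (he : IsFrame e) {E : κ → Γ(M, V)}
    (hE : IsFrame E) :
    hE.dualFrame = dualOf e he.dualFrame hE := by
  funext l
  have h1 : hE.coordForm l = ∑ i, hE.coord le_rfl (e i) l • pres le_rfl (he.coordForm i) := by
    refine form_ext fun W h s => ?_
    rw [he.evalForm_sum, hE.evalForm_coordForm]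
    congr 1
    have h2 : s = lc (fun i => lc E le_rfl (hE.coord le_rfl (e i))) h (he.coord h s) := by
      simp only [hE.lc_coord, he.lc_coord]
    conv_lhs => rw [h2]
    rw [lc_matrix, hE.coord_lc]
    exact Finset.sum_congr rfl fun i _ => mul_comm _ _
  unfold dualFrame dualOf
  rw [h1, map_sum]
  exact Finset.sum_congr rfl fun i _ => by rw [LinearMap.map_smul, toSh_pres]; rfl

lemma IsFrame.dualFrame_mres {e : ι → Γ(M, V)} (he : IsFrame e) (h : W ≤ V) (i : ι) :
    (he.mres h).dualFrame i = HiggsGrass.mres h (he.dualFrame i) := by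
  refine Eq.trans (congrArg (toSh _ W) (form_ext fun U hU s => ?_)) (toSh_pres h (he.coordForm i))
  rw [evalForm_pres, IsFrame.evalForm_coordForm, IsFrame.evalForm_coordForm, he.coord_of_mres]

/-- The duality between the cotangent and the tangent sheaf. -/
lemma isDuality_tangent (p : X ⟶ Spec (.of ℂ)) (n : ℕ) [SmoothOfRelativeDimension n p] :
    IsDuality (M := cotangent p) (M' := tangent p) n fun _ e e' => ∃ he : IsFrame e, e' =
      he.dualFrame where
  left := fun ⟨he, _⟩ => he
  right := by
    rintro V e _ ⟨he, rfl⟩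
    exact he.isFrame_dualFrame
  res := by
    rintro V W e _ h ⟨he, rfl⟩
    exact ⟨he.mres h, funext fun i => (he.dualFrame_mres h i).symm⟩
  exists_mem x :=
    have ⟨W, e, hx, he⟩ := exists_isFrame_cotangent p n x
    ⟨W, e, _, hx, he, rfl⟩
  eq_dualOf := by
    rintro V e _ E _ ⟨he, rfl⟩ ⟨hE, rfl⟩ _
    exact he.dualFrame_eq_dualOf hE

lemma isVectorBundle_tangent (p : X ⟶ Spec (.of ℂ)) (n : ℕ) [SmoothOfRelativeDimension n p] :
    IsVectorBundle (tangent p) :=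
  IsVectorBundle_iff.2 fun x =>
    have ⟨W, _, hx, he⟩ := exists_isFrame_cotangent p n x
    ⟨W, n, _, hx, he.isFrame_dualFrame⟩

end Dual

end HiggsGrass

end

theorem mainTheorem5 (X : Scheme.{0}) (p : X ⟶ Spec (.of ℂ)) (n : ℕ)
    [SmoothOfRelativeDimension n p] [IsSeparated p] [QuasiCompact p] :
    (Nonempty (GrassmannBundle (simpson p) 1) ∧
      ∀ G : GrassmannBundle (simpson p) 1,
        ∃ e : X ≅ higgsGrassmannianRed G (simpsonField p),
          Classifies G.incl (e.hom ≫ higgsGrassmannianRedι G (simpsonField p))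
            (𝟙 X) (simpsonLine p)) ∧
    ∀ d : ℕ, 2 ≤ d → d ≤ n →
      Nonempty (GrassmannBundle (simpson p) d) ∧
      Nonempty (GrassmannBundle (cotangent p) (d - 1)) ∧
      Nonempty (GrassmannBundle (tangent p) (n + 1 - d)) ∧
      ∀ (G : GrassmannBundle (simpson p) d) (K : GrassmannBundle (cotangent p) (d - 1))
        (L : GrassmannBundle (tangent p) (n + 1 - d)),
        Nonempty (Over.mk (higgsGrassmannianRedι G (simpsonField p) ≫ G.proj) ≅
          Over.mk K.proj) ∧
        Nonempty (Over.mk K.proj ≅ Over.mk L.proj) := by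
  refine ⟨⟨nonempty_grassmannBundle (isVectorBundle_simpson p n) 1,
    higgsGrassmannianRed_iso_base p n⟩, fun d hd hdn => ⟨nonempty_grassmannBundle
      (isVectorBundle_simpson p n) d, nonempty_grassmannBundle (isVectorBundle_cotangent p n) _,
      nonempty_grassmannBundle (isVectorBundle_tangent p n) _, fun G K L => ⟨?_, ?_⟩⟩⟩
  · obtain ⟨d, rfl⟩ : ∃ d', d = d' + 1 := ⟨d - 1, by omega⟩
    exact higgsGrassmannianRed_iso_cotangent p n G K
  · exact (isDuality_tangent p n).nonempty_iso (by omega) K L
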